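/- **Definitions.** An \emph{affine poset of order $n\ge 1$} is a partial order $\tilde P=(\mathbb Z,\preceq)$ such that $i\prec i+n$ for all $i$; $i\preceq j\iff i+n\preceq j+n$; and for all $i,j\in\mathbb Z$ there is $k\ge 0$ with $i\preceq j+kn$. A \emph{tube} is a nonempty subset $\tau\subseteq\mathbb Z$ that is convex ($i\prec j\prec k$, $i,k\in\tau$ imply $j\in\tau$), induces a connected subgraph of the Hasse diagram of $\tilde P$, and either equals $\mathbb Z$ or contains at most one element of each residue class modulo $n$. It is \emph{proper} if $|\tau|>1$ and $\tau\ne\mathbb Z$. Tubes $\tau$ and $\tau+dn$ ($d\in\mathbb Z$) are \emph{equivalent}. A \emph{tubing} is an $n$-periodic collection $\mathbf T$ of tubes (a union of equivalence classes), any two of which are nested or disjoint, such that the directed graph on $\mathbf T$ with an edge $\tau\to\tau'$ whenever $\tau\cap\tau'=\emptyset$ and $i\prec j$ for some $i\in\tau$, $j\in\tau'$ has no directed cycle; it is \emph{proper} if all its tubes are proper. Let $\mathcal K(\tilde P)$ be the abstract simplicial complex whose vertices are the equivalence classes of proper tubes and whose simplices are the sets of equivalence classes whose union is a proper tubing. Fix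 $c>0$. Let $V=\{x\in\mathbb R^n:\sum_i x_i=0\}$, with coordinates indexed by $0,\dots,n-1$, and extend $x\in V$ to $(\tilde x_i)_{i\in\mathbb Z}$ by $\tilde x_i=x_i$ for $0\le i<n$ and $\tilde x_{i+n}=\tilde x_i+c$. Let $$\mathscr O(\tilde P)=\{x\in V:\tilde x_i\le\tilde x_j\text{ for all }i\preceq j\},\qquad \mathscr O^\circ(\tilde P)=\{x\in V:\tilde x_i<\tilde x_j\text{ for all }i\prec j\}$$ be the affine order polytope and its interior. For $p\in\mathscr O^\circ(\tilde P)$ let $\mathscr O(\tilde P)^*_p=\{y\in V:\langle x-p,y\rangle\le 1\text{ for all }x\in\mathscr O(\tilde P)\}$ be the dual affine order polytope with respect to $p$, and for a proper tube $\tau$ let $$F_\tau=\{y\in\mathscr O(\tilde P)^*_p:\langle x-p,y\rangle=1\text{ for all }x\in\mathscr O(\tilde P)\text{ with }\tilde x\text{ constant on }\tau\},$$ the face dual to the face of $\mathscr O(\tilde P)$ on which $\tilde x$ is constant on $\tau$. A \emph{stellar subdivision} of a polytope $Q$ having the origin in its interior, at a nonempty face $F\subsetneq Q$, is a polytope $\operatorname{Conv}(Q\cup\{(1+\varepsilon)x\})$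 with $x$ in the relative interior of $F$ and $\varepsilon>0$ so small that $(1+\varepsilon)x$ lies strictly on the inner side of every facet of $Q$ not containing $F$. **Theorem (affine poset cyclohedron).** Let $\tilde P$ be an affine poset of order $n\ge1$ and let $c>0$. Then $\mathscr O^\circ(\tilde P)\neq\emptyset$, and for every $p\in\mathscr O^\circ(\tilde P)$ there is a simplicial polytope $\mathscr C(\tilde P)^*\subset V$ of dimension $n-1$ such that: 1. the boundary complex of $\mathscr C(\tilde P)^*$ is isomorphic to $\mathcal K(\tilde P)$; 2. $\mathscr C(\tilde P)^*$ is obtained from $\mathscr O(\tilde P)^*_p$ by a sequence of stellar subdivisions, one for each equivalence class of proper tubes, where each step is a stellar subdivision of the current polytope at its face $F_\tau$, with $\tau$ maximal by inclusion among the proper tubes whose equivalence classes have not been used before. -/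

import Mathlib

/-! ### Affine posets, tubes and tubings -/

/-- An affine poset of order `n`: a partial order on `ℤ` that is `n`-periodic, satisfies
`i ≺ i + n`, and is strongly connected. (The field `lt_add` forces `n ≥ 1`.) -/
structure AffinePoset (n : ℕ) where
  order : PartialOrder ℤ
  lt_add : ∀ i : ℤ, order.lt i (i + n)
  periodic : ∀ i j : ℤ, order.le i j ↔ order.le (i + n) (j + n)
  strongly_connected : ∀ i j : ℤ, ∃ k : ℕ, order.le i (j + k * n)

namespace AffinePoset

variable {n : ℕ} (P : AffinePoset n)

/-- The Hasse diagram of the affine poset, as a graph on `ℤ`. -/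
def hasse : SimpleGraph ℤ := @SimpleGraph.hasse ℤ P.order.toPreorder

/-- `τ` is convex: `i ≺ j ≺ k` with `i, k ∈ τ` implies `j ∈ τ`. -/
def IsConvexSet (τ : Set ℤ) : Prop :=
  ∀ i j k : ℤ, P.order.lt i j → P.order.lt j k → i ∈ τ → k ∈ τ → j ∈ τ

/-- A tube: a convex connected nonempty subset of `ℤ` which either is all of `ℤ` or contains at
most one element in each residue class modulo `n`. (`SimpleGraph.Connected` includes
non-emptiness.) -/
def IsTube (τ : Set ℤ) : Prop :=
  P.IsConvexSet τ ∧ (P.hasse.induce τ).Connected ∧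
    (τ = Set.univ ∨ ∀ i ∈ τ, ∀ j ∈ τ, i ≡ j [ZMOD n] → i = j)

/-- A proper tube: a tube with more than one element, different from the whole of `ℤ`. -/
def IsProperTube (τ : Set ℤ) : Prop :=
  P.IsTube τ ∧ τ.Nontrivial ∧ τ ≠ Set.univ

end AffinePoset

/-- The translate `τ + d n`. -/
def shiftSet (n : ℕ) (τ : Set ℤ) (d : ℤ) : Set ℤ := (fun i : ℤ => i + d * n) '' τ

/-- The equivalence class `{τ + d n | d ∈ ℤ}` of `τ`. -/
def shiftClass (n : ℕ) (τ : Set ℤ) : Set (Set ℤ) := Set.range (shiftSet n τ)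

namespace AffinePoset

variable {n : ℕ} (P : AffinePoset n)

/-- The edge relation of the directed graph `D_T` on a collection `T` of subsets of `ℤ`. -/
def TubeEdge (T : Set (Set ℤ)) (τ σ : Set ℤ) : Prop :=
  τ ∈ T ∧ σ ∈ T ∧ Disjoint τ σ ∧ ∃ i ∈ τ, ∃ j ∈ σ, P.order.lt i j

/-- A tubing: an `n`-periodic collection of tubes, any two of which are nested or disjoint, whose
directed graph `D_T` is acyclic. -/
structure IsTubing (T : Set (Set ℤ)) : Prop where
  tube : ∀ τ ∈ T, P.IsTube τ
  periodic : ∀ τ ∈ T, shiftClass n τ ⊆ T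
  nested_or_disjoint : ∀ τ ∈ T, ∀ σ ∈ T, τ ⊆ σ ∨ σ ⊆ τ ∨ Disjoint τ σ
  acyclic : ∀ τ : Set ℤ, ¬ Relation.TransGen (P.TubeEdge T) τ τ

/-- A proper tubing: a tubing all of whose tubes are proper. -/
def IsProperTubing (T : Set (Set ℤ)) : Prop :=
  P.IsTubing T ∧ ∀ τ ∈ T, P.IsProperTube τ

/-- The type of equivalence classes of proper tubes. -/
def ProperTubeClass : Type :=
  {O : Set (Set ℤ) // ∃ τ, P.IsProperTube τ ∧ O = shiftClass n τ}

variable {P}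

theorem IsTubing.mono_periodic {T T' : Set (Set ℤ)} (h : P.IsTubing T) (hT : T' ⊆ T)
    (hp : ∀ τ ∈ T', shiftClass n τ ⊆ T') : P.IsTubing T' where
  tube τ hτ := h.tube τ (hT hτ)
  periodic := hp
  nested_or_disjoint τ hτ σ hσ := h.nested_or_disjoint τ (hT hτ) σ (hT hσ)
  acyclic τ hτ := h.acyclic τ
    (Relation.TransGen.mono (r := P.TubeEdge T') (p := P.TubeEdge T)
      (fun _ _ e => ⟨hT e.1, hT e.2.1, e.2.2⟩) _ _ hτ)

theorem mem_shiftSet {τ : Set ℤ} {d i : ℤ} : i ∈ shiftSet n τ d ↔ i - d * n ∈ τ := by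
  constructor
  · rintro ⟨j, hj, rfl⟩
    simpa using hj
  · intro h
    exact ⟨_, h, by simp⟩

theorem shiftClass_periodic {τ σ : Set ℤ} (h : σ ∈ shiftClass n τ) :
    shiftClass n σ ⊆ shiftClass n τ := by
  obtain ⟨d, rfl⟩ := h
  rintro _ ⟨e, rfl⟩
  refine ⟨d + e, ?_⟩
  ext i
  simp only [mem_shiftSet]
  ring_nf

theorem le_translate_nat (i j : ℤ) (k : ℕ) :
    P.order.le (i + k * n) (j + k * n) ↔ P.order.le i j := by
  induction k with
  | zero => simp
  | succ k ih =>
    rw [← ih, P.periodic (i + k * n) (j + k * n)]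
    push_cast
    ring_nf

theorem le_translate (i j d : ℤ) :
    P.order.le (i + d * n) (j + d * n) ↔ P.order.le i j := by
  obtain ⟨k, rfl | rfl⟩ := d.eq_nat_or_neg
  · exact le_translate_nat i j k
  · rw [← le_translate_nat (i + -(k : ℤ) * n) _ k]
    ring_nf

theorem lt_translate (i j d : ℤ) :
    P.order.lt (i + d * n) (j + d * n) ↔ P.order.lt i j := by
  rw [P.order.lt_iff_le_not_ge, P.order.lt_iff_le_not_ge, le_translate, le_translate]

theorem lt_add_mul_nat (i : ℤ) (k : ℕ) (hk : 0 < k) : P.order.lt i (i + k * n) := by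
  induction k, hk using Nat.le_induction with
  | base => simpa using P.lt_add i
  | succ k hk ih =>
    have h := @lt_trans ℤ P.order.toPreorder _ _ _ ih (P.lt_add (i + k * n))
    have e : i + ((k + 1 : ℕ) : ℤ) * n = i + k * n + n := by push_cast; ring
    rw [e]; exact h

theorem order_pos (P : AffinePoset n) : 0 < n := by
  rcases Nat.eq_zero_or_pos n with rfl | h
  · have := P.lt_add 0
    simp only [Nat.cast_zero, add_zero] at this
    exact absurd this (@lt_irrefl ℤ P.order.toPreorder 0)
  · exact h

theorem shiftSet_isTube {τ : Set ℤ} (h : P.IsTube τ) (d : ℤ) : P.IsTube (shiftSet n τ d) := by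
  obtain ⟨hc, hconn, hr⟩ := h
  refine ⟨?_, ?_, ?_⟩
  · intro i j k hij hjk hi hk
    rw [mem_shiftSet] at hi hk ⊢
    refine hc _ _ _ ?_ ?_ hi hk
    · rw [← lt_translate _ _ d]; simpa using hij
    · rw [← lt_translate _ _ d]; simpa using hjk
  · have cov : ∀ a b : ℤ, P.hasse.Adj a b → P.hasse.Adj (a + d * n) (b + d * n) := by
      have key : ∀ a b : ℤ, @CovBy ℤ P.order.toLT a b →
          @CovBy ℤ P.order.toLT (a + d * n) (b + d * n) := by
        rintro a b ⟨h1, h2⟩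
        refine ⟨(lt_translate a b d).2 h1, fun c hac hcb => ?_⟩
        refine @h2 (c - d * n) ?_ ?_
        · exact (lt_translate _ _ d).1 (by simpa using hac)
        · exact (lt_translate _ _ d).1 (by simpa using hcb)
      rintro a b (h | h)
      · exact Or.inl (key _ _ h)
      · exact Or.inr (key _ _ h)
    let f : P.hasse.induce τ →g P.hasse.induce (shiftSet n τ d) :=
      { toFun := fun a => ⟨a.1 + d * n, a.1, a.2, rfl⟩
        map_rel' := fun {a b} hab => cov a.1 b.1 hab }
    refine hconn.map f ?_
    rintro ⟨_, a, ha, rfl⟩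
    exact ⟨⟨a, ha⟩, rfl⟩
  · rcases hr with rfl | hr
    · left; ext i; simp [mem_shiftSet]
    · right
      rintro _ ⟨a, ha, rfl⟩ _ ⟨b, hb, rfl⟩ hab
      have : a = b := hr a ha b hb (by simpa [Int.ModEq] using hab)
      simp [this]

theorem shiftSet_isProperTube {τ : Set ℤ} (h : P.IsProperTube τ) (d : ℤ) :
    P.IsProperTube (shiftSet n τ d) := by
  refine ⟨shiftSet_isTube h.1 d, ?_, ?_⟩
  · exact h.2.1.image (add_left_injective _)
  · intro hu
    apply h.2.2
    ext i
    have : i + d * n ∈ shiftSet n τ d := hu ▸ Set.mem_univ _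
    rw [mem_shiftSet] at this
    simpa using this

/-- The equivalence class of a single proper tube is a proper tubing. -/
theorem shiftClass_isProperTubing {τ : Set ℤ} (h : P.IsProperTube τ) :
    P.IsProperTubing (shiftClass n τ) := by
  have hn := P.order_pos
  have hr : ∀ i ∈ τ, ∀ j ∈ τ, i ≡ j [ZMOD n] → i = j := h.1.2.2.resolve_left h.2.2
  have hprop : ∀ σ ∈ shiftClass n τ, P.IsProperTube σ := by
    rintro _ ⟨d, rfl⟩
    exact shiftSet_isProperTube h d
  refine ⟨⟨fun σ hσ => (hprop σ hσ).1, fun σ hσ => shiftClass_periodic hσ, ?_, ?_⟩, hprop⟩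
  · rintro _ ⟨d, rfl⟩ _ ⟨e, rfl⟩
    by_cases hde : d = e
    · left; rw [hde]
    · right; right
      rw [Set.disjoint_left]
      intro i hi hi'
      rw [mem_shiftSet] at hi hi'
      apply hde
      have := hr _ hi _ hi' (by simp [Int.ModEq])
      have h2 : d * (n : ℤ) = e * n := by linarith
      exact mul_right_cancel₀ (by exact_mod_cast hn.ne') h2
  · -- every edge strictly increases the translation number
    have hedge : ∀ d e : ℤ, P.TubeEdge (shiftClass n τ) (shiftSet n τ d) (shiftSet n τ e) →
        d < e := by
      rintro d e ⟨-, -, hdis, i, hi, j, hj, hij⟩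
      by_contra hlt
      rcases (not_lt.1 hlt).eq_or_lt with rfl | hlt
      · rw [disjoint_self] at hdis
        have : i ∈ (⊥ : Set ℤ) := hdis ▸ hi
        exact this
      · obtain ⟨k, hk⟩ := Int.eq_ofNat_of_zero_le (sub_pos.2 hlt).le
        have hk0 : 0 < k := by omega
        have hjk := P.lt_add_mul_nat j k hk0
        have hjk' : j + (k : ℤ) * n ∈ shiftSet n τ d := by
          rw [mem_shiftSet] at hj ⊢
          have : d = e + k := by linarith
          rw [this]
          have e2 : j + (k : ℤ) * n - (e + k) * n = j - e * n := by ring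
          rwa [e2]
        have := (shiftSet_isTube h.1 d).1 i j _ hij hjk hi hjk'
        exact Set.disjoint_left.1 hdis this hj
    have hpath : ∀ σ ρ, Relation.TransGen (P.TubeEdge (shiftClass n τ)) σ ρ →
        ∃ d e, σ = shiftSet n τ d ∧ ρ = shiftSet n τ e ∧ d < e := by
      intro σ ρ hp
      induction hp with
      | single hs =>
        obtain ⟨d, rfl⟩ := hs.1
        obtain ⟨e, rfl⟩ := hs.2.1
        exact ⟨d, e, rfl, rfl, hedge d e hs⟩
      | tail _ hs ih =>
        obtain ⟨d, e, rfl, rfl, hde⟩ := ih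
        obtain ⟨f, rfl⟩ := hs.2.1
        exact ⟨d, f, rfl, rfl, hde.trans (hedge e f hs)⟩
    intro σ hσ
    obtain ⟨d, e, rfl, he, hde⟩ := hpath σ σ hσ
    obtain ⟨i, hi⟩ := h.2.1.nonempty
    have h1 : i + d * n ∈ shiftSet n τ e := he ▸ ⟨i, hi, rfl⟩
    rw [mem_shiftSet] at h1
    have := hr _ hi _ h1 (by simp [Int.ModEq])
    have h2 : d * (n : ℤ) = e * n := by linarith
    exact hde.ne (mul_right_cancel₀ (by exact_mod_cast hn.ne') h2)

variable (P)

/-- The abstract simplicial complex whose vertices are the equivalence classes of proper tubes, and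
whose simplices are the proper tubings, a tubing being identified with the finite set of
equivalence classes of which it is the union. -/
def cyclohedronComplex : AbstractSimplicialComplex P.ProperTubeClass where
  faces := {S | S.Nonempty ∧ P.IsProperTubing (⋃ O ∈ S, O.1)}
  isRelLowerSet_faces := by
    rintro S ⟨hS, hT⟩
    refine ⟨hS, fun S' hSS' hne => ⟨hne, ?_⟩⟩
    have hsub : (⋃ O ∈ S', O.1) ⊆ ⋃ O ∈ S, O.1 := Set.biUnion_subset_biUnion_left hSS'
    refine ⟨hT.1.mono_periodic hsub ?_, fun τ hτ => hT.2 τ (hsub hτ)⟩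
    intro τ hτ
    simp only [Set.mem_iUnion] at hτ
    obtain ⟨O, hO, hτO⟩ := hτ
    obtain ⟨σ, -, hσ⟩ := O.2
    refine Set.Subset.trans ?_ (Set.subset_biUnion_of_mem (u := fun O => O.1) hO)
    rw [hσ] at hτO ⊢
    exact shiftClass_periodic hτO
  singleton_mem := by
    rintro ⟨O, τ, hτ, rfl⟩
    refine ⟨Finset.singleton_nonempty _, ?_⟩
    have e : (⋃ O ∈ ({⟨shiftClass n τ, τ, hτ, rfl⟩} : Finset P.ProperTubeClass), O.1) =
        shiftClass n τ := Finset.set_biUnion_singleton _ _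
    exact e.symm ▸ shiftClass_isProperTubing hτ

end AffinePoset

/-! ### Polytopes -/

section Polytopes

variable {E : Type*} [NormedAddCommGroup E] [InnerProductSpace ℝ E]

/-- A polytope: the convex hull of a finite nonempty set of points. -/
def IsPolytope (Q : Set E) : Prop :=
  ∃ s : Finset E, s.Nonempty ∧ Q = convexHull ℝ (s : Set E)

/-- `F` is a face of the polytope `Q` other than `Q` itself. The empty set is such a face of any
polytope; the nonempty ones are the intersections of `Q` with supporting hyperplanes. -/
def IsProperFace (Q F : Set E) : Prop := IsExposed ℝ Q F ∧ F ≠ Q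

/-- A facet: a maximal proper face. -/
def IsFacet (Q G : Set E) : Prop := Maximal (IsProperFace Q) G

/-- A simplicial polytope: one all of whose proper faces are simplices. -/
def IsSimplicialPolytope (Q : Set E) : Prop :=
  IsPolytope Q ∧ ∀ F, IsProperFace Q F →
    ∃ s : Finset E, AffineIndependent ℝ ((↑) : s → E) ∧ F = convexHull ℝ (s : Set E)

/-- The dimension of a nonempty set: the dimension of its affine span. -/
noncomputable def polytopeDim (Q : Set E) : ℕ := Module.finrank ℝ (vectorSpan ℝ Q)

/-- The boundary complex of a simplicial polytope: its simplices are the nonempty finite sets of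
vertices that lie on a common proper face. -/
def boundaryComplex (Q : Set E) : PreAbstractSimplicialComplex E where
  faces := {S | S.Nonempty ∧ (S : Set E) ⊆ Q.extremePoints ℝ ∧
    ∃ F, IsProperFace Q F ∧ (S : Set E) ⊆ F}
  isRelLowerSet_faces := by
    rintro S ⟨hS, hv, F, hF, hSF⟩
    refine ⟨hS, fun S' hSS' hne => ⟨hne, ?_, F, hF, ?_⟩⟩
    · exact (Finset.coe_subset.2 hSS').trans hv
    · exact (Finset.coe_subset.2 hSS').trans hSF

/-- An isomorphism of simplicial complexes: a bijection between the vertices (the points whose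
singletons are simplices) under which simplices correspond to simplices. -/
def ComplexesIsomorphic {α β : Type*} (K : PreAbstractSimplicialComplex α)
    (L : PreAbstractSimplicialComplex β) : Prop :=
  ∃ f : {v : α // {v} ∈ K.faces} ≃ {w : β // {w} ∈ L.faces},
    ∀ S : Finset {v : α // {v} ∈ K.faces},
      S.map (Function.Embedding.subtype _) ∈ K.faces ↔
        (S.map f.toEmbedding).map (Function.Embedding.subtype _) ∈ L.faces

/-- The polar dual of `A` with respect to the base point `p`. -/
def polarDual (A : Set E) (p : E) : Set E := {y | ∀ x ∈ A, inner ℝ (x - p) y ≤ 1}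

/-- The face of the polar dual of `A` that is dual to the face `F` of `A`. -/
def dualFace (A : Set E) (p : E) (F : Set E) : Set E :=
  {y ∈ polarDual A p | ∀ x ∈ F, inner ℝ (x - p) y = 1}

/-- `Q'` is a stellar subdivision of the polytope `Q` (with the origin in its interior) at its
proper nonempty face `F`: for some point `x` in the relative interior of `F` and some sufficiently
small `ε > 0`, it is the convex hull of `Q` and `(1 + ε) x`. Sufficiently small means that
`(1 + ε) x` still lies strictly on the inner side of each facet of `Q` that does not contain
`F`. -/
def IsStellarSubdivision (Q F Q' : Set E) : Prop :=
  IsPolytope Q ∧ (0 : E) ∈ interior Q ∧ F.Nonempty ∧ IsProperFace Q F ∧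
    ∃ x ∈ intrinsicInterior ℝ F, ∃ ε : ℝ, 0 < ε ∧
      (∀ G, IsFacet Q G → ¬ F ⊆ G → ∀ l : StrongDual ℝ E,
        (∀ y ∈ Q, l y ≤ 1) → G = {y ∈ Q | l y = 1} → l ((1 + ε) • x) < 1) ∧
      Q' = convexHull ℝ (insert ((1 + ε) • x) Q)

end Polytopes

/-! ### The affine order polytope and the subdivision process -/

/-- The space of vectors in `ℝⁿ`, indexed by the residues modulo `n`, with zero coordinate sum. -/
noncomputable def sumZero (n : ℕ) [NeZero n] : Submodule ℝ (EuclideanSpace ℝ (ZMod n)) where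
  carrier := {x | ∑ a, x a = 0}
  zero_mem' := by simp
  add_mem' := by
    intro x y hx hy
    simp only [Set.mem_ofPred_eq, PiLp.add_apply, Finset.sum_add_distrib] at *
    rw [hx, hy, add_zero]
  smul_mem' := by
    intro t x hx
    simp only [Set.mem_ofPred_eq, PiLp.smul_apply, smul_eq_mul, ← Finset.mul_sum] at *
    rw [hx, mul_zero]

/-- The sequence `x̃` with `x̃ (i + n) = x̃ i + c` for all `i` and `x̃ i` equal to the `i`-th
coordinate of `x` for `0 ≤ i < n`. -/
noncomputable def periodicExtension {n : ℕ} [NeZero n] (c : ℝ) (x : sumZero n) (i : ℤ) : ℝ :=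
  (x : EuclideanSpace ℝ (ZMod n)) (i : ZMod n) + c * ((i / (n : ℤ) : ℤ) : ℝ)

namespace AffinePoset

variable {n : ℕ} [NeZero n] (P : AffinePoset n) (c : ℝ)

/-- The affine order polytope. -/
def orderPolytope : Set (sumZero n) :=
  {x | ∀ i j : ℤ, P.order.le i j → periodicExtension c x i ≤ periodicExtension c x j}

/-- The configuration space: the interior of the affine order polytope. -/
def orderInterior : Set (sumZero n) :=
  {x | ∀ i j : ℤ, P.order.lt i j → periodicExtension c x i < periodicExtension c x j}

/-- The face of the affine order polytope corresponding to the tubing partition into the translates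
of the tube `τ` and the remaining singletons: the points for which `x̃` is constant on `τ` (hence on
each of its translates). -/
def orderFace (τ : Set ℤ) : Set (sumZero n) :=
  {x ∈ P.orderPolytope c |
    ∀ i ∈ τ, ∀ j ∈ τ, periodicExtension c x i = periodicExtension c x j}

/-- `P.SubdivisionStage c p M Q`: starting from the polar dual (with respect to `p`) of the affine
order polytope, one may arrive at `Q` by a sequence of stellar subdivisions, one for each
equivalence class contained in the set `M` of proper tubes. In each step, `τ` is a proper tube that
is maximal by inclusion among the proper tubes outside `M`, the polytope is subdivided at the face
dual to `P.orderFace c τ`, and the equivalence class of `τ` is added to `M`. -/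
inductive SubdivisionStage (p : sumZero n) : Set (Set ℤ) → Set (sumZero n) → Prop
  | base : SubdivisionStage p ∅ (polarDual (P.orderPolytope c) p)
  | step {M : Set (Set ℤ)} {Q Q' : Set (sumZero n)} {τ : Set ℤ}
      (stage : SubdivisionStage p M Q)
      (maximal : Maximal (fun σ => P.IsProperTube σ ∧ σ ∉ M) τ)
      (stellar : IsStellarSubdivision Q
        (dualFace (P.orderPolytope c) p (P.orderFace c τ)) Q') :
      SubdivisionStage p (M ∪ shiftClass n τ) Q'

end AffinePoset

/-!
In the polar picture the theorem is about truncations of the order polytope. Fix a finite set of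
relations `i ≺ j` that implies all others (`minimalPairs`), and for a class `O` of proper tubes let
`O.spread x̃` be the sum of the differences `x̃ j - x̃ i` over the relations inside a tube of `O`.
On the order polytope it is nonnegative, and it vanishes exactly where `x̃` is constant on the tubes of
`O`. Adding to the dual polytope a vertex `(1 + ε) x`, with `x` the suitably weighted barycenter of
the face `F_τ`, means cutting the order polytope by the inequality `δ O ≤ O.spread x̃`, where the
threshold `δ O > 0` is small if `ε` is. So the final polytope is dual to the set of all `x` in the
order polytope whose spreads are at least the thresholds, and a proper face of it corresponds to the
set of classes whose thresholds are attained at some such `x`.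

The thresholds are chosen one after the other (`exists_next_stage`). All that is asked of them is
that each is small enough for its stellar subdivision (`eventually_stellar`), for the faces of the
remaining tubes to stay faces, and compared to the thresholds of the larger tubes, which have been
chosen before (`IsHierarchical`).

Two facts then determine the boundary complex.

* The tubes whose thresholds are attained at a point `x` form a tubing (`isTubingFamily_tight`). If
  two of them overlapped without being nested, or if some of them formed a directed cycle, then they
  would lie in one strongly connected component of the relation that allows going up in the poset
  and moving freely within these tubes. A step of this relation hardly decreases `x̃`, and by
  quasi-periodicity the small losses cannot add up (`path_bound`). Hence `x̃` is almost constant on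
  the component, which therefore is itself a proper tube, strictly larger than the given ones
  (`backComponent_isTube`). But its threshold is much larger than theirs, a contradiction.
* The cones spanned by tubings intersect as in a fan: a nonnegative combination of the new vertices
  that is supported on a tubing determines its coefficients (`eq_of_sum_newVertex_eq`). By
  acyclicity, for every tubing there is a point of the order polytope that is constant exactly on
  the tubes contained in a tube of the tubing (`exists_spread_eq_zero_iff`); so the zeros of the
  combination reveal the maximal tubes, which can be split off.

The second fact gives the linear independence of the vertices of a face, so that the polytope is
simplicial, and shows that all the new vertices are extreme. It also provides the faces: for a
tubing, the ray through the sum of its new vertices leaves the polytope in a point of a proper face;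
this face is spanned by the vertices of some tubing by the first fact, and that tubing contains the
given one by the second (`exists_face_of_tubing`).
-/

namespace AffinePoset

variable {n : ℕ} {P : AffinePoset n}

/-! ### Order-theoretic preliminaries -/

theorem le_refl' (P : AffinePoset n) (i : ℤ) : P.order.le i i := P.order.le_refl i

theorem le_trans' {i j k : ℤ} (h : P.order.le i j) (h' : P.order.le j k) : P.order.le i k :=
  P.order.le_trans i j k h h'

theorem le_antisymm' {i j : ℤ} (h : P.order.le i j) (h' : P.order.le j i) : i = j :=
  P.order.le_antisymm i j h h'

theorem lt_iff' {i j : ℤ} : P.order.lt i j ↔ P.order.le i j ∧ i ≠ j :=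
  @lt_iff_le_and_ne ℤ P.order i j

theorem le_of_lt' {i j : ℤ} (h : P.order.lt i j) : P.order.le i j := (lt_iff'.1 h).1

theorem lt_of_lt_of_le' {i j k : ℤ} (h : P.order.lt i j) (h' : P.order.le j k) :
    P.order.lt i k := @lt_of_lt_of_le ℤ P.order.toPreorder _ _ _ h h'

theorem lt_irrefl' {i : ℤ} (h : P.order.lt i i) : False := (lt_iff'.1 h).2 rfl

theorem lt_add_mul (P : AffinePoset n) (i : ℤ) {d : ℤ} (hd : 0 < d) :
    P.order.lt i (i + d * n) := by
  obtain ⟨k, rfl⟩ := Int.eq_ofNat_of_zero_le hd.le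
  exact P.lt_add_mul_nat i k (by exact_mod_cast hd)

theorem le_add_mul (P : AffinePoset n) (i : ℤ) {d : ℤ} (hd : 0 ≤ d) :
    P.order.le i (i + d * n) := by
  rcases hd.eq_or_lt with rfl | hd
  · simpa using P.le_refl' i
  · exact le_of_lt' (P.lt_add_mul i hd)

theorem cast_pos (P : AffinePoset n) : (0 : ℤ) < n := by exact_mod_cast P.order_pos

theorem modEq_exists {i j : ℤ} (h : i ≡ j [ZMOD n]) : ∃ d : ℤ, j = i + d * n := by
  obtain ⟨d, hd⟩ := h.dvd
  exact ⟨d, by linarith⟩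

theorem exists_le_add_mul (P : AffinePoset n) (i j : ℤ) : ∃ t : ℤ, P.order.le i (j + t * n) := by
  obtain ⟨k, hk⟩ := P.strongly_connected i j
  exact ⟨k, hk⟩

/-! ### Strictly monotone quasi-periodic functions -/

/-- Every periodic preorder `r` on `ℤ` that extends an affine poset, and in which `i + n` is
strictly above `i`, has a strictly monotone quasi-periodic real function: add up, over the residues
`k`, the index of the largest `k + m n` below the argument. -/
theorem exists_strictMono_quasiperiodic (P : AffinePoset n) (c : ℝ) (hc : 0 < c)
    (r : ℤ → ℤ → Prop)
    (htrans : ∀ i j k, r i j → r j k → r i k) (hle : ∀ i j, P.order.le i j → r i j)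
    (hper : ∀ i j d : ℤ, r i j → r (i + d * n) (j + d * n))
    (hstrict : ∀ i : ℤ, ¬ r (i + n) i) :
    ∃ f : ℤ → ℝ, (∀ i d : ℤ, f (i + d * n) = f i + d * c) ∧ (∀ i j, r i j → f i ≤ f j) ∧
      ∀ i j, r i j → ¬ r j i → f i < f j := by
  have hn := P.cast_pos
  have key : ∀ k i : ℤ, ∃ m : ℤ, r (k + m * n) i ∧ ∀ m' : ℤ, r (k + m' * n) i → m' ≤ m := by
    intro k i
    apply Int.exists_greatest_of_bdd
    · obtain ⟨t, ht⟩ := P.exists_le_add_mul i k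
      refine ⟨t, fun m hm => ?_⟩
      by_contra hlt
      have h1 : r (k + m * n) (k + t * n) := htrans _ _ _ hm (hle _ _ ht)
      have h2 : r (k + t * n + n) (k + m * n) := by
        apply hle
        have := P.le_add_mul (k + t * n + n) (d := m - t - 1) (by omega)
        convert this using 1
        ring
      exact hstrict _ (htrans _ _ _ h2 h1)
    · obtain ⟨t, ht⟩ := P.exists_le_add_mul k i
      refine ⟨-t, hle _ _ ?_⟩
      rw [← P.le_translate _ _ t]
      convert ht using 1
      ring
  choose N hN hNmax using key
  have hmono : ∀ k i j, r i j → N k i ≤ N k j := fun k i j hij =>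
    hNmax _ _ _ (htrans _ _ _ (hN k i) hij)
  have hshift : ∀ k i d : ℤ, N k (i + d * n) = N k i + d := by
    intro k i d
    apply le_antisymm
    · have h := hper _ _ (-d) (hN k (i + d * n))
      have e1 : i + d * n + -d * n = i := by ring
      have e2 : k + N k (i + d * n) * n + -d * n = k + (N k (i + d * n) - d) * n := by ring
      rw [e1, e2] at h
      linarith [hNmax _ _ _ h]
    · have h := hper _ _ d (hN k i)
      have e2 : k + N k i * n + d * n = k + (N k i + d) * n := by ring
      rw [e2] at h
      exact hNmax _ _ _ h
  have hn' : (0 : ℝ) < n := by exact_mod_cast hn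
  refine ⟨fun i => c / n * ∑ k ∈ Finset.Ico (0 : ℤ) n, (N k i : ℝ), ?_, ?_, ?_⟩
  · intro i d
    simp only [hshift]
    push_cast
    rw [Finset.sum_add_distrib]
    simp only [Finset.sum_const, Int.card_Ico, sub_zero, Int.toNat_natCast, nsmul_eq_mul]
    field_simp
  · intro i j hij
    refine mul_le_mul_of_nonneg_left (Finset.sum_le_sum fun k _ => ?_) (by positivity)
    exact_mod_cast hmono k i j hij
  · intro i j hij hji
    refine mul_lt_mul_of_pos_left (Finset.sum_lt_sum (fun k _ => ?_) ⟨j % n, ?_, ?_⟩)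
      (by positivity)
    · exact_mod_cast hmono k i j hij
    · exact Finset.mem_Ico.2 ⟨Int.emod_nonneg _ hn.ne', Int.emod_lt_of_pos _ hn⟩
    · have e : j % n + j / n * n = j := by rw [mul_comm]; exact Int.emod_add_mul_ediv j n
      have h1 : j / n ≤ N (j % n) j := by
        apply hNmax
        rw [e]
        exact hle _ _ (P.le_refl' j)
      have h2 : N (j % n) i < j / n := by
        by_contra hcon
        apply hji
        refine htrans _ _ _ (hle _ _ ?_) (hN (j % n) i)
        have := P.le_add_mul j (d := N (j % n) i - j / n) (by omega)
        convert this using 1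
        linarith [sub_mul (N (j % n) i) (j / n) (n : ℤ)]
      exact_mod_cast h2.trans_le h1

/-! ### Almost monotone relations -/

/-- If every step of a relation decreases a quasi-periodic function by at most `g`, then so does
every path, up to a factor `n`: among the `n` windows of length `g` below the starting value, one
contains no value of the function (its values in a window shorter than the quasi-period have
distinct residues), and no path can cross that window. -/
theorem path_bound {c g : ℝ} (hn : 0 < n) {f : ℤ → ℝ} (hf : ∀ i d : ℤ, f (i + d * n) = f i + d * c)
    (hg : 0 ≤ g) (hgc : n * g < c) {R : ℤ → ℤ → Prop} (hR : ∀ a b, R a b → f a - g ≤ f b)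
    {i j : ℤ} (hij : Relation.ReflTransGen R i j) : f i - n * g ≤ f j := by
  by_contra! hlt
  have hwin : ∀ s : Fin n, ∃ k : ℤ, f i - s * g - g ≤ f k ∧ f k < f i - s * g := by
    intro s
    by_contra! hno
    have hreach : ∀ k, Relation.ReflTransGen R i k → f i - s * g ≤ f k := by
      intro k hk
      induction hk with
      | refl =>
        have : 0 ≤ (s : ℝ) * g := by positivity
        linarith
      | tail _ hab ih =>
        exact hno _ (by linarith [hR _ _ hab])
    have h1 := hreach j hij
    have h2 : (s : ℝ) * g ≤ n * g :=
      mul_le_mul_of_nonneg_right (by exact_mod_cast s.2.le) hg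
    linarith
  choose k hk1 hk2 using hwin
  have hlow : ∀ s : Fin n, f i - n * g ≤ f (k s) := by
    intro s
    have : ((s : ℝ) + 1) * g ≤ n * g :=
      mul_le_mul_of_nonneg_right (by exact_mod_cast s.2) hg
    linarith [hk1 s]
  have hhigh : ∀ s : Fin n, f (k s) < f i := by
    intro s
    have : 0 ≤ (s : ℝ) * g := by positivity
    linarith [hk2 s]
  have hc : 0 < c := lt_of_le_of_lt (by positivity) hgc
  have hres : ∀ a b : ℤ, (a : ZMod n) = b → |f a - f b| < c → a = b := by
    intro a b hab hfab
    obtain ⟨d, rfl⟩ := modEq_exists ((ZMod.intCast_eq_intCast_iff a b n).1 hab)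
    rw [hf, abs_lt] at hfab
    have h1 : (d : ℝ) < 1 := by
      by_contra! h
      nlinarith
    have h2 : (-1 : ℝ) < d := by
      by_contra! h
      nlinarith
    have h1' : d < 1 := by exact_mod_cast h1
    have h2' : -1 < d := by exact_mod_cast h2
    have : d = 0 := by omega
    simp [this]
  have : NeZero n := ⟨hn.ne'⟩
  let F : Option (Fin n) → ZMod n := fun o =>
    o.elim ((i : ℤ) : ZMod n) fun s => ((k s : ℤ) : ZMod n)
  have hF : ¬ Function.Injective F := by
    intro h
    have := Fintype.card_le_of_injective F h
    simp [ZMod.card] at this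
  apply hF
  have hlt' : ∀ s t : Fin n, k s = k t → ¬ s < t := by
    intro s t hst hlt
    have h1 := hk1 s
    have h2 := hk2 t
    rw [hst] at h1
    have : ((s : ℝ) + 1) * g ≤ t * g :=
      mul_le_mul_of_nonneg_right (by exact_mod_cast hlt) hg
    linarith
  rintro (_ | s) (_ | t) hst
  · rfl
  · have := hres i (k t) hst (by rw [abs_lt]; constructor <;> linarith [hlow t, hhigh t])
    exact absurd (hhigh t) (by rw [← this]; exact lt_irrefl _)
  · have := hres (k s) i hst (by rw [abs_lt]; constructor <;> linarith [hlow s, hhigh s])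
    exact absurd (hhigh s) (by rw [this]; exact lt_irrefl _)
  · have h := hres (k s) (k t) hst
      (by rw [abs_lt]; constructor <;> linarith [hlow s, hhigh s, hlow t, hhigh t])
    rcases lt_trichotomy s t with h1 | h1 | h1
    · exact absurd h1 (hlt' _ _ h)
    · rw [h1]
    · exact absurd h1 (hlt' _ _ h.symm)

/-! ### Connectedness of convex sets -/

theorem finite_of_residues (hn : 0 < n) {E : Set ℤ}
    (hE : ∀ i ∈ E, ∀ j ∈ E, i ≡ j [ZMOD n] → i = j) : E.Finite := by
  have : NeZero n := ⟨hn.ne'⟩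
  refine Set.Finite.of_injOn (f := fun i : ℤ => (i : ZMod n)) (t := Set.univ) (fun _ _ => trivial)
    ?_ Set.finite_univ
  intro i hi j hj hij
  exact hE i hi j hj ((ZMod.intCast_eq_intCast_iff i j n).1 hij)

/-- In a finite convex set, comparable elements are joined by a chain of covering relations. -/
theorem hasse_reachable_of_le {E : Set ℤ} (hconv : P.IsConvexSet E) (hfin : E.Finite)
    (a b : E) (hab : P.order.le a b) : (P.hasse.induce E).Reachable a b := by
  suffices H : ∀ m : ℕ, ∀ a b : E, P.order.le a b →
      {k | P.order.lt a k ∧ P.order.lt k b}.ncard ≤ m → (P.hasse.induce E).Reachable a b from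
    H _ a b hab le_rfl
  have hsub : ∀ a b : E, {k | P.order.lt a k ∧ P.order.lt k b} ⊆ E := fun a b k hk =>
    hconv a k b hk.1 hk.2 a.2 b.2
  intro m
  induction m with
  | zero =>
    intro a b hab hcard
    by_cases hne : a = b
    · rw [hne]
    have hlt : P.order.lt a b := lt_iff'.2 ⟨hab, fun h => hne (Subtype.ext h)⟩
    have hemp := (Set.ncard_eq_zero (hfin.subset (hsub a b))).1 (Nat.le_zero.1 hcard)
    refine SimpleGraph.Adj.reachable (G := P.hasse.induce E) (Or.inl ⟨hlt, fun k h1 h2 => ?_⟩)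
    have : k ∈ {k | P.order.lt a k ∧ P.order.lt k b} := ⟨h1, h2⟩
    rw [hemp] at this
    exact this
  | succ m ih =>
    intro a b hab hcard
    rcases Set.eq_empty_or_nonempty {k | P.order.lt a k ∧ P.order.lt k b} with hemp | ⟨k, hak, hkb⟩
    · exact ih a b hab (by rw [hemp]; simp)
    have hk : k ∈ E := hsub a b ⟨hak, hkb⟩
    refine (ih a ⟨k, hk⟩ (le_of_lt' hak) ?_).trans (ih ⟨k, hk⟩ b (le_of_lt' hkb) ?_)
    · refine Nat.le_of_lt_succ (lt_of_lt_of_le (Set.ncard_lt_ncard ?_ (hfin.subset (hsub a b)))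
        hcard)
      refine ⟨fun l hl => ⟨hl.1, lt_of_lt_of_le' hl.2 (le_of_lt' hkb)⟩, fun h => ?_⟩
      exact lt_irrefl' (h (show k ∈ {k | P.order.lt a k ∧ P.order.lt k b} from ⟨hak, hkb⟩)).2
    · refine Nat.le_of_lt_succ (lt_of_lt_of_le (Set.ncard_lt_ncard ?_ (hfin.subset (hsub a b)))
        hcard)
      refine ⟨fun l hl => ⟨lt_of_lt_of_le' hak (le_of_lt' hl.1), hl.2⟩, fun h => ?_⟩
      exact lt_irrefl' (h (show k ∈ {k | P.order.lt a k ∧ P.order.lt k b} from ⟨hak, hkb⟩)).1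

/-- The relation generated by an affine poset and by the possibility of going back along the pairs
of `W`. -/
def backRel (P : AffinePoset n) (W : ℤ → ℤ → Prop) (a b : ℤ) : Prop := P.order.le a b ∨ W b a

/-- The strongly connected component of `a` for `backRel`. -/
def backComponent (P : AffinePoset n) (W : ℤ → ℤ → Prop) (a : ℤ) : Set ℤ :=
  {b | Relation.ReflTransGen (P.backRel W) a b ∧ Relation.ReflTransGen (P.backRel W) b a}

section Component

variable {W : ℤ → ℤ → Prop} {c g : ℝ} {f : ℤ → ℝ}

theorem mem_backComponent_self (a : ℤ) : a ∈ P.backComponent W a :=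
  ⟨Relation.ReflTransGen.refl, Relation.ReflTransGen.refl⟩

theorem reflTransGen_of_mem_backComponent {a i j : ℤ} (hi : i ∈ P.backComponent W a)
    (hj : j ∈ P.backComponent W a) : Relation.ReflTransGen (P.backRel W) i j :=
  hi.2.trans hj.1

theorem backComponent_bound (hf : ∀ i d : ℤ, f (i + d * n) = f i + d * c)
    (hmono : ∀ i j, P.order.le i j → f i ≤ f j) (hg : 0 ≤ g) (hgc : n * g < c)
    (hW : ∀ a b, W a b → f b ≤ f a + g)
    {a i j : ℤ} (hi : i ∈ P.backComponent W a) (hj : j ∈ P.backComponent W a) :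
    f i - n * g ≤ f j := by
  refine path_bound P.order_pos hf hg hgc ?_ (reflTransGen_of_mem_backComponent hi hj)
  rintro a b (h | h)
  · linarith [hmono _ _ h]
  · linarith [hW _ _ h]

/-- If going back along `W` decreases `f` only slightly, then the strongly connected components are
tubes with at most one element in each residue class. -/
theorem backComponent_isTube (hf : ∀ i d : ℤ, f (i + d * n) = f i + d * c)
    (hmono : ∀ i j, P.order.le i j → f i ≤ f j) (hg : 0 ≤ g) (hgc : n * g < c)
    (hWle : ∀ a b, W a b → P.order.le a b) (hW : ∀ a b, W a b → f b ≤ f a + g) (a : ℤ) :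
    P.IsTube (P.backComponent W a) ∧ P.backComponent W a ≠ Set.univ := by
  set E := P.backComponent W a with hE
  have hres : ∀ i ∈ E, ∀ j ∈ E, i ≡ j [ZMOD n] → i = j := by
    intro i hi j hj hij
    obtain ⟨d, rfl⟩ := modEq_exists hij
    have h1 := backComponent_bound hf hmono hg hgc hW hi hj
    have h2 := backComponent_bound hf hmono hg hgc hW hj hi
    rw [hf] at h1 h2
    have hc : 0 < c := lt_of_le_of_lt (by positivity) hgc
    have h1 : (d : ℝ) < 1 := by
      by_contra! h
      nlinarith
    have h2 : (-1 : ℝ) < d := by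
      by_contra! h
      nlinarith
    have h1' : d < 1 := by exact_mod_cast h1
    have h2' : -1 < d := by exact_mod_cast h2
    have : d = 0 := by omega
    simp [this]
  have hconv : P.IsConvexSet E := by
    intro i j k hij hjk hi hk
    exact ⟨hi.1.tail (Or.inl (le_of_lt' hij)),
      (hk.2.head (Or.inl (le_of_lt' hjk)))⟩
  have hfin := finite_of_residues P.order_pos hres
  refine ⟨⟨hconv, ?_, Or.inr hres⟩, ?_⟩
  · have hstep : ∀ b (hb : b ∈ E),
        (P.hasse.induce E).Reachable ⟨a, mem_backComponent_self a⟩ ⟨b, hb⟩ := by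
      intro b hb
      obtain ⟨h1, h2⟩ := hb
      induction h1 with
      | refl => rfl
      | @tail b d hab hbd ih =>
        have hb : b ∈ E := ⟨hab, h2.head hbd⟩
        refine (ih hb.2).trans ?_
        rcases hbd with h | h
        · exact hasse_reachable_of_le hconv hfin _ _ h
        · exact (hasse_reachable_of_le hconv hfin _ _ (hWle _ _ h)).symm
    have : Nonempty E := ⟨⟨a, mem_backComponent_self a⟩⟩
    refine SimpleGraph.Connected.mk fun u v => ?_
    exact (hstep u.1 u.2).symm.trans (hstep v.1 v.2)
  · intro hu
    have h0 : (0 : ℤ) ∈ E := hu ▸ Set.mem_univ _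
    have h1 : (n : ℤ) ∈ E := hu ▸ Set.mem_univ _
    have := hres 0 h0 n h1 (by simp [Int.ModEq])
    exact P.cast_pos.ne this

end Component

end AffinePoset

namespace AffinePoset

variable {n : ℕ} {P : AffinePoset n}

/-! ### Tubes and their classes -/

theorem IsProperTube.residues {τ : Set ℤ} (h : P.IsProperTube τ) :
    ∀ i ∈ τ, ∀ j ∈ τ, i ≡ j [ZMOD n] → i = j := h.1.2.2.resolve_left h.2.2

theorem IsProperTube.finite {τ : Set ℤ} (h : P.IsProperTube τ) : τ.Finite :=
  finite_of_residues P.order_pos h.residues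

theorem IsProperTube.ncard_le {τ : Set ℤ} (h : P.IsProperTube τ) : τ.ncard ≤ n := by
  have : NeZero n := ⟨P.order_pos.ne'⟩
  have := Set.ncard_le_ncard_of_injOn (s := τ) (t := (Set.univ : Set (ZMod n)))
    (fun i : ℤ => (i : ZMod n)) (fun _ _ => trivial)
    (fun i hi j hj hij => h.residues i hi j hj ((ZMod.intCast_eq_intCast_iff i j n).1 hij))
  simpa [Set.ncard_univ, Nat.card_eq_fintype_card, ZMod.card] using this

theorem IsProperTube.eq_zero_of_shift {τ : Set ℤ} (h : P.IsProperTube τ) {i d : ℤ} (hi : i ∈ τ)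
    (hi' : i + d * n ∈ τ) : d = 0 := by
  have := h.residues _ hi _ hi' (by simp [Int.ModEq])
  have h2 : d * (n : ℤ) = 0 := by linarith
  exact (mul_eq_zero.1 h2).resolve_right P.cast_pos.ne'

theorem convex_le {τ : Set ℤ} (h : P.IsConvexSet τ) {i j k : ℤ} (hij : P.order.le i j)
    (hjk : P.order.le j k) (hi : i ∈ τ) (hk : k ∈ τ) : j ∈ τ := by
  by_cases h1 : i = j
  · exact h1 ▸ hi
  by_cases h2 : j = k
  · exact h2 ▸ hk
  exact h i j k (lt_iff'.2 ⟨hij, h1⟩) (lt_iff'.2 ⟨hjk, h2⟩) hi hk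

/-- To propagate a property through a tube it suffices to propagate it along comparabilities. -/
theorem IsTube.induction {τ : Set ℤ} (h : P.IsTube τ) {p : ℤ → Prop} {a : ℤ} (ha : a ∈ τ)
    (hp : p a) (hstep : ∀ i ∈ τ, ∀ j ∈ τ, P.order.lt i j ∨ P.order.lt j i → p i → p j) :
    ∀ b ∈ τ, p b := by
  intro b hb
  have hr := (h.2.1.preconnected ⟨a, ha⟩ ⟨b, hb⟩)
  rw [SimpleGraph.reachable_iff_reflTransGen] at hr
  suffices H : ∀ y : τ, Relation.ReflTransGen (P.hasse.induce τ).Adj ⟨a, ha⟩ y → p y from H _ hr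
  intro y hy
  induction hy with
  | refl => exact hp
  | @tail u v _ huv ih =>
    refine hstep _ u.2 _ v.2 ?_ ih
    rcases huv with h | h
    · exact Or.inl h.1
    · exact Or.inr h.1

/-- The class of a proper tube. -/
def tubeClass (τ : Set ℤ) (h : P.IsProperTube τ) : P.ProperTubeClass := ⟨shiftClass n τ, τ, h, rfl⟩

theorem mem_shiftClass_self (τ : Set ℤ) : τ ∈ shiftClass n τ := ⟨0, by simp [shiftSet]⟩

namespace ProperTubeClass

theorem isProperTube (O : P.ProperTubeClass) {τ : Set ℤ} (h : τ ∈ O.1) : P.IsProperTube τ := by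
  obtain ⟨σ, hσ, e⟩ := O.2
  rw [e] at h
  obtain ⟨d, rfl⟩ := h
  exact shiftSet_isProperTube hσ d

theorem nonempty (O : P.ProperTubeClass) : ∃ τ, τ ∈ O.1 := by
  obtain ⟨σ, hσ, e⟩ := O.2
  exact ⟨σ, e ▸ mem_shiftClass_self σ⟩

theorem shift_mem (O : P.ProperTubeClass) {τ : Set ℤ} (h : τ ∈ O.1) (d : ℤ) :
    shiftSet n τ d ∈ O.1 := by
  obtain ⟨σ, hσ, e⟩ := O.2
  rw [e] at h ⊢
  exact shiftClass_periodic h ⟨d, rfl⟩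

theorem exists_shift (O : P.ProperTubeClass) {τ σ : Set ℤ} (h : τ ∈ O.1) (h' : σ ∈ O.1) :
    ∃ d, σ = shiftSet n τ d := by
  obtain ⟨ρ, hρ, e⟩ := O.2
  rw [e] at h h'
  obtain ⟨d, rfl⟩ := h
  obtain ⟨d', rfl⟩ := h'
  refine ⟨d' - d, ?_⟩
  ext i
  simp only [mem_shiftSet]
  ring_nf

theorem eq_shiftClass (O : P.ProperTubeClass) {τ : Set ℤ} (h : τ ∈ O.1) :
    O.1 = shiftClass n τ := by
  ext σ
  constructor
  · intro hσ
    obtain ⟨d, rfl⟩ := O.exists_shift h hσ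
    exact ⟨d, rfl⟩
  · rintro ⟨d, rfl⟩
    exact O.shift_mem h d

theorem eq_tubeClass (O : P.ProperTubeClass) {τ : Set ℤ} (h : τ ∈ O.1) :
    O = tubeClass τ (O.isProperTube h) := Subtype.ext (O.eq_shiftClass h)

theorem eq_of_mem {O O' : P.ProperTubeClass} {τ : Set ℤ} (h : τ ∈ O.1) (h' : τ ∈ O'.1) :
    O = O' := (O.eq_tubeClass h).trans (O'.eq_tubeClass h').symm

end ProperTubeClass

/-! ### A finite set of order relations that implies all others -/

/-- The relations `i ≺ j` with `0 ≤ i < n` and `j` as small as possible in its residue class. -/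
def minimalPairSet (P : AffinePoset n) : Set (ℤ × ℤ) :=
  {q | 0 ≤ q.1 ∧ q.1 < n ∧ P.order.lt q.1 q.2 ∧ ¬ P.order.lt q.1 (q.2 - n)}

theorem minimalPairSet_finite (P : AffinePoset n) : P.minimalPairSet.Finite := by
  have : NeZero n := ⟨P.order_pos.ne'⟩
  refine Set.Finite.of_injOn (f := fun q : ℤ × ℤ => (q.1, (q.2 : ZMod n)))
    (t := Set.Ico (0 : ℤ) n ×ˢ (Set.univ : Set (ZMod n))) (fun q hq => ⟨⟨hq.1, hq.2.1⟩, trivial⟩) ?_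
    ((Set.finite_Ico _ _).prod Set.finite_univ)
  have key : ∀ i j : ℤ, ∀ d : ℤ, 0 < d → P.order.lt i j → ¬ P.order.lt i (j + d * n - n) →
      False := by
    intro i j d hd h1 h2
    apply h2
    refine lt_of_lt_of_le' h1 ?_
    have := P.le_add_mul j (d := d - 1) (by omega)
    convert this using 1
    ring
  rintro ⟨i, j⟩ hq ⟨i', j'⟩ hq' h
  simp only [Prod.mk.injEq] at h
  obtain ⟨rfl, h⟩ := h
  obtain ⟨d, rfl⟩ := modEq_exists ((ZMod.intCast_eq_intCast_iff j j' n).1 h)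
  rcases lt_trichotomy d 0 with hd | rfl | hd
  · refine (key i (j + d * n) (-d) (by omega) hq'.2.2.1 ?_).elim
    convert hq.2.2.2 using 3
    ring
  · simp
  · exact (key i j d hd hq.2.2.1 hq'.2.2.2).elim

/-- The relations `i ≺ j` with `0 ≤ i < n` and `j` as small as possible in its residue class, as a
finite set. -/
noncomputable def minimalPairs (P : AffinePoset n) : Finset (ℤ × ℤ) :=
  P.minimalPairSet_finite.toFinset

theorem mem_minimalPairs {q : ℤ × ℤ} : q ∈ P.minimalPairs ↔
    0 ≤ q.1 ∧ q.1 < n ∧ P.order.lt q.1 q.2 ∧ ¬ P.order.lt q.1 (q.2 - n) := by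
  simp [minimalPairs, minimalPairSet]

theorem lt_of_mem_minimalPairs {q : ℤ × ℤ} (h : q ∈ P.minimalPairs) : P.order.lt q.1 q.2 :=
  (mem_minimalPairs.1 h).2.2.1

theorem zero_n_mem_minimalPairs (P : AffinePoset n) : ((0 : ℤ), (n : ℤ)) ∈ P.minimalPairs := by
  refine mem_minimalPairs.2 ⟨le_rfl, P.cast_pos, by simpa using P.lt_add 0, ?_⟩
  rw [sub_self]
  exact fun h => lt_irrefl' h

theorem exists_minimalPair {i j : ℤ} (h : P.order.lt i j) :
    ∃ q ∈ P.minimalPairs, ∃ d k : ℤ, 0 ≤ k ∧ i = q.1 + d * n ∧ j = q.2 + d * n + k * n := by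
  have hn := P.cast_pos
  have hi : i = i % n + i / n * n := by rw [mul_comm]; exact (Int.emod_add_mul_ediv i n).symm
  have h0 : P.order.lt (i % n) (j - i / n * n) := by
    rw [← P.lt_translate _ _ (i / n), ← hi]
    simpa using h
  obtain ⟨k, hk, hmax⟩ := Int.exists_greatest_of_bdd
    (P := fun k : ℤ => P.order.lt (i % n) (j - i / n * n - k * n)) (by
      obtain ⟨t, ht⟩ := P.exists_le_add_mul (j - i / n * n) (i % n)
      refine ⟨t, fun k hk => ?_⟩
      by_contra hlt
      refine lt_irrefl' (P := P) (i := i % n) (lt_of_lt_of_le' hk ?_)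
      have h1 := (P.le_translate _ _ (-k)).2 ht
      have h2 := P.le_add_mul (i % n + t * n + -k * n) (d := k - t) (by omega)
      have h3 := P.le_trans' h1 h2
      convert h3 using 1 <;> ring) ⟨0, by simpa using h0⟩
  refine ⟨(i % n, j - i / n * n - k * n), mem_minimalPairs.2 ⟨Int.emod_nonneg _ hn.ne',
    Int.emod_lt_of_pos _ hn, hk, fun hcon => ?_⟩, i / n, k, hmax 0 (by simpa using h0), hi, ?_⟩
  · have := hmax (k + 1) (by convert hcon using 1; ring)
    omega
  · ring

theorem exists_minimalPair_of_mem {τ : Set ℤ} (hτ : P.IsProperTube τ) {i j : ℤ} (hi : i ∈ τ)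
    (hj : j ∈ τ) (h : P.order.lt i j) :
    ∃ q ∈ P.minimalPairs, ∃ d : ℤ, i = q.1 + d * n ∧ j = q.2 + d * n := by
  obtain ⟨q, hq, d, k, hk, h1, h2⟩ := exists_minimalPair h
  refine ⟨q, hq, d, h1, ?_⟩
  have hm : q.2 + d * n ∈ τ := by
    refine convex_le hτ.1.1 (i := i) (k := j) ?_ ?_ hi hj
    · rw [h1, P.le_translate]
      exact le_of_lt' (lt_of_mem_minimalPairs hq)
    · rw [h2]
      exact P.le_add_mul _ hk
  have hk0 : k = 0 := hτ.eq_zero_of_shift hm (h2 ▸ hj)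
  simpa [hk0] using h2

open Classical in
/-- The minimal pairs that have a translate inside a tube of the class `O`. -/
noncomputable def ProperTubeClass.edges (O : P.ProperTubeClass) : Finset (ℤ × ℤ) :=
  P.minimalPairs.filter fun q => ∃ τ ∈ O.1, q.1 ∈ τ ∧ q.2 ∈ τ

namespace ProperTubeClass

theorem mem_edges {O : P.ProperTubeClass} {q : ℤ × ℤ} :
    q ∈ O.edges ↔ q ∈ P.minimalPairs ∧ ∃ τ ∈ O.1, q.1 ∈ τ ∧ q.2 ∈ τ := by
  simp [edges]

theorem lt_of_mem_edges {O : P.ProperTubeClass} {q : ℤ × ℤ} (h : q ∈ O.edges) :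
    P.order.lt q.1 q.2 := lt_of_mem_minimalPairs (mem_edges.1 h).1

theorem exists_edge {O : P.ProperTubeClass} {τ : Set ℤ} (hτ : τ ∈ O.1) {i j : ℤ} (hi : i ∈ τ)
    (hj : j ∈ τ) (h : P.order.lt i j) :
    ∃ q ∈ O.edges, ∃ d : ℤ, i = q.1 + d * n ∧ j = q.2 + d * n := by
  obtain ⟨q, hq, d, h1, h2⟩ := exists_minimalPair_of_mem (O.isProperTube hτ) hi hj h
  refine ⟨q, mem_edges.2 ⟨hq, _, O.shift_mem hτ (-d), ?_, ?_⟩, d, h1, h2⟩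
  · rw [mem_shiftSet]
    convert hi using 1
    rw [h1]; ring
  · rw [mem_shiftSet]
    convert hj using 1
    rw [h2]; ring

theorem exists_shift_of_mem_edges {O : P.ProperTubeClass} {τ : Set ℤ} (hτ : τ ∈ O.1) {q : ℤ × ℤ}
    (hq : q ∈ O.edges) : ∃ d : ℤ, q.1 + d * n ∈ τ ∧ q.2 + d * n ∈ τ := by
  obtain ⟨-, σ, hσ, h1, h2⟩ := mem_edges.1 hq
  obtain ⟨d, rfl⟩ := O.exists_shift hτ hσ
  rw [mem_shiftSet] at h1 h2
  exact ⟨-d, by convert h1 using 1; ring, by convert h2 using 1; ring⟩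

theorem exists_lt_of_mem {τ : Set ℤ} (h : P.IsProperTube τ) {a : ℤ} (ha : a ∈ τ) :
    ∃ b ∈ τ, P.order.lt a b ∨ P.order.lt b a := by
  by_contra! hcon
  obtain ⟨b, hb, hne⟩ := h.2.1.exists_ne a
  refine hne (h.1.induction (p := fun x => x = a) ha rfl ?_ b hb)
  rintro i hi j hj hij rfl
  rcases hij with h | h
  · exact absurd h (hcon j hj).1
  · exact absurd h (hcon j hj).2

theorem edges_nonempty (O : P.ProperTubeClass) : O.edges.Nonempty := by
  obtain ⟨τ, hτ⟩ := O.nonempty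
  obtain ⟨a, ha⟩ := (O.isProperTube hτ).2.1.nonempty
  obtain ⟨b, hb, h | h⟩ := exists_lt_of_mem (O.isProperTube hτ) ha
  · obtain ⟨q, hq, -⟩ := exists_edge hτ ha hb h
    exact ⟨q, hq⟩
  · obtain ⟨q, hq, -⟩ := exists_edge hτ hb ha h
    exact ⟨q, hq⟩

theorem subset_of_edges_subset {O O' : P.ProperTubeClass} (h : O.edges ⊆ O'.edges) {τ : Set ℤ}
    (hτ : τ ∈ O.1) : ∃ σ ∈ O'.1, τ ⊆ σ := by
  have key : ∀ σ ∈ O'.1, ∀ i ∈ τ, ∀ j ∈ τ, P.order.lt i j → (i ∈ σ ↔ j ∈ σ) := by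
    intro σ hσ i hi j hj hij
    obtain ⟨q, hq, d, rfl, rfl⟩ := exists_edge hτ hi hj hij
    obtain ⟨e, h1, h2⟩ := exists_shift_of_mem_edges hσ (h hq)
    constructor
    · intro h3
      have := (O'.isProperTube hσ).eq_zero_of_shift h1 (d := d - e) (by convert h3 using 1; ring)
      have : d = e := by omega
      rwa [this]
    · intro h3
      have := (O'.isProperTube hσ).eq_zero_of_shift h2 (d := d - e) (by convert h3 using 1; ring)
      have : d = e := by omega
      rwa [this]
  obtain ⟨a, ha⟩ := (O.isProperTube hτ).2.1.nonempty
  have hex : ∃ σ ∈ O'.1, a ∈ σ := by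
    obtain ⟨σ, hσ⟩ := O'.nonempty
    obtain ⟨b, hb, hab⟩ := exists_lt_of_mem (O.isProperTube hτ) ha
    rcases hab with hab | hab
    · obtain ⟨q, hq, d, rfl, rfl⟩ := exists_edge hτ ha hb hab
      obtain ⟨e, h1, h2⟩ := exists_shift_of_mem_edges hσ (h hq)
      refine ⟨_, O'.shift_mem hσ (d - e), ?_⟩
      rw [mem_shiftSet]
      convert h1 using 1; ring
    · obtain ⟨q, hq, d, rfl, rfl⟩ := exists_edge hτ hb ha hab
      obtain ⟨e, h1, h2⟩ := exists_shift_of_mem_edges hσ (h hq)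
      refine ⟨_, O'.shift_mem hσ (d - e), ?_⟩
      rw [mem_shiftSet]
      convert h2 using 1; ring
  obtain ⟨σ, hσ, haσ⟩ := hex
  refine ⟨σ, hσ, (O.isProperTube hτ).1.induction ha haσ ?_⟩
  intro i hi j hj hij hiσ
  rcases hij with hij | hij
  · exact (key σ hσ i hi j hj hij).1 hiσ
  · exact (key σ hσ j hj i hi hij).2 hiσ

/-- If each tube of one class lies in a tube of the other and conversely, the classes agree. -/
theorem eq_of_subset_of_subset {O O' : P.ProperTubeClass}
    {τ σ τ' : Set ℤ} (hτ : τ ∈ O.1) (hσ : σ ∈ O'.1) (hτ' : τ' ∈ O.1) (h1 : τ ⊆ σ) (h2 : σ ⊆ τ') :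
    O = O' := by
  obtain ⟨d, rfl⟩ := O.exists_shift hτ hτ'
  obtain ⟨a, ha⟩ := (O.isProperTube hτ).2.1.nonempty
  have h3 := h2 (h1 ha)
  rw [mem_shiftSet] at h3
  have hd := (O.isProperTube hτ).eq_zero_of_shift ha (d := -d) (by convert h3 using 1; ring)
  have hd : d = 0 := by omega
  subst hd
  have : shiftSet n τ 0 = τ := by ext i; simp [mem_shiftSet]
  rw [this] at h2
  exact eq_of_mem hτ ((h1.antisymm h2) ▸ hσ)

theorem edges_injective : Function.Injective (edges (P := P)) := by
  intro O O' h
  obtain ⟨τ, hτ⟩ := O.nonempty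
  obtain ⟨σ, hσ, h1⟩ := subset_of_edges_subset h.subset hτ
  obtain ⟨τ', hτ', h2⟩ := subset_of_edges_subset h.symm.subset hσ
  exact eq_of_subset_of_subset hτ hσ hτ' h1 h2

instance instFinite : Finite P.ProperTubeClass := by
  refine Finite.of_injective
    (fun O : P.ProperTubeClass => (⟨O.edges, ?_⟩ : {s // s ∈ P.minimalPairs.powerset})) ?_
  · exact Finset.mem_powerset.2 fun q hq => (mem_edges.1 hq).1
  · intro O O' h
    exact edges_injective (Subtype.ext_iff.1 h)

noncomputable instance instFintype : Fintype P.ProperTubeClass := Fintype.ofFinite _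

noncomputable instance instDecidableEq : DecidableEq P.ProperTubeClass := Classical.decEq _

/-- The sum of the differences `f j - f i` over the pairs `i ≺ j` in a tube of the class `O`. It
measures how far a monotone function `f` is from being constant on the tubes of `O`. -/
noncomputable def spread (O : P.ProperTubeClass) (f : ℤ → ℝ) : ℝ :=
  ∑ q ∈ O.edges, (f q.2 - f q.1)

section Spread

variable {c : ℝ} {f : ℤ → ℝ} {O : P.ProperTubeClass} {τ : Set ℤ}

theorem spread_nonneg (hmono : ∀ i j, P.order.le i j → f i ≤ f j) : 0 ≤ O.spread f :=
  Finset.sum_nonneg fun _ hq => sub_nonneg.2 (hmono _ _ (le_of_lt' (lt_of_mem_edges hq)))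

theorem sub_le_spread (hf : ∀ i d : ℤ, f (i + d * n) = f i + d * c)
    (hmono : ∀ i j, P.order.le i j → f i ≤ f j) (hτ : τ ∈ O.1) {i j : ℤ}
    (hi : i ∈ τ) (hj : j ∈ τ) (hij : P.order.le i j) : f j - f i ≤ O.spread f := by
  by_cases hne : i = j
  · rw [hne, sub_self]
    exact spread_nonneg hmono
  obtain ⟨q, hq, d, rfl, rfl⟩ := exists_edge hτ hi hj (lt_iff'.2 ⟨hij, hne⟩)
  rw [hf, hf]
  have := Finset.single_le_sum (f := fun q : ℤ × ℤ => f q.2 - f q.1)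
    (fun _ hq => sub_nonneg.2 (hmono _ _ (le_of_lt' (lt_of_mem_edges hq)))) hq
  unfold spread
  linarith

theorem spread_le (hf : ∀ i d : ℤ, f (i + d * n) = f i + d * c) (hτ : τ ∈ O.1) {b : ℝ}
    (hb : 0 ≤ b) (h : ∀ i ∈ τ, ∀ j ∈ τ, f j ≤ f i + b) :
    O.spread f ≤ P.minimalPairs.card * b := by
  have h1 : ∀ q ∈ O.edges, f q.2 - f q.1 ≤ b := by
    intro q hq
    obtain ⟨d, hd1, hd2⟩ := exists_shift_of_mem_edges hτ hq
    have := h _ hd1 _ hd2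
    rw [hf, hf] at this
    linarith
  refine (Finset.sum_le_card_nsmul _ _ _ h1).trans ?_
  rw [nsmul_eq_mul]
  exact mul_le_mul_of_nonneg_right
    (by exact_mod_cast Finset.card_le_card fun q hq => (mem_edges.1 hq).1) hb

theorem constant_of_lt (hτ : P.IsTube τ)
    (h : ∀ i ∈ τ, ∀ j ∈ τ, P.order.lt i j → f i = f j) : ∀ i ∈ τ, ∀ j ∈ τ, f i = f j := by
  intro i hi
  refine hτ.induction (p := fun j => f i = f j) hi rfl ?_
  intro a ha b hb hab e
  rcases hab with hab | hab
  · rw [e, h a ha b hb hab]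
  · rw [e, h b hb a ha hab]

theorem spread_eq_zero_iff (hf : ∀ i d : ℤ, f (i + d * n) = f i + d * c)
    (hmono : ∀ i j, P.order.le i j → f i ≤ f j) (hτ : τ ∈ O.1) :
    O.spread f = 0 ↔ ∀ i ∈ τ, ∀ j ∈ τ, f i = f j := by
  constructor
  · intro h
    refine constant_of_lt (O.isProperTube hτ).1 fun i hi j hj hij => ?_
    have h1 := sub_le_spread hf hmono hτ hi hj (le_of_lt' hij)
    have h2 := hmono _ _ (le_of_lt' hij)
    linarith
  · intro h
    refine Finset.sum_eq_zero fun q hq => ?_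
    obtain ⟨d, hd1, hd2⟩ := exists_shift_of_mem_edges hτ hq
    have := h _ hd1 _ hd2
    rw [hf, hf] at this
    linarith

end Spread

end ProperTubeClass

end AffinePoset

namespace AffinePoset

variable {n : ℕ} {P : AffinePoset n}

/-! ### Tubings and monotone functions -/

/-- A set of classes of proper tubes whose union is a proper tubing. -/
def IsTubingFamily (A : Set P.ProperTubeClass) : Prop := P.IsProperTubing (⋃ O ∈ A, O.1)

theorem mem_iUnion_classes {A : Set P.ProperTubeClass} {τ : Set ℤ} :
    (τ ∈ ⋃ O ∈ A, O.1) ↔ ∃ O ∈ A, τ ∈ O.1 := by simp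

theorem mem_biUnion_iff_tubeClass {M : Set P.ProperTubeClass} {τ : Set ℤ}
    (hτ : P.IsProperTube τ) : (τ ∈ ⋃ O ∈ M, O.1) ↔ tubeClass τ hτ ∈ M := by
  rw [mem_iUnion_classes]
  constructor
  · rintro ⟨O, hO, hτO⟩
    rwa [← O.eq_tubeClass hτO]
  · exact fun h => ⟨_, h, mem_shiftClass_self τ⟩

theorem IsTubingFamily.mono {A B : Set P.ProperTubeClass} (h : IsTubingFamily A) (hBA : B ⊆ A) :
    IsTubingFamily B := by
  have hsub : (⋃ O ∈ B, O.1) ⊆ ⋃ O ∈ A, O.1 := Set.biUnion_subset_biUnion_left hBA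
  refine ⟨h.1.mono_periodic hsub ?_, fun τ hτ => h.2 τ (hsub hτ)⟩
  intro τ hτ
  obtain ⟨O, hO, hτO⟩ := mem_iUnion_classes.1 hτ
  rintro _ ⟨d, rfl⟩
  exact mem_iUnion_classes.2 ⟨O, hO, O.shift_mem hτO d⟩

theorem isTubingFamily_empty : IsTubingFamily (∅ : Set P.ProperTubeClass) := by
  refine ⟨⟨by simp, by simp, by simp, ?_⟩, by simp⟩
  intro τ h
  obtain ⟨σ, hσ, -⟩ := Relation.TransGen.head'_iff.1 h
  simpa using hσ.1

theorem isTubingFamily_singleton (O : P.ProperTubeClass) : IsTubingFamily {O} := by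
  obtain ⟨τ, hτ⟩ := O.nonempty
  unfold IsTubingFamily
  rw [Set.biUnion_singleton]
  convert shiftClass_isProperTubing (O.isProperTube hτ) using 1
  exact O.eq_shiftClass hτ

section Collapse

variable {T : Set (Set ℤ)}

/-- Two integers are related by a step if they are comparable, or if they belong to the same tube
of `T`. -/
def collapseStep (P : AffinePoset n) (T : Set (Set ℤ)) (a b : ℤ) : Prop :=
  P.order.le a b ∨ ∃ σ ∈ T, a ∈ σ ∧ b ∈ σ

/-- Since proper tubes have at most `n` elements, those with a given property lie in maximal
ones. -/
theorem exists_maximal_properTube {p : Set ℤ → Prop} (hp : ∀ ρ, p ρ → P.IsProperTube ρ) {σ : Set ℤ}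
    (hσ : p σ) : ∃ ρ, Maximal p ρ ∧ σ ⊆ ρ := by
  have hne : {m | ∃ ρ, p ρ ∧ σ ⊆ ρ ∧ ρ.ncard = m}.Nonempty := ⟨_, σ, hσ, subset_rfl, rfl⟩
  have hbdd : BddAbove {m | ∃ ρ, p ρ ∧ σ ⊆ ρ ∧ ρ.ncard = m} := by
    refine ⟨n, ?_⟩
    rintro _ ⟨ρ, hρ, -, rfl⟩
    exact (hp ρ hρ).ncard_le
  obtain ⟨ρ, hρ, hσρ, hcard⟩ := Nat.sSup_mem hne hbdd
  refine ⟨ρ, ⟨hρ, fun ρ' hρ' hle => ?_⟩, hσρ⟩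
  have h1 : ρ'.ncard ≤ ρ.ncard := by
    rw [hcard]
    exact le_csSup hbdd ⟨ρ', hρ', hσρ.trans hle, rfl⟩
  exact (Set.eq_of_subset_of_ncard_le hle h1 (hp ρ' hρ').finite).symm.subset

theorem exists_maximal_tube (hT : P.IsProperTubing T) {σ : Set ℤ} (hσ : σ ∈ T) :
    ∃ ρ, Maximal (· ∈ T) ρ ∧ σ ⊆ ρ := exists_maximal_properTube hT.2 hσ

theorem eq_or_disjoint_of_maximal (hT : P.IsProperTubing T) {σ ρ : Set ℤ}
    (hσ : Maximal (· ∈ T) σ) (hρ : Maximal (· ∈ T) ρ) : σ = ρ ∨ Disjoint σ ρ := by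
  rcases hT.1.nested_or_disjoint σ hσ.1 ρ hρ.1 with h | h | h
  · exact Or.inl (hσ.eq_of_le hρ.1 h)
  · exact Or.inl (hρ.eq_of_le hσ.1 h).symm
  · exact Or.inr h

theorem eq_or_edge (hT : P.IsProperTubing T) {σ ρ : Set ℤ}
    (hσ : Maximal (· ∈ T) σ) (hρ : Maximal (· ∈ T) ρ) {i j : ℤ} (hi : i ∈ σ) (hj : j ∈ ρ)
    (hij : P.order.le i j) : σ = ρ ∨ P.TubeEdge T σ ρ := by
  rcases eq_or_disjoint_of_maximal hT hσ hρ with h | h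
  · exact Or.inl h
  · refine Or.inr ⟨hσ.1, hρ.1, h, i, hi, j, hj, lt_iff'.2 ⟨hij, ?_⟩⟩
    rintro rfl
    exact Set.disjoint_left.1 h hi hj

/-- A path of steps that starts in a maximal tube leads below its end point by a path of edges
between maximal tubes. -/
theorem exists_tube_path (hT : P.IsProperTubing T) {σ : Set ℤ} (hσ : Maximal (· ∈ T) σ) {i j : ℤ}
    (hi : i ∈ σ) (hij : Relation.ReflTransGen (P.collapseStep T) i j) :
    ∃ ρ, Maximal (· ∈ T) ρ ∧ Relation.ReflTransGen (P.TubeEdge T) σ ρ ∧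
      ∃ r ∈ ρ, P.order.le r j := by
  induction hij with
  | refl => exact ⟨σ, hσ, .refl, i, hi, P.le_refl' i⟩
  | @tail j k _ hjk ih =>
    obtain ⟨ρ, hρ, hσρ, r, hr, hrj⟩ := ih
    rcases hjk with hjk | ⟨ν, hν, hj, hk⟩
    · exact ⟨ρ, hρ, hσρ, r, hr, le_trans' hrj hjk⟩
    · obtain ⟨μ, hμ, hνμ⟩ := exists_maximal_tube hT hν
      rcases eq_or_edge hT hρ hμ hr (hνμ hj) hrj with rfl | he
      · exact ⟨ρ, hρ, hσρ, k, hνμ hk, P.le_refl' k⟩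
      · exact ⟨μ, hμ, hσρ.tail he, k, hνμ hk, P.le_refl' k⟩

theorem tube_path_of_mem (hT : P.IsProperTubing T) {σ ρ : Set ℤ} (hσ : Maximal (· ∈ T) σ)
    (hρ : Maximal (· ∈ T) ρ) {i j : ℤ} (hi : i ∈ σ) (hj : j ∈ ρ)
    (hij : Relation.ReflTransGen (P.collapseStep T) i j) :
    Relation.ReflTransGen (P.TubeEdge T) σ ρ := by
  obtain ⟨μ, hμ, hσμ, r, hr, hrj⟩ := exists_tube_path hT hσ hi hij
  rcases eq_or_edge hT hμ hρ hr hj hrj with rfl | he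
  · exact hσμ
  · exact hσμ.tail he

theorem tube_path_antisymm (hT : P.IsProperTubing T) {σ ρ : Set ℤ}
    (h1 : Relation.ReflTransGen (P.TubeEdge T) σ ρ)
    (h2 : Relation.ReflTransGen (P.TubeEdge T) ρ σ) : σ = ρ := by
  rcases Relation.reflTransGen_iff_eq_or_transGen.1 h1 with h | h
  · exact h.symm
  · exact absurd (h.trans_left h2) (hT.1.acyclic σ)

theorem le_or_exists_tube {i j : ℤ} (hij : Relation.ReflTransGen (P.collapseStep T) i j) :
    P.order.le i j ∨ ∃ ρ ∈ T, ∃ s ∈ ρ, P.order.le i s ∧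
      Relation.ReflTransGen (P.collapseStep T) s j := by
  induction hij using Relation.ReflTransGen.head_induction_on with
  | refl => exact Or.inl (P.le_refl' _)
  | @head i k hik hkj ih =>
    rcases hik with hik | ⟨ρ, hρ, hi, hk⟩
    · rcases ih with h | ⟨ρ, hρ, s, hs, hks, hsj⟩
      · exact Or.inl (le_trans' hik h)
      · exact Or.inr ⟨ρ, hρ, s, hs, le_trans' hik hks, hsj⟩
    · exact Or.inr ⟨ρ, hρ, i, hi, P.le_refl' i, hkj.head (Or.inr ⟨ρ, hρ, hi, hk⟩)⟩

/-- The strongly connected component of a point of a maximal tube is that tube. -/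
theorem mem_tube_of_path (hT : P.IsProperTubing T) {σ : Set ℤ} (hσ : Maximal (· ∈ T) σ) {i j : ℤ}
    (hi : i ∈ σ) (hij : Relation.ReflTransGen (P.collapseStep T) i j)
    (hji : Relation.ReflTransGen (P.collapseStep T) j i) : j ∈ σ := by
  obtain ⟨μ, hμ, hσμ, r, hr, hrj⟩ := exists_tube_path hT hσ hi hij
  -- the path back to `i` enters a maximal tube `ρ` at `s`, from where there is a path to `σ`
  obtain ⟨ρ, hρ, s, hs, hjs, hρσ⟩ : ∃ ρ, Maximal (· ∈ T) ρ ∧ ∃ s ∈ ρ, P.order.le j s ∧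
      Relation.ReflTransGen (P.TubeEdge T) ρ σ := by
    rcases le_or_exists_tube hji with h | ⟨ρ, hρ, s, hs, hjs, hsi⟩
    · exact ⟨σ, hσ, i, hi, h, .refl⟩
    · obtain ⟨ρ', hρ', hsub⟩ := exists_maximal_tube hT hρ
      exact ⟨ρ', hρ', s, hsub hs, hjs, tube_path_of_mem hT hρ' hσ (hsub hs) hi hsi⟩
  have hμρ : Relation.ReflTransGen (P.TubeEdge T) μ ρ := by
    rcases eq_or_edge hT hμ hρ hr hs (le_trans' hrj hjs) with rfl | he
    · exact .refl
    · exact .single he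
  have e1 : σ = μ := tube_path_antisymm hT hσμ (hμρ.trans hρσ)
  have e2 : ρ = σ := tube_path_antisymm hT hρσ (hσμ.trans hμρ)
  subst e1
  subst e2
  exact convex_le (hT.2 _ hσ.1).1.1 hrj hjs hr hs

/-- The transitive closure of an affine poset and of the equivalence relation of a tubing identifies
only the points that lie in a common tube. This is the meaning of acyclicity. -/
theorem eq_or_mem_tube_of_path (hT : P.IsProperTubing T) {i j : ℤ}
    (hij : Relation.ReflTransGen (P.collapseStep T) i j)
    (hji : Relation.ReflTransGen (P.collapseStep T) j i) : i = j ∨ ∃ σ ∈ T, i ∈ σ ∧ j ∈ σ := by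
  rcases le_or_exists_tube hij with h1 | ⟨ρ, hρ, s, hs, his, hsj⟩
  · rcases le_or_exists_tube hji with h2 | ⟨ρ, hρ, s, hs, hjs, hsi⟩
    · exact Or.inl (le_antisymm' h1 h2)
    · obtain ⟨σ, hσ, hρσ⟩ := exists_maximal_tube hT hρ
      have hsj : Relation.ReflTransGen (P.collapseStep T) s j := hsi.trans hij
      exact Or.inr ⟨σ, hσ.1, mem_tube_of_path hT hσ (hρσ hs) hsi (hij.tail (Or.inl hjs)),
        mem_tube_of_path hT hσ (hρσ hs) hsj (.single (Or.inl hjs))⟩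
  · obtain ⟨σ, hσ, hρσ⟩ := exists_maximal_tube hT hρ
    have hsi : Relation.ReflTransGen (P.collapseStep T) s i := hsj.trans hji
    exact Or.inr ⟨σ, hσ.1, mem_tube_of_path hT hσ (hρσ hs) hsi (.single (Or.inl his)),
      mem_tube_of_path hT hσ (hρσ hs) hsj (hji.tail (Or.inl his))⟩

/-- For each tubing there is a monotone quasi-periodic function that identifies comparable integers
only when they lie in a common tube. -/
theorem exists_collapsing (c : ℝ) (hc : 0 < c) {A : Set P.ProperTubeClass}
    (hA : IsTubingFamily A) :
    ∃ f : ℤ → ℝ, (∀ i d : ℤ, f (i + d * n) = f i + d * c) ∧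
      (∀ i j, P.order.le i j → f i ≤ f j) ∧
      ∀ i j, P.order.lt i j → (f i = f j ↔ ∃ O ∈ A, ∃ σ ∈ O.1, i ∈ σ ∧ j ∈ σ) := by
  set T : Set (Set ℤ) := ⋃ O ∈ A, O.1 with hTdef
  have hT : P.IsProperTubing T := hA
  have hstrict : ∀ i : ℤ, ¬ Relation.ReflTransGen (P.collapseStep T) (i + n) i := by
    intro i h
    have h2 : P.order.lt i (i + n) := P.lt_add i
    rcases eq_or_mem_tube_of_path hT h (.single (Or.inl (le_of_lt' h2))) with e | ⟨σ, hσ, h3, h4⟩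
    · rw [e] at h2
      exact lt_irrefl' h2
    · exact one_ne_zero ((hT.2 σ hσ).eq_zero_of_shift (d := 1) h4 (by simpa using h3))
  obtain ⟨f, hf, hmono, hlt⟩ := P.exists_strictMono_quasiperiodic c hc
    (Relation.ReflTransGen (P.collapseStep T)) (fun _ _ _ h h' => h.trans h')
    (fun i j h => .single (Or.inl h)) (fun i j d h => by
      refine Relation.ReflTransGen.lift (fun i => i + d * n) ?_ _ _ h
      rintro a b (hab | ⟨σ, hσ, ha, hb⟩)
      · exact Or.inl ((P.le_translate _ _ d).2 hab)
      · exact Or.inr ⟨_, hT.1.periodic σ hσ ⟨d, rfl⟩, ⟨a, ha, rfl⟩, ⟨b, hb, rfl⟩⟩) hstrict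
  refine ⟨f, hf, fun i j h => hmono _ _ (.single (Or.inl h)), fun i j hij => ⟨fun he => ?_, ?_⟩⟩
  · by_cases hji : Relation.ReflTransGen (P.collapseStep T) j i
    · rcases eq_or_mem_tube_of_path hT (.single (Or.inl (le_of_lt' hij))) hji with e | h
      · rw [e] at hij
        exact (lt_irrefl' hij).elim
      · obtain ⟨σ, hσ, h⟩ := h
        obtain ⟨O, hO, hσ⟩ := mem_iUnion_classes.1 hσ
        exact ⟨O, hO, σ, hσ, h⟩
    · exact absurd he (hlt _ _ (.single (Or.inl (le_of_lt' hij))) hji).ne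
  · rintro ⟨O, hO, σ, hσ, hi, hj⟩
    have hσ : σ ∈ T := mem_iUnion_classes.2 ⟨O, hO, hσ⟩
    exact le_antisymm (hmono _ _ (.single (Or.inr ⟨σ, hσ, hi, hj⟩)))
      (hmono _ _ (.single (Or.inr ⟨σ, hσ, hj, hi⟩)))

theorem exists_superset_of_collapsed {A : Set P.ProperTubeClass} (hA : IsTubingFamily A)
    {τ : Set ℤ} (hτ : P.IsProperTube τ)
    (h : ∀ i ∈ τ, ∀ j ∈ τ, P.order.lt i j → ∃ O ∈ A, ∃ σ ∈ O.1, i ∈ σ ∧ j ∈ σ) :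
    ∃ O ∈ A, ∃ σ ∈ O.1, τ ⊆ σ := by
  have h' : ∀ i ∈ τ, ∀ j ∈ τ, P.order.lt i j →
      ∃ σ, Maximal (· ∈ ⋃ O ∈ A, O.1) σ ∧ i ∈ σ ∧ j ∈ σ := by
    intro i hi j hj hij
    obtain ⟨O, hO, σ, hσ, hiσ, hjσ⟩ := h i hi j hj hij
    obtain ⟨ρ, hρ, hσρ⟩ := exists_maximal_tube hA (mem_iUnion_classes.2 ⟨O, hO, hσ⟩)
    exact ⟨ρ, hρ, hσρ hiσ, hσρ hjσ⟩
  obtain ⟨a, ha⟩ := hτ.2.1.nonempty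
  obtain ⟨ρ, hρ, haρ⟩ : ∃ σ, Maximal (· ∈ ⋃ O ∈ A, O.1) σ ∧ a ∈ σ := by
    obtain ⟨b, hb, hab | hab⟩ := ProperTubeClass.exists_lt_of_mem hτ ha
    · obtain ⟨σ, hσ, h1, -⟩ := h' a ha b hb hab
      exact ⟨σ, hσ, h1⟩
    · obtain ⟨σ, hσ, -, h1⟩ := h' b hb a ha hab
      exact ⟨σ, hσ, h1⟩
  have hsub : ∀ b ∈ τ, b ∈ ρ := by
    refine hτ.1.induction ha haρ ?_
    intro i hi j hj hij hiρ
    obtain ⟨σ, hσ, h1, h2⟩ : ∃ σ, Maximal (· ∈ ⋃ O ∈ A, O.1) σ ∧ i ∈ σ ∧ j ∈ σ := by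
      rcases hij with hij | hij
      · exact h' i hi j hj hij
      · obtain ⟨σ, hσ, h1, h2⟩ := h' j hj i hi hij
        exact ⟨σ, hσ, h2, h1⟩
    rcases eq_or_disjoint_of_maximal hA hσ hρ with rfl | hd
    · exact h2
    · exact absurd hiρ (Set.disjoint_left.1 hd h1)
  obtain ⟨O, hO, hρO⟩ := mem_iUnion_classes.1 hρ.1
  exact ⟨O, hO, ρ, hρO, hsub⟩

/-- For each tubing there is a monotone quasi-periodic function that is constant exactly on the
proper tubes contained in a tube of the tubing, and that identifies no further comparable
integers. -/
theorem exists_spread_eq_zero_iff (c : ℝ) (hc : 0 < c) {A : Set P.ProperTubeClass}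
    (hA : IsTubingFamily A) :
    ∃ f : ℤ → ℝ, (∀ i d : ℤ, f (i + d * n) = f i + d * c) ∧
      (∀ i j, P.order.le i j → f i ≤ f j) ∧
      (∀ i j, P.order.lt i j → (f i = f j ↔ ∃ O ∈ A, ∃ σ ∈ O.1, i ∈ σ ∧ j ∈ σ)) ∧
      ∀ (O : P.ProperTubeClass) (τ : Set ℤ), τ ∈ O.1 →
        (O.spread f = 0 ↔ ∃ O' ∈ A, ∃ σ ∈ O'.1, τ ⊆ σ) := by
  obtain ⟨f, hf, hmono, h⟩ := exists_collapsing c hc hA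
  refine ⟨f, hf, hmono, h, fun O τ hτ => ?_⟩
  rw [ProperTubeClass.spread_eq_zero_iff hf hmono hτ]
  constructor
  · intro hcst
    exact exists_superset_of_collapsed hA (O.isProperTube hτ) fun i hi j hj hij =>
      (h i j hij).1 (hcst i hi j hj)
  · rintro ⟨O', hO', σ, hσ, hsub⟩
    refine ProperTubeClass.constant_of_lt (O.isProperTube hτ).1 fun i hi j hj hij => ?_
    exact (h i j hij).2 ⟨O', hO', σ, hσ, hsub hi, hsub hj⟩

end Collapse

/-! ### Uniqueness of expansions along tubings -/

theorem IsTubingFamily.subset_of_spread_identity {c : ℝ} (hc : 0 < c) {a b : P.ProperTubeClass → ℝ}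
    (ha0 : ∀ O, 0 ≤ a O) (hb0 : ∀ O, 0 ≤ b O)
    (ha : IsTubingFamily {O | a O ≠ 0}) (hb : IsTubingFamily {O | b O ≠ 0}) {k : ℝ}
    (hk : ∀ f : ℤ → ℝ, (∀ i d : ℤ, f (i + d * n) = f i + d * c) →
      ∑ O, a O * O.spread f = ∑ O, b O * O.spread f + k) :
    ∀ O, b O ≠ 0 → ∀ τ ∈ O.1, ∃ O', a O' ≠ 0 ∧ ∃ σ ∈ O'.1, τ ⊆ σ := by
  obtain ⟨f, hf, hfm, -, hfz⟩ := exists_spread_eq_zero_iff c hc ha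
  obtain ⟨g, hg, hgm, -, hgz⟩ := exists_spread_eq_zero_iff c hc hb
  have hself : ∀ {A : Set P.ProperTubeClass} {O} (τ), O ∈ A → τ ∈ O.1 →
      ∃ O' ∈ A, ∃ σ ∈ O'.1, τ ⊆ σ := fun τ hO hτ => ⟨_, hO, τ, hτ, subset_rfl⟩
  have haf : ∑ O, a O * O.spread f = 0 := by
    refine Finset.sum_eq_zero fun O _ => ?_
    by_cases h : a O = 0
    · rw [h, zero_mul]
    · obtain ⟨τ, hτ⟩ := O.nonempty
      rw [(hfz O τ hτ).2 (hself τ h hτ), mul_zero]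
  have hbg : ∑ O, b O * O.spread g = 0 := by
    refine Finset.sum_eq_zero fun O _ => ?_
    by_cases h : b O = 0
    · rw [h, zero_mul]
    · obtain ⟨τ, hτ⟩ := O.nonempty
      rw [(hgz O τ hτ).2 (hself τ h hτ), mul_zero]
  have hag : 0 ≤ ∑ O, a O * O.spread g :=
    Finset.sum_nonneg fun O _ => mul_nonneg (ha0 O) (ProperTubeClass.spread_nonneg hgm)
  have hbf0 : ∀ O ∈ Finset.univ, 0 ≤ b O * O.spread f :=
    fun O _ => mul_nonneg (hb0 O) (ProperTubeClass.spread_nonneg hfm)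
  have hbf := Finset.sum_nonneg hbf0
  have h1 := hk f hf
  have h2 := hk g hg
  have h3 : ∑ O, b O * O.spread f = 0 := by linarith
  rw [Finset.sum_eq_zero_iff_of_nonneg hbf0] at h3
  intro O hO τ hτ
  have h4 := (mul_eq_zero.1 (h3 O (Finset.mem_univ O))).resolve_left hO
  exact (hfz O τ hτ).1 h4

/-- The cones spanned by tubings form a fan: a nonnegative combination of spreads supported on a
tubing determines its coefficients, even up to an additive constant. The maximal tubes are
recognized from the zeros of the combination on monotone functions, and are then split off. -/
theorem IsTubingFamily.eq_of_spread_identity {c : ℝ} (hc : 0 < c) (m : ℕ) :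
    ∀ {a b : P.ProperTubeClass → ℝ} (_ : ∀ O, 0 ≤ a O) (_ : ∀ O, 0 ≤ b O)
      (_ : IsTubingFamily {O | a O ≠ 0}) (_ : IsTubingFamily {O | b O ≠ 0}) {k : ℝ}
      (_ : ∀ f : ℤ → ℝ, (∀ i d : ℤ, f (i + d * n) = f i + d * c) →
        ∑ O, a O * O.spread f = ∑ O, b O * O.spread f + k)
      (_ : {O | a O ≠ 0}.ncard + {O | b O ≠ 0}.ncard ≤ m), a = b := by
  induction m with
  | zero =>
    intro a b _ _ _ _ k _ hcard
    have h1 := (Set.ncard_eq_zero (Set.toFinite _)).1 (Nat.eq_zero_of_add_eq_zero_right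
      (Nat.le_zero.1 hcard))
    have h2 := (Set.ncard_eq_zero (Set.toFinite _)).1 (Nat.eq_zero_of_add_eq_zero_left
      (Nat.le_zero.1 hcard))
    funext O
    have h3 : a O = 0 := by
      by_contra h
      exact Set.eq_empty_iff_forall_notMem.1 h1 O h
    have h4 : b O = 0 := by
      by_contra h
      exact Set.eq_empty_iff_forall_notMem.1 h2 O h
    rw [h3, h4]
  | succ m ih =>
    intro a b ha0 hb0 ha hb k hk hcard
    have hba := subset_of_spread_identity hc ha0 hb0 ha hb hk
    have hab := subset_of_spread_identity (k := -k) hc hb0 ha0 hb ha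
      (fun f hf => by linarith [hk f hf])
    by_cases hemp : ∀ O, a O = 0
    · funext O
      rw [hemp]
      by_contra hO
      obtain ⟨τ, hτ⟩ := O.nonempty
      obtain ⟨O', hO', -⟩ := hba O (Ne.symm hO) τ hτ
      exact hO' (hemp O')
    push Not at hemp
    obtain ⟨O₀, hO₀⟩ := hemp
    obtain ⟨τ₀, hτ₀⟩ := O₀.nonempty
    obtain ⟨τ, hτmax, -⟩ := exists_maximal_tube ha (mem_iUnion_classes.2 ⟨O₀, hO₀, hτ₀⟩)
    obtain ⟨O, hO, hτ⟩ := mem_iUnion_classes.1 hτmax.1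
    obtain ⟨O', hO', σ, hσ, hτσ⟩ := hab O hO τ hτ
    obtain ⟨O'', hO'', τ', hτ', hστ'⟩ := hba O' hO' σ hσ
    have e : τ = τ' := hτmax.eq_of_le (mem_iUnion_classes.2 ⟨O'', hO'', hτ'⟩) (hτσ.trans hστ')
    have e2 : τ = σ := hτσ.antisymm (e ▸ hστ')
    have e3 : O = O' := ProperTubeClass.eq_of_mem hτ (e2 ▸ hσ)
    subst e3
    set t : ℝ := min (a O) (b O) with ht
    have haO : 0 < a O := lt_of_le_of_ne (ha0 O) (Ne.symm hO)
    have hbO : 0 < b O := lt_of_le_of_ne (hb0 O) (Ne.symm hO')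
    have htpos : 0 < t := lt_min haO hbO
    have hsub : ∀ x : P.ProperTubeClass → ℝ, x O ≠ 0 →
        {O' | (x - Pi.single O t : P.ProperTubeClass → ℝ) O' ≠ 0} ⊆ {O' | x O' ≠ 0} := by
      intro x hx O' h
      by_cases e : O' = O
      · subst e
        exact hx
      · simpa [Pi.single_eq_of_ne e] using h
    have hnn : ∀ x : P.ProperTubeClass → ℝ, (∀ O, 0 ≤ x O) → t ≤ x O →
        ∀ O', 0 ≤ (x - Pi.single O t : P.ProperTubeClass → ℝ) O' := by
      intro x hx htx O'
      by_cases e : O' = O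
      · subst e
        simpa using htx
      · simpa [Pi.single_eq_of_ne e] using hx O'
    have hsum : ∀ (x : P.ProperTubeClass → ℝ) (f : ℤ → ℝ),
        ∑ O', (x - Pi.single O t : P.ProperTubeClass → ℝ) O' * O'.spread f =
          ∑ O', x O' * O'.spread f - t * O.spread f := by
      intro x f
      have : ∑ O', (Pi.single O t : P.ProperTubeClass → ℝ) O' * O'.spread f = t * O.spread f := by
        rw [Finset.sum_eq_single O]
        · simp
        · intro O' _ h
          simp [Pi.single_eq_of_ne h]
        · simp
      rw [← this, ← Finset.sum_sub_distrib]
      refine Finset.sum_congr rfl fun O' _ => ?_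
      rw [Pi.sub_apply, sub_mul]
    have hle1 := Set.ncard_le_ncard (hsub a hO)
    have hle2 := Set.ncard_le_ncard (hsub b hO')
    have hlt : ∀ x : P.ProperTubeClass → ℝ, x O ≠ 0 → x O = t →
        {O' | (x - Pi.single O t : P.ProperTubeClass → ℝ) O' ≠ 0}.ncard <
          {O' | x O' ≠ 0}.ncard := by
      intro x hx hxt
      refine Set.ncard_lt_ncard ⟨hsub x hx, fun h => ?_⟩
      have : O ∈ {O' | (x - Pi.single O t : P.ProperTubeClass → ℝ) O' ≠ 0} := h hx
      simp [hxt] at this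
    have key := ih (a := a - Pi.single O t) (b := b - Pi.single O t)
      (hnn a ha0 (min_le_left _ _)) (hnn b hb0 (min_le_right _ _)) (ha.mono (hsub a hO))
      (hb.mono (hsub b hO')) (k := k) (fun f hf => by rw [hsum, hsum, hk f hf]; ring) (by
        rcases min_choice (a O) (b O) with h | h
        · have := hlt a hO (by rw [ht, h])
          omega
        · have := hlt b hO' (by rw [ht, h])
          omega)
    exact sub_left_injective key

/-! ### Hierarchical thresholds -/

/-- Positive numbers attached to the classes of proper tubes in `M`, all of them small compared to
`c`, and much smaller for a tube than for the tubes that strictly contain it. The factor in the last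
condition is large enough for the following: if going back inside some tubes costs at most `g` per
step, then differences within a strongly connected component are at most `n * g`, and its spread, a
sum over minimal pairs, is at most the number of these times `n * g`. -/
structure IsHierarchical (M : Set P.ProperTubeClass) (c : ℝ) (δ : P.ProperTubeClass → ℝ) :
    Prop where
  pos : ∀ O ∈ M, 0 < δ O
  small : ∀ O ∈ M, n * δ O < c
  lt : ∀ O ∈ M, ∀ O' ∈ M, ∀ τ ∈ O.1, ∀ σ ∈ O'.1, τ ⊂ σ →
    (P.minimalPairs.card * n + 1) * δ O < δ O'

section Feasible

variable {c : ℝ} {δ : P.ProperTubeClass → ℝ} {f : ℤ → ℝ}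

/-- Suppose that all spreads of `f` are at least the thresholds. If tubes at which the threshold is
attained all lie in the same strongly connected component, this component is one of them: otherwise
`f` would be almost constant on the component, at odds with its larger threshold. -/
theorem backComponent_mem_of_tight (hδ : IsHierarchical Set.univ c δ)
    (hf : ∀ i d : ℤ, f (i + d * n) = f i + d * c) (hmono : ∀ i j, P.order.le i j → f i ≤ f j)
    (hfeas : ∀ O : P.ProperTubeClass, δ O ≤ O.spread f) {T : Set (Set ℤ)}
    (htight : ∀ τ ∈ T, ∃ O : P.ProperTubeClass, τ ∈ O.1 ∧ O.spread f = δ O)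
    {ρ : Set ℤ} (hρ : ρ ∈ T) {a : ℤ}
    (hsub : ∀ τ ∈ T, τ ⊆ P.backComponent
      (fun i j => P.order.le i j ∧ ∃ τ ∈ T, i ∈ τ ∧ j ∈ τ) a) :
    P.backComponent (fun i j => P.order.le i j ∧ ∃ τ ∈ T, i ∈ τ ∧ j ∈ τ) a ∈ T := by
  set W : ℤ → ℤ → Prop := fun i j => P.order.le i j ∧ ∃ τ ∈ T, i ∈ τ ∧ j ∈ τ with hW
  set E := P.backComponent W a with hE
  obtain ⟨O₀, hρO₀, -⟩ := htight ρ hρ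
  have : Nonempty P.ProperTubeClass := ⟨O₀⟩
  obtain ⟨O₁, hO₁⟩ := Finite.exists_max δ
  have hn : (0 : ℝ) < n := by exact_mod_cast P.order_pos
  have hWle : ∀ i j, W i j → P.order.le i j := fun i j h => h.1
  have hWδ : ∀ i j, W i j → ∃ O : P.ProperTubeClass, ∃ τ ∈ T, τ ∈ O.1 ∧ f j ≤ f i + δ O := by
    rintro i j ⟨hij, τ, hτ, hi, hj⟩
    obtain ⟨O, hτO, hO⟩ := htight τ hτ
    have := ProperTubeClass.sub_le_spread hf hmono hτO hi hj hij
    exact ⟨O, τ, hτ, hτO, by linarith⟩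
  have htube := backComponent_isTube hf hmono (hδ.pos O₁ trivial).le (hδ.small O₁ trivial) hWle
    (fun i j h => by
      obtain ⟨O, -, -, -, hO⟩ := hWδ i j h
      linarith [hO₁ O]) a
  have hprop : P.IsProperTube E :=
    ⟨htube.1, (O₀.isProperTube hρO₀).2.1.mono (hsub ρ hρ), htube.2⟩
  by_contra hET
  set OE := tubeClass E hprop with hOE
  set K : ℝ := P.minimalPairs.card * n + 1 with hK
  have hKpos : 0 < K := by positivity
  have hδE := hδ.pos OE trivial
  have hK1 : 1 ≤ K := by
    have : (0 : ℝ) ≤ P.minimalPairs.card * n := by positivity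
    linarith
  have hg : δ OE / K ≤ δ OE := div_le_self hδE.le hK1
  have hbound : ∀ i ∈ E, ∀ j ∈ E, f j ≤ f i + n * (δ OE / K) := by
    intro i hi j hj
    have := backComponent_bound (g := δ OE / K) hf hmono (by positivity)
      (lt_of_le_of_lt (mul_le_mul_of_nonneg_left hg hn.le) (hδ.small OE trivial))
      (fun i j h => by
        obtain ⟨O, τ, hτ, hτO, hO⟩ := hWδ i j h
        have hss : τ ⊂ E := lt_of_le_of_ne (hsub τ hτ) (fun h => hET (h ▸ hτ))
        have := hδ.lt O trivial OE trivial τ hτO E (mem_shiftClass_self E) hss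
        have h2 : δ O ≤ δ OE / K := by
          rw [le_div_iff₀ hKpos]
          linarith
        linarith) hj hi
    linarith
  have h1 := ProperTubeClass.spread_le (O := OE) hf (mem_shiftClass_self E) (by positivity) hbound
  have h2 := hfeas OE
  have h3 : P.minimalPairs.card * (n * (δ OE / K)) < δ OE := by
    have : P.minimalPairs.card * (n * (δ OE / K)) = (K - 1) * δ OE / K := by
      rw [hK]; ring
    rw [this, div_lt_iff₀ hKpos]
    nlinarith
  linarith

/-- A tube of a family is strongly connected when going back inside the tubes is allowed. -/
theorem backRel_of_mem_tube {T : Set (Set ℤ)} {τ : Set ℤ} (hτT : τ ∈ T) (hτ : P.IsTube τ) {a b : ℤ}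
    (ha : a ∈ τ) (hb : b ∈ τ) : Relation.ReflTransGen
      (P.backRel (fun i j => P.order.le i j ∧ ∃ τ ∈ T, i ∈ τ ∧ j ∈ τ)) a b := by
  refine hτ.induction (p := fun b => Relation.ReflTransGen _ a b) ha .refl ?_ b hb
  intro i hi j hj hij h
  refine h.tail ?_
  rcases hij with hij | hij
  · exact Or.inl (le_of_lt' hij)
  · exact Or.inr ⟨le_of_lt' hij, τ, hτT, hj, hi⟩

/-- The tubes at which a function attains its thresholds form a tubing. -/
theorem isTubingFamily_tight (hδ : IsHierarchical Set.univ c δ)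
    (hf : ∀ i d : ℤ, f (i + d * n) = f i + d * c) (hmono : ∀ i j, P.order.le i j → f i ≤ f j)
    (hfeas : ∀ O : P.ProperTubeClass, δ O ≤ O.spread f) :
    IsTubingFamily {O : P.ProperTubeClass | O.spread f = δ O} := by
  set U : Set (Set ℤ) := ⋃ O ∈ {O : P.ProperTubeClass | O.spread f = δ O}, O.1 with hU
  have htight : ∀ τ ∈ U, ∃ O : P.ProperTubeClass, τ ∈ O.1 ∧ O.spread f = δ O := by
    intro τ hτ
    obtain ⟨O, hO, hτO⟩ := mem_iUnion_classes.1 hτ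
    exact ⟨O, hτO, hO⟩
  have hprop : ∀ τ ∈ U, P.IsProperTube τ := fun τ hτ => by
    obtain ⟨O, hτO, -⟩ := htight τ hτ
    exact O.isProperTube hτO
  refine ⟨⟨fun τ hτ => (hprop τ hτ).1, ?_, ?_, ?_⟩, hprop⟩
  · rintro τ hτ _ ⟨d, rfl⟩
    obtain ⟨O, hO, hτO⟩ := mem_iUnion_classes.1 hτ
    exact mem_iUnion_classes.2 ⟨O, hO, O.shift_mem hτO d⟩
  · intro τ hτ σ hσ
    by_cases hd : Disjoint τ σ
    · exact Or.inr (Or.inr hd)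
    obtain ⟨a, haτ, haσ⟩ := Set.not_disjoint_iff.1 hd
    have hmem : ∀ ρ ∈ ({τ, σ} : Set (Set ℤ)), ρ ∈ U ∧ a ∈ ρ := by
      rintro ρ (rfl | rfl)
      · exact ⟨hτ, haτ⟩
      · exact ⟨hσ, haσ⟩
    have hsub : ∀ ρ ∈ ({τ, σ} : Set (Set ℤ)), ρ ⊆ P.backComponent
        (fun i j => P.order.le i j ∧ ∃ τ' ∈ ({τ, σ} : Set (Set ℤ)), i ∈ τ' ∧ j ∈ τ') a := by
      intro ρ hρ b hb
      have ht := (hprop ρ (hmem ρ hρ).1).1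
      exact ⟨backRel_of_mem_tube hρ ht (hmem ρ hρ).2 hb, backRel_of_mem_tube hρ ht hb (hmem ρ hρ).2⟩
    have hE := backComponent_mem_of_tight hδ hf hmono hfeas
      (fun ρ hρ => htight ρ (hmem ρ hρ).1) (Or.inl rfl : τ ∈ ({τ, σ} : Set (Set ℤ))) hsub
    rcases hE with hE | hE
    · exact Or.inr (Or.inl (hE ▸ hsub σ (Or.inr rfl)))
    · exact Or.inl (hE ▸ hsub τ (Or.inl rfl))
  · intro τ hcyc
    set T : Set (Set ℤ) := {ρ | Relation.TransGen (P.TubeEdge U) τ ρ ∧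
      Relation.TransGen (P.TubeEdge U) ρ τ} with hT
    have hτT : τ ∈ T := ⟨hcyc, hcyc⟩
    have hTU : ∀ ρ ∈ T, ρ ∈ U := by
      rintro ρ ⟨-, h⟩
      obtain ⟨σ, hσ, -⟩ := Relation.TransGen.head'_iff.1 h
      exact hσ.1
    have htubeT : ∀ ρ ∈ T, P.IsTube ρ := fun ρ hρ => (hprop ρ (hTU ρ hρ)).1
    have hedge : ∀ ρ ∈ T, ∀ σ ∈ T, P.TubeEdge U ρ σ → ∀ i ∈ ρ, ∀ j ∈ σ, Relation.ReflTransGen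
        (P.backRel (fun i j => P.order.le i j ∧ ∃ τ ∈ T, i ∈ τ ∧ j ∈ τ)) i j := by
      rintro ρ hρ σ hσ ⟨-, -, -, k, hk, l, hl, hkl⟩ i hi j hj
      exact ((backRel_of_mem_tube hρ (htubeT ρ hρ) hi hk).tail (Or.inl (le_of_lt' hkl))).trans
        (backRel_of_mem_tube hσ (htubeT σ hσ) hl hj)
    have hpath1 : ∀ ρ, Relation.TransGen (P.TubeEdge U) τ ρ → Relation.TransGen (P.TubeEdge U) ρ τ →
        ∀ i ∈ τ, ∀ j ∈ ρ, Relation.ReflTransGen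
        (P.backRel (fun i j => P.order.le i j ∧ ∃ τ ∈ T, i ∈ τ ∧ j ∈ τ)) i j := by
      intro ρ h1
      induction h1 with
      | single h => exact fun h2 => hedge τ hτT _ ⟨.single h, h2⟩ h
      | @tail ρ σ h h' ih =>
        intro h2 i hi j hj
        have hρ : ρ ∈ T := ⟨h, h2.head h'⟩
        obtain ⟨k, hk⟩ := (hprop ρ (hTU ρ hρ)).2.1.nonempty
        exact (ih (h2.head h') i hi k hk).trans (hedge ρ hρ σ ⟨h.tail h', h2⟩ h' k hk j hj)
    have hpath2 : ∀ ρ, Relation.TransGen (P.TubeEdge U) ρ τ → Relation.TransGen (P.TubeEdge U) τ ρ →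
        ∀ i ∈ ρ, ∀ j ∈ τ, Relation.ReflTransGen
        (P.backRel (fun i j => P.order.le i j ∧ ∃ τ ∈ T, i ∈ τ ∧ j ∈ τ)) i j := by
      intro ρ h1
      induction h1 using Relation.TransGen.head_induction_on with
      | single h => exact fun h2 => hedge _ ⟨h2, .single h⟩ τ hτT h
      | @head ρ σ h h' ih =>
        intro h2 i hi j hj
        have hσ : σ ∈ T := ⟨h2.tail h, h'⟩
        obtain ⟨k, hk⟩ := (hprop σ (hTU σ hσ)).2.1.nonempty
        exact (hedge ρ ⟨h2, h'.head h⟩ σ hσ h i hi k hk).trans (ih (h2.tail h) k hk j hj)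
    obtain ⟨a, ha⟩ := (hprop τ (hTU τ hτT)).2.1.nonempty
    have hsub : ∀ ρ ∈ T, ρ ⊆ P.backComponent
        (fun i j => P.order.le i j ∧ ∃ τ' ∈ T, i ∈ τ' ∧ j ∈ τ') a := fun ρ hρ b hb =>
      ⟨hpath1 ρ hρ.1 hρ.2 a ha b hb, hpath2 ρ hρ.2 hρ.1 b hb a ha⟩
    have hE := backComponent_mem_of_tight hδ hf hmono hfeas
      (fun ρ hρ => htight ρ (hTU ρ hρ)) hτT hsub
    -- the component is a tube of the cycle, but the next tube of the cycle is disjoint from it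
    obtain ⟨σ, hσ, hστ⟩ := Relation.TransGen.head'_iff.1 hE.2
    have hσT : σ ∈ T := ⟨hE.1.tail hσ, hcyc.trans_right hστ⟩
    obtain ⟨b, hb⟩ := (hprop σ (hTU σ hσT)).2.1.nonempty
    exact Set.disjoint_left.1 hσ.2.2.1 (hsub σ hσT hb) hb

/-- A monotone function whose spreads are at least the thresholds is strictly monotone. -/
theorem lt_of_feasible (hc : 0 < c) (hδ : IsHierarchical Set.univ c δ)
    (hf : ∀ i d : ℤ, f (i + d * n) = f i + d * c) (hmono : ∀ i j, P.order.le i j → f i ≤ f j)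
    (hfeas : ∀ O : P.ProperTubeClass, δ O ≤ O.spread f) {i j : ℤ} (hij : P.order.lt i j) :
    f i < f j := by
  by_contra! hle
  set W : ℤ → ℤ → Prop := fun a b => a = i ∧ b = j with hW
  have hWle : ∀ a b, W a b → P.order.le a b := by
    rintro a b ⟨rfl, rfl⟩
    exact le_of_lt' hij
  have hWg : ∀ a b, W a b → f b ≤ f a + 0 := by
    rintro a b ⟨rfl, rfl⟩
    linarith
  have hi : i ∈ P.backComponent W i := mem_backComponent_self i
  have hj : j ∈ P.backComponent W i :=
    ⟨.single (Or.inl (le_of_lt' hij)), .single (Or.inr ⟨rfl, rfl⟩)⟩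
  have htube := backComponent_isTube hf hmono le_rfl (by simpa using hc) hWle hWg i
  have hprop : P.IsProperTube (P.backComponent W i) :=
    ⟨htube.1, ⟨i, hi, j, hj, (lt_iff'.1 hij).2⟩, htube.2⟩
  have h1 := ProperTubeClass.spread_le (O := tubeClass _ hprop) hf (mem_shiftClass_self _) le_rfl
    (fun a ha b hb => by
      have := backComponent_bound hf hmono le_rfl (by simpa using hc) hWg hb ha
      linarith)
  have h2 := hfeas (tubeClass _ hprop)
  have h3 := hδ.pos (tubeClass _ hprop) trivial
  rw [mul_zero] at h1
  linarith

end Feasible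

end AffinePoset

/-! ### Faces and stellar subdivisions of polytopes -/

section Convexity

variable {E : Type*} [NormedAddCommGroup E] [InnerProductSpace ℝ E]

theorem convexHull_le_one {s : Set E} {l : StrongDual ℝ E} (hl : ∀ y ∈ s, l y ≤ 1) :
    ∀ y ∈ convexHull ℝ s, l y ≤ 1 := by
  have hconv : Convex ℝ {y | l y ≤ 1} := convex_halfSpace_le l.isLinear 1
  exact fun y hy => convexHull_min (t := {y | l y ≤ 1}) hl hconv hy

/-- The face of a convex hull on which a bounded functional attains its bound is spanned by the
generators that it contains. -/
theorem convexHull_face {s : Set E} {l : StrongDual ℝ E} (hl : ∀ y ∈ s, l y ≤ 1) :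
    {y ∈ convexHull ℝ s | l y = 1} = convexHull ℝ {y ∈ s | l y = 1} := by
  apply Set.Subset.antisymm
  · have hconv : Convex ℝ {y | l y ≤ 1 ∧ (l y = 1 → y ∈ convexHull ℝ {y ∈ s | l y = 1})} := by
      rw [convex_iff_forall_pos]
      rintro x ⟨hx1, hx2⟩ y ⟨hy1, hy2⟩ a b ha hb hab
      have e : l (a • x + b • y) = a * l x + b * l y := by simp
      have h1 : a * l x ≤ a := by nlinarith
      have h2 : b * l y ≤ b := by nlinarith
      refine ⟨by rw [e]; linarith, fun h => ?_⟩
      rw [e] at h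
      have h3 : l x = 1 := by
        have : a * l x = a := by linarith
        field_simp at this
        exact this
      have h4 : l y = 1 := by
        have : b * l y = b := by linarith
        field_simp at this
        exact this
      exact convex_convexHull ℝ _ (hx2 h3) (hy2 h4) ha.le hb.le hab
    rintro y ⟨hy, hy1⟩
    exact (convexHull_min
      (t := {y | l y ≤ 1 ∧ (l y = 1 → y ∈ convexHull ℝ {y ∈ s | l y = 1})})
      (fun z hz => ⟨hl z hz, fun h => subset_convexHull ℝ _ ⟨hz, h⟩⟩) hconv hy).2 hy1
  · intro y hy
    refine ⟨convexHull_mono (fun z hz => hz.1) hy, ?_⟩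
    have hconv : Convex ℝ {y | l y = 1} := convex_hyperplane l.isLinear 1
    exact convexHull_min (t := {y | l y = 1}) (fun z hz => hz.2) hconv hy

theorem isProperFace_of_le_one {Q : Set E} (h0 : (0 : E) ∈ Q) {l : StrongDual ℝ E}
    (hl : ∀ y ∈ Q, l y ≤ 1) : IsProperFace Q {y ∈ Q | l y = 1} := by
  refine ⟨fun ⟨x, hx, hx1⟩ => ⟨l, ?_⟩, fun h => ?_⟩
  · ext y
    constructor
    · rintro ⟨hy, hy1⟩
      exact ⟨hy, fun z hz => hy1 ▸ hl z hz⟩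
    · rintro ⟨hy, hy1⟩
      exact ⟨hy, le_antisymm (hl y hy) (hx1 ▸ hy1 x hx)⟩
  · have : (0 : E) ∈ {y ∈ Q | l y = 1} := by
      rw [h]
      exact h0
    simpa using this.2

/-- A nonzero functional is positive somewhere on a neighbourhood of the origin. -/
theorem exists_pos_of_mem_interior {Q : Set E} (h0 : (0 : E) ∈ interior Q) {l : StrongDual ℝ E}
    (hl : l ≠ 0) : ∃ y ∈ Q, 0 < l y := by
  obtain ⟨v, hv⟩ : ∃ v, 0 < l v := by
    by_contra! hcon
    refine hl (ContinuousLinearMap.ext fun v => le_antisymm (hcon v) ?_)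
    have := hcon (-v)
    simp only [map_neg, Left.neg_nonpos_iff] at this
    simpa using this
  have hev : ∀ᶠ t : ℝ in nhdsWithin 0 (Set.Ioi 0), t • v ∈ Q := by
    have hc : Filter.Tendsto (fun t : ℝ => t • v) (nhds 0) (nhds 0) := by
      have : Continuous fun t : ℝ => t • v := by fun_prop
      simpa using this.tendsto 0
    exact nhdsWithin_le_nhds (hc (mem_interior_iff_mem_nhds.1 h0))
  obtain ⟨t, ht, ht0⟩ := (hev.and self_mem_nhdsWithin).exists
  refine ⟨t • v, ht, ?_⟩
  rw [map_smul, smul_eq_mul]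
  exact mul_pos ht0 hv

/-- A nonempty proper face of a convex set around the origin is cut out by a functional that is
bounded by `1` on the set. -/
theorem IsProperFace.exists_functional {Q F : Set E} (h0 : (0 : E) ∈ interior Q)
    (hF : IsProperFace Q F) (hne : F.Nonempty) :
    ∃ l : StrongDual ℝ E, (∀ y ∈ Q, l y ≤ 1) ∧ F = {y ∈ Q | l y = 1} := by
  obtain ⟨l, hl⟩ := hF.1 hne
  obtain ⟨x, hx⟩ := hne
  have hx' := hx
  rw [hl] at hx'
  obtain ⟨hxQ, hmax⟩ := hx'
  have hl0 : l ≠ 0 := by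
    rintro rfl
    apply hF.2
    rw [hl]
    ext y
    simp
  obtain ⟨y, hy, hy0⟩ := exists_pos_of_mem_interior h0 hl0
  have hpos : 0 < l x := hy0.trans_le (hmax y hy)
  refine ⟨(l x)⁻¹ • l, fun z hz => ?_, ?_⟩
  · simp only [smul_apply, smul_eq_mul]
    rw [inv_mul_le_one₀ hpos]
    exact hmax z hz
  · rw [hl]
    ext z
    simp only [smul_apply, smul_eq_mul, Set.mem_ofPred_eq]
    refine and_congr_right fun hz => ?_
    rw [inv_mul_eq_one₀ hpos.ne']
    exact ⟨fun h => le_antisymm (h x hxQ) (hmax z hz), fun h w hw => h ▸ hmax w hw⟩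

/-- The functional that is bounded by `1` and cuts out a given facet is unique: otherwise moving
along the difference of two such functionals would produce a larger proper face. -/
theorem facet_functional_unique {s : Set E} (hs : s.Finite)
    (h0 : (0 : E) ∈ interior (convexHull ℝ s))
    {G : Set E} (hG : IsFacet (convexHull ℝ s) G) {l l' : StrongDual ℝ E}
    (hl : ∀ y ∈ convexHull ℝ s, l y ≤ 1) (hlG : G = {y ∈ convexHull ℝ s | l y = 1})
    (hlG' : G = {y ∈ convexHull ℝ s | l' y = 1}) : l = l' := by
  by_contra hne
  have hd : l - l' ≠ 0 := sub_ne_zero.2 hne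
  have hdG : ∀ y ∈ G, (l - l') y = 0 := by
    intro y hy
    have h1 : l y = 1 := by rw [hlG] at hy; exact hy.2
    have h2 : l' y = 1 := by rw [hlG'] at hy; exact hy.2
    simp [h1, h2]
  have hpos : (hs.toFinset.filter fun v => 0 < (l - l') v).Nonempty := by
    obtain ⟨y, hy, hy0⟩ := exists_pos_of_mem_interior h0 hd
    by_contra hemp
    have hle : ∀ v ∈ s, (l - l') v ≤ 0 := by
      intro v hv
      by_contra! h
      exact hemp ⟨v, Finset.mem_filter.2 ⟨hs.mem_toFinset.2 hv, h⟩⟩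
    have hconv : Convex ℝ {y | (l - l') y ≤ 0} := convex_halfSpace_le (l - l').isLinear 0
    have := convexHull_min (t := {y | (l - l') y ≤ 0}) hle hconv hy
    exact absurd this (not_le.2 hy0)
  obtain ⟨v, hv, hmin⟩ := Finset.exists_min_image _ (fun v => (1 - l v) / (l - l') v) hpos
  obtain ⟨hvs, hv0⟩ := Finset.mem_filter.1 hv
  have hvs : v ∈ convexHull ℝ s := subset_convexHull ℝ s (hs.mem_toFinset.1 hvs)
  set t := (1 - l v) / (l - l') v with ht
  have ht0 : 0 ≤ t := div_nonneg (by linarith [hl v hvs]) hv0.le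
  have hle : ∀ y ∈ s, (l + t • (l - l')) y ≤ 1 := by
    intro y hy
    have e : (l + t • (l - l')) y = l y + t * (l - l') y := by
      simp
    rw [e]
    have hly := hl y (subset_convexHull ℝ s hy)
    by_cases hy0 : 0 < (l - l') y
    · have := hmin y (Finset.mem_filter.2 ⟨hs.mem_toFinset.2 hy, hy0⟩)
      rw [le_div_iff₀ hy0] at this
      linarith
    · nlinarith
  have hle' := convexHull_le_one hle
  have hface := isProperFace_of_le_one (interior_subset h0) hle'
  have hsub : G ⊆ {y ∈ convexHull ℝ s | (l + t • (l - l')) y = 1} := by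
    intro y hy
    have h1 : y ∈ {y ∈ convexHull ℝ s | l y = 1} := hlG ▸ hy
    refine ⟨h1.1, ?_⟩
    have e : (l + t • (l - l')) y = l y + t * (l - l') y := by simp
    rw [e, hdG y hy, h1.2]
    ring
  have hvH : v ∈ {y ∈ convexHull ℝ s | (l + t • (l - l')) y = 1} := by
    refine ⟨hvs, ?_⟩
    have e : (l + t • (l - l')) v = l v + t * (l - l') v := by simp
    rw [e, ht, div_mul_cancel₀ _ hv0.ne']
    ring
  exact hv0.ne' (hdG v (hG.2 hface hsub hvH))

theorem exists_extension_of_mem_intrinsicInterior {F : Set E} {x y : E}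
    (hx : x ∈ intrinsicInterior ℝ F) (hy : y ∈ F) : ∃ t : ℝ, 0 < t ∧ x + t • (x - y) ∈ F := by
  obtain ⟨x', hx', rfl⟩ := mem_intrinsicInterior.1 hx
  have hyA : y ∈ affineSpan ℝ F := subset_affineSpan ℝ F hy
  let γ : ℝ → affineSpan ℝ F := fun t =>
    ⟨AffineMap.lineMap y (x' : E) (1 + t), AffineMap.lineMap_mem _ hyA x'.2⟩
  have hγ : Continuous γ := by
    refine Continuous.subtype_mk ?_ _
    simp only [AffineMap.lineMap_apply_module]
    fun_prop
  have hγ0 : γ 0 = x' := by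
    apply Subtype.ext
    simp [γ]
  have hev : ∀ᶠ t : ℝ in nhdsWithin 0 (Set.Ioi 0), γ t ∈ ((↑) ⁻¹' F : Set (affineSpan ℝ F)) := by
    apply nhdsWithin_le_nhds
    have := hγ.tendsto 0
    rw [hγ0] at this
    exact this (mem_interior_iff_mem_nhds.1 hx')
  obtain ⟨t, ht, ht0⟩ := (hev.and self_mem_nhdsWithin).exists
  refine ⟨t, ht0, ?_⟩
  have h : (γ t : E) ∈ F := ht
  convert h using 1
  simp only [γ, AffineMap.lineMap_apply_module]
  module

/-- The faces that a functional bounded by `1` cuts out contain `F` as soon as they contain a point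
of the relative interior of `F`. -/
theorem eq_one_of_intrinsicInterior {F : Set E} {l : StrongDual ℝ E} (hl : ∀ y ∈ F, l y ≤ 1) {x : E}
    (hx : x ∈ intrinsicInterior ℝ F) (hx1 : l x = 1) : ∀ y ∈ F, l y = 1 := by
  intro y hy
  obtain ⟨t, ht, h⟩ := exists_extension_of_mem_intrinsicInterior hx hy
  have h1 := hl _ h
  have h2 := hl y hy
  simp only [map_add, map_smul, map_sub, smul_eq_mul, hx1] at h1
  nlinarith

/-- All sufficiently small `ε` are admissible in a stellar subdivision. -/
theorem eventually_stellar {s : Set E} (hs : s.Finite) (hne : s.Nonempty)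
    (h0 : (0 : E) ∈ interior (convexHull ℝ s)) {F : Set E} (hFne : F.Nonempty)
    (hF : IsProperFace (convexHull ℝ s) F) {x : E} (hx : x ∈ intrinsicInterior ℝ F) :
    ∀ᶠ ε : ℝ in nhdsWithin 0 (Set.Ioi 0), IsStellarSubdivision (convexHull ℝ s) F
      (convexHull ℝ (insert ((1 + ε) • x) s)) := by
  set Q := convexHull ℝ s with hQ
  have hFQ : F ⊆ Q := by
    obtain ⟨l, hl⟩ := hF.1 hFne
    rw [hl]
    exact fun y hy => hy.1
  set Λ : Set (StrongDual ℝ E) := {l | (∀ y ∈ Q, l y ≤ 1) ∧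
    IsFacet Q {y ∈ Q | l y = 1} ∧ ¬ F ⊆ {y ∈ Q | l y = 1}} with hΛ
  have hΛfin : Λ.Finite := by
    refine Set.Finite.of_injOn (f := fun l => {y ∈ s | l y = 1}) (t := 𝒫 s)
      (fun l _ y hy => hy.1) ?_ hs.finite_subsets
    rintro l ⟨hl, hlG, -⟩ l' ⟨hl', hlG', -⟩ h
    have e : {y ∈ Q | l y = 1} = {y ∈ Q | l' y = 1} := by
      rw [hQ, convexHull_face fun y hy => hl y (subset_convexHull ℝ s hy),
        convexHull_face fun y hy => hl' y (subset_convexHull ℝ s hy)]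
      exact congrArg _ h
    exact facet_functional_unique hs h0 hlG hl rfl e
  have hev : ∀ᶠ ε : ℝ in nhdsWithin 0 (Set.Ioi 0), ∀ l ∈ Λ, l ((1 + ε) • x) < 1 := by
    rw [Filter.eventually_all_finite hΛfin]
    rintro l ⟨hl, -, hFl⟩
    apply nhdsWithin_le_nhds
    have hlx : l x < 1 := by
      refine lt_of_le_of_ne (hl x (hFQ (intrinsicInterior_subset hx))) fun h => hFl fun y hy => ?_
      exact ⟨hFQ hy, eq_one_of_intrinsicInterior (fun y hy => hl y (hFQ hy)) hx h y hy⟩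
    have hc : Continuous fun ε : ℝ => l ((1 + ε) • x) := by fun_prop
    have ht := hc.tendsto 0
    simp only [add_zero, one_smul] at ht
    exact ht.eventually_lt_const hlx
  filter_upwards [hev, self_mem_nhdsWithin] with ε hε hε0
  refine ⟨⟨hs.toFinset, by simpa using hne, by simp [hQ]⟩, h0, hFne, hF, x, hx, ε, hε0, ?_, ?_⟩
  · rintro G hG hFG l hl rfl
    exact hε l ⟨hl, hG, hFG⟩
  · refine Set.Subset.antisymm
      (convexHull_mono (Set.insert_subset_insert (subset_convexHull ℝ s)))
      (convexHull_min (Set.insert_subset ?_ ?_) (convex_convexHull ℝ _))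
    · exact subset_convexHull ℝ _ (Set.mem_insert _ _)
    · exact convexHull_mono (Set.subset_insert _ _)

theorem exists_weights {ι : Type*} (t : Finset ι) (v : ι → E) {y : E}
    (hy : y ∈ convexHull ℝ (v '' t)) : ∃ w : ι → ℝ, (∀ k, 0 ≤ w k) ∧ (∀ k, k ∉ t → w k = 0) ∧
      ∑ k ∈ t, w k = 1 ∧ ∑ k ∈ t, w k • v k = y := by
  classical
  have hconv : Convex ℝ {y | ∃ w : ι → ℝ, (∀ k, 0 ≤ w k) ∧ (∀ k, k ∉ t → w k = 0) ∧
      ∑ k ∈ t, w k = 1 ∧ ∑ k ∈ t, w k • v k = y} := by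
    rintro _ ⟨w, hw0, hwt, hw1, rfl⟩ _ ⟨u, hu0, hut, hu1, rfl⟩ a b ha hb hab
    refine ⟨fun k => a * w k + b * u k, fun k => by have := hw0 k; have := hu0 k; positivity,
      fun k hk => by simp [hwt k hk, hut k hk], ?_, ?_⟩
    · rw [Finset.sum_add_distrib, ← Finset.mul_sum, ← Finset.mul_sum, hw1, hu1, mul_one, mul_one,
        hab]
    · simp only [add_smul, mul_smul, Finset.sum_add_distrib, Finset.smul_sum]
  refine convexHull_min ?_ hconv hy
  rintro _ ⟨k, hk, rfl⟩
  refine ⟨fun j => if j = k then 1 else 0, fun j => by dsimp only; split_ifs <;> norm_num,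
    fun j hj => ?_,
    ?_, ?_⟩
  · refine if_neg ?_
    rintro rfl
    exact hj hk
  · rw [Finset.sum_ite_eq' t k]
    simpa using hk
  · simp only [ite_smul, one_smul, zero_smul]
    rw [Finset.sum_ite_eq' t k]
    exact if_pos hk

/-- A combination with positive weights of the generators of a polytope lies in its relative
interior. -/
theorem sum_mem_intrinsicInterior [FiniteDimensional ℝ E] {ι : Type*} (t : Finset ι)
    (ht : t.Nonempty) (v : ι → E) (w : ι → ℝ)
    (hw : ∀ k ∈ t, 0 < w k) (hw1 : ∑ k ∈ t, w k = 1) :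
    ∑ k ∈ t, w k • v k ∈ intrinsicInterior ℝ (convexHull ℝ (v '' t)) := by
  set F := convexHull ℝ (v '' (t : Set ι)) with hF
  have hFc : Convex ℝ F := convex_convexHull ℝ _
  have hFne : F.Nonempty := (Set.Nonempty.image v ht).convexHull
  obtain ⟨z, hz⟩ := hFne.intrinsicInterior hFc
  obtain ⟨u, hu0, -, hu1, huz⟩ := exists_weights t v (intrinsicInterior_subset hz)
  set x := ∑ k ∈ t, w k • v k with hx
  -- beyond `x`, as seen from the relatively interior point `z`, there still is a point of `F`
  obtain ⟨ε, hε0, hε⟩ : ∃ ε : ℝ, 0 < ε ∧ x + ε • (x - z) ∈ F := by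
    have hev : ∀ᶠ ε : ℝ in nhdsWithin 0 (Set.Ioi 0), ∀ k ∈ t, 0 < w k + ε * (w k - u k) := by
      rw [Filter.eventually_all_finset]
      intro k hk
      apply nhdsWithin_le_nhds
      have hc : Continuous fun ε : ℝ => w k + ε * (w k - u k) := by fun_prop
      have ht := hc.tendsto 0
      simp only [zero_mul, add_zero] at ht
      exact ht.eventually_const_lt (hw k hk)
    obtain ⟨ε, h, hε0⟩ := (hev.and self_mem_nhdsWithin).exists
    refine ⟨ε, hε0, ?_⟩
    have e : x + ε • (x - z) = ∑ k ∈ t, (w k + ε * (w k - u k)) • v k := by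
      rw [← huz, hx, ← Finset.sum_sub_distrib, Finset.smul_sum, ← Finset.sum_add_distrib]
      refine Finset.sum_congr rfl fun k _ => ?_
      module
    rw [e]
    refine hFc.sum_mem (fun k hk => (h k hk).le) ?_ fun k hk =>
      subset_convexHull ℝ _ ⟨k, hk, rfl⟩
    rw [Finset.sum_add_distrib, ← Finset.mul_sum, Finset.sum_sub_distrib, hw1, hu1]
    ring
  obtain ⟨z', hz', rfl⟩ := mem_intrinsicInterior.1 hz
  have hxF : x ∈ F := hFc.sum_mem (fun k hk => (hw k hk).le) hw1 fun k hk =>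
    subset_convexHull ℝ _ ⟨k, hk, rfl⟩
  have hxA : x ∈ affineSpan ℝ F := subset_affineSpan ℝ F hxF
  refine mem_intrinsicInterior.2 ⟨⟨x, hxA⟩, ?_, rfl⟩
  rw [mem_interior_iff_mem_nhds]
  let γ : affineSpan ℝ F → affineSpan ℝ F := fun p =>
    ⟨((1 + ε) / ε) • ((p : E) - x) + (z' : E), by
      have := AffineSubspace.vadd_mem_of_mem_direction (Submodule.smul_mem _ ((1 + ε) / ε)
        (AffineSubspace.vsub_mem_direction p.2 hxA)) z'.2
      simpa using this⟩
  have hγ : Continuous γ := by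
    refine Continuous.subtype_mk ?_ _
    fun_prop
  have hγx : γ ⟨x, hxA⟩ = z' := by
    apply Subtype.ext
    simp [γ]
  have hnhds := hγ.tendsto ⟨x, hxA⟩
  rw [hγx] at hnhds
  filter_upwards [hnhds (mem_interior_iff_mem_nhds.1 hz')] with p hp
  have hp' : ((1 + ε) / ε) • ((p : E) - x) + (z' : E) ∈ F := hp
  have hcomb := hFc hε hp' (a := 1 / (1 + ε)) (b := ε / (1 + ε)) (by positivity) (by positivity)
    (by field_simp)
  show (p : E) ∈ F
  convert hcomb using 1
  have h1 : (1 + ε) ≠ 0 := by positivity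
  have h2 : ε ≠ 0 := hε0.ne'
  match_scalars <;> field_simp <;> ring

/-- A ray from the origin leaves a compact convex neighbourhood of the origin in a point of a
proper face. -/
theorem exists_smul_mem_face {C : Set E} (hconv : Convex ℝ C) (hcomp : IsCompact C)
    (h0 : (0 : E) ∈ interior C) {y : E} (hy : y ≠ 0) :
    ∃ r : ℝ, 0 < r ∧ ∃ l : StrongDual ℝ E, (∀ z ∈ C, l z ≤ 1) ∧ r • y ∈ C ∧ l (r • y) = 1 := by
  have hnhds : C ∈ nhds (0 : E) := mem_interior_iff_mem_nhds.1 h0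
  have hpos : 0 < gauge C y := (gauge_pos (absorbent_nhds_zero hnhds)
    (NormedSpace.isVonNBounded_of_isBounded ℝ hcomp.isBounded)).2 hy
  set x := (gauge C y)⁻¹ • y with hx
  have hg : gauge C x = 1 := by
    rw [hx, gauge_smul_of_nonneg (inv_nonneg.2 hpos.le), smul_eq_mul, inv_mul_cancel₀ hpos.ne']
  have hxC : x ∈ C := by
    have := (gauge_le_one_iff_mem_closure hconv hnhds).1 hg.le
    rwa [hcomp.isClosed.closure_eq] at this
  have hxint : x ∉ interior C := fun h =>
    absurd ((gauge_lt_one_iff_mem_interior hconv hnhds).2 h) (by rw [hg]; exact lt_irrefl _)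
  obtain ⟨l, hl⟩ := geometric_hahn_banach_open_point hconv.interior isOpen_interior hxint
  have hlx : 0 < l x := by simpa using hl 0 h0
  have hle : ∀ z ∈ C, l z ≤ l x := by
    intro z hz
    have hz' : z ∈ closure (interior C) := by
      rw [hconv.closure_interior_eq_closure_of_nonempty_interior ⟨0, h0⟩]
      exact subset_closure hz
    exact closure_minimal (s := interior C) (t := {z | l z ≤ l x}) (fun w hw => (hl w hw).le)
      (isClosed_le l.continuous continuous_const) hz'
  refine ⟨_, inv_pos.2 hpos, (l x)⁻¹ • l, fun z hz => ?_, hxC, ?_⟩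
  · simp only [smul_apply, smul_eq_mul]
    rw [inv_mul_le_one₀ hlx]
    exact hle z hz
  · show (l x)⁻¹ * l x = 1
    exact inv_mul_cancel₀ hlx.ne'

/-- The bipolar theorem for finite sets that contain the origin. -/
theorem mem_convexHull_of_polar [CompleteSpace E] {s : Set E} (hs : s.Finite) (h0 : (0 : E) ∈ s)
    {y : E}
    (hy : ∀ u : E, (∀ v ∈ s, inner ℝ u v ≤ 1) → inner ℝ u y ≤ 1) : y ∈ convexHull ℝ s := by
  by_contra hcon
  obtain ⟨l, a, hla, hay⟩ := geometric_hahn_banach_closed_point (convex_convexHull ℝ s)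
    (hs.isClosed_convexHull ℝ) hcon
  have ha : 0 < a := by simpa using hla 0 (subset_convexHull ℝ s h0)
  have hin : ∀ v, inner ℝ (a⁻¹ • (InnerProductSpace.toDual ℝ E).symm l) v = a⁻¹ * l v := by
    intro v
    rw [real_inner_smul_left, InnerProductSpace.toDual_symm_apply]
  have := hy (a⁻¹ • (InnerProductSpace.toDual ℝ E).symm l) fun v hv => by
    rw [hin, inv_mul_le_one₀ ha]
    exact (hla v (subset_convexHull ℝ s hv)).le
  rw [hin, inv_mul_le_one₀ ha] at this
  linarith

end Convexity

/-! ### Coordinates on the space of the order polytope -/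

section Coordinates

variable {n : ℕ} [NeZero n] {c : ℝ}

theorem periodicExtension_add_mul (c : ℝ) (x : sumZero n) (i d : ℤ) :
    periodicExtension c x (i + d * n) = periodicExtension c x i + d * c := by
  have hn : (n : ℤ) ≠ 0 := by exact_mod_cast NeZero.ne n
  unfold periodicExtension
  rw [Int.add_mul_ediv_right _ _ hn]
  push_cast
  simp only [ZMod.natCast_self, mul_zero, add_zero]
  ring

theorem periodicExtension_sub (c : ℝ) (x p : sumZero n) (i : ℤ) :
    periodicExtension c x i - periodicExtension c p i =
      ((x - p : sumZero n) : EuclideanSpace ℝ (ZMod n)) (i : ZMod n) := by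
  simp [periodicExtension]

/-- Every quasi-periodic function is, up to an additive constant, the extension of a vector. -/
theorem exists_periodicExtension_eq {f : ℤ → ℝ} (hf : ∀ i d : ℤ, f (i + d * n) = f i + d * c) :
    ∃ (x : sumZero n) (t : ℝ), ∀ i, periodicExtension c x i = f i + t := by
  set m : ℝ := (∑ a : ZMod n, f (a.val : ℤ)) / n with hm
  have hn : (n : ℝ) ≠ 0 := by exact_mod_cast NeZero.ne n
  have hmem : (WithLp.toLp 2 fun a : ZMod n => f (a.val : ℤ) - m) ∈ sumZero n := by
    show ∑ a : ZMod n, (f (a.val : ℤ) - m) = 0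
    rw [Finset.sum_sub_distrib, Finset.sum_const, Finset.card_univ, ZMod.card, nsmul_eq_mul, hm,
      mul_div_cancel₀ _ hn, sub_self]
  refine ⟨⟨_, hmem⟩, -m, fun i => ?_⟩
  have h1 : f i = f (i % n) + (i / n : ℤ) * c := by
    rw [← hf]
    congr 1
    rw [mul_comm]
    exact (Int.emod_add_mul_ediv i n).symm
  have h2 : periodicExtension c (⟨_, hmem⟩ : sumZero n) i =
      f (((i : ZMod n).val : ℕ) : ℤ) - m + c * ((i / (n : ℤ) : ℤ) : ℝ) := rfl
  rw [h2, ZMod.val_intCast, h1]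
  ring

/-- The vector `e_i - e_j`, whose coordinates depend on the residues of `i` and `j` only. -/
noncomputable def root (n : ℕ) [NeZero n] (i j : ℤ) : sumZero n :=
  ⟨EuclideanSpace.single (i : ZMod n) 1 - EuclideanSpace.single (j : ZMod n) 1, by
    show ∑ a, (EuclideanSpace.single (i : ZMod n) (1 : ℝ) -
      EuclideanSpace.single (j : ZMod n) (1 : ℝ) : EuclideanSpace ℝ (ZMod n)) a = 0
    simp [Finset.sum_sub_distrib]⟩

theorem inner_root (c : ℝ) (x p : sumZero n) (i j : ℤ) : inner ℝ (x - p) (root n i j) =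
    (periodicExtension c p j - periodicExtension c p i) -
      (periodicExtension c x j - periodicExtension c x i) := by
  have h1 := periodicExtension_sub c x p i
  have h2 := periodicExtension_sub c x p j
  have h3 : inner ℝ (x - p) (root n i j) =
      ((x - p : sumZero n) : EuclideanSpace ℝ (ZMod n)) (i : ZMod n) -
      ((x - p : sumZero n) : EuclideanSpace ℝ (ZMod n)) (j : ZMod n) := by
    rw [Submodule.coe_inner, root]
    simp [inner_sub_right, EuclideanSpace.inner_single_right]
  rw [h3, ← h1, ← h2]
  ring

theorem finrank_sumZero : Module.finrank ℝ (sumZero n) + 1 = n := by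
  let φ : EuclideanSpace ℝ (ZMod n) →ₗ[ℝ] ℝ :=
    { toFun := fun x => ∑ a, x a
      map_add' := fun x y => by simp [Finset.sum_add_distrib]
      map_smul' := fun t x => by simp [Finset.mul_sum] }
  have hker : sumZero n = LinearMap.ker φ := by
    ext x
    rfl
  have hsurj : Function.Surjective φ := by
    intro t
    refine ⟨EuclideanSpace.single 0 t, ?_⟩
    show ∑ a, (EuclideanSpace.single (0 : ZMod n) t : EuclideanSpace ℝ (ZMod n)) a = t
    simp
  have h := LinearMap.finrank_range_add_finrank_ker φ
  rw [LinearMap.range_eq_top.2 hsurj, finrank_top, Module.finrank_self, finrank_euclideanSpace,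
    ZMod.card, ← hker] at h
  omega

end Coordinates

namespace AffinePoset

variable {n : ℕ} [NeZero n] {P : AffinePoset n} {c : ℝ}

theorem mem_orderPolytope_iff (hc : 0 ≤ c) {x : sumZero n} : x ∈ P.orderPolytope c ↔
    ∀ q ∈ P.minimalPairs, periodicExtension c x q.1 ≤ periodicExtension c x q.2 := by
  refine ⟨fun h q hq => h _ _ (le_of_lt' (lt_of_mem_minimalPairs hq)), fun h i j hij => ?_⟩
  by_cases hne : i = j
  · rw [hne]
  obtain ⟨q, hq, d, k, hk, rfl, rfl⟩ := exists_minimalPair (lt_iff'.2 ⟨hij, hne⟩)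
  simp only [periodicExtension_add_mul]
  have hk' : (0 : ℝ) ≤ k * c := mul_nonneg (by exact_mod_cast hk) hc
  linarith [h q hq]

theorem orderInterior_subset {p : sumZero n} (hp : p ∈ P.orderInterior c) :
    p ∈ P.orderPolytope c := by
  intro i j hij
  by_cases hne : i = j
  · rw [hne]
  exact (hp i j (lt_iff'.2 ⟨hij, hne⟩)).le

/-- The order polytope is bounded, because any two residues are comparable up to a translation. -/
theorem exists_norm_sub_le (P : AffinePoset n) (c : ℝ) : ∃ R : ℝ, 0 < R ∧
    ∀ x ∈ P.orderPolytope c, ∀ p ∈ P.orderPolytope c, ‖x - p‖ ≤ R := by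
  choose t ht using P.exists_le_add_mul
  set B : ℝ := ∑ a : ZMod n, ∑ b : ZMod n, |t (a.val : ℤ) (b.val : ℤ) * c| with hB
  have hB0 : 0 ≤ B := Finset.sum_nonneg fun a _ => Finset.sum_nonneg fun b _ => abs_nonneg _
  have hn : 0 < n := Nat.pos_of_ne_zero (NeZero.ne n)
  have hval : ∀ (x : sumZero n) (a : ZMod n),
      periodicExtension c x (a.val : ℤ) = (x : EuclideanSpace ℝ (ZMod n)) a := by
    intro x a
    have h : ((a.val : ℤ) / (n : ℤ)) = 0 :=
      Int.ediv_eq_zero_of_lt (by positivity) (by exact_mod_cast ZMod.val_lt a)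
    rw [periodicExtension, h]
    simp
  have hdiff : ∀ x ∈ P.orderPolytope c, ∀ a b : ZMod n,
      (x : EuclideanSpace ℝ (ZMod n)) a - (x : EuclideanSpace ℝ (ZMod n)) b ≤ B := by
    intro x hx a b
    have h1 := hx _ _ (ht (a.val : ℤ) (b.val : ℤ))
    rw [periodicExtension_add_mul, hval, hval] at h1
    have h2 : |t (a.val : ℤ) (b.val : ℤ) * c| ≤ B :=
      (Finset.single_le_sum (f := fun b : ZMod n => |t (a.val : ℤ) (b.val : ℤ) * c|)
        (fun b _ => abs_nonneg _) (Finset.mem_univ b)).trans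
        (Finset.single_le_sum (f := fun a : ZMod n => ∑ b : ZMod n,
          |t (a.val : ℤ) (b.val : ℤ) * c|)
          (fun a _ => Finset.sum_nonneg fun b _ => abs_nonneg _) (Finset.mem_univ a))
    linarith [le_abs_self (t (a.val : ℤ) (b.val : ℤ) * c)]
  have hcoord : ∀ x ∈ P.orderPolytope c, ∀ a : ZMod n,
      |(x : EuclideanSpace ℝ (ZMod n)) a| ≤ B := by
    intro x hx a
    have hsum : ∑ b, (x : EuclideanSpace ℝ (ZMod n)) b = 0 := x.2
    have e : ∑ b : ZMod n, ((x : EuclideanSpace ℝ (ZMod n)) a -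
        (x : EuclideanSpace ℝ (ZMod n)) b) = n * (x : EuclideanSpace ℝ (ZMod n)) a := by
      rw [Finset.sum_sub_distrib, hsum, Finset.sum_const, Finset.card_univ, ZMod.card,
        nsmul_eq_mul, sub_zero]
    have e' : ∑ b : ZMod n, ((x : EuclideanSpace ℝ (ZMod n)) b -
        (x : EuclideanSpace ℝ (ZMod n)) a) = -(n * (x : EuclideanSpace ℝ (ZMod n)) a) := by
      rw [Finset.sum_sub_distrib, hsum, Finset.sum_const, Finset.card_univ, ZMod.card,
        nsmul_eq_mul, zero_sub]
    have h1 := Finset.sum_le_card_nsmul Finset.univ _ B fun b _ => hdiff x hx a b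
    have h2 := Finset.sum_le_card_nsmul Finset.univ _ B fun b _ => hdiff x hx b a
    rw [e, Finset.card_univ, ZMod.card, nsmul_eq_mul] at h1
    rw [e', Finset.card_univ, ZMod.card, nsmul_eq_mul] at h2
    have hn' : (0 : ℝ) < n := by exact_mod_cast hn
    rw [abs_le]
    constructor <;> nlinarith
  have hnorm : ∀ x ∈ P.orderPolytope c, ‖x‖ ≤ n * B + 1 := by
    intro x hx
    refine abs_le_of_sq_le_sq' ?_ (by positivity) |>.2
    have h1 : ‖x‖ ^ 2 = ∑ a, ‖(x : EuclideanSpace ℝ (ZMod n)) a‖ ^ 2 := by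
      rw [← EuclideanSpace.norm_sq_eq]
      rfl
    have h2 : ∑ a, ‖(x : EuclideanSpace ℝ (ZMod n)) a‖ ^ 2 ≤ n * B ^ 2 := by
      have := Finset.sum_le_card_nsmul Finset.univ
        (fun a => ‖(x : EuclideanSpace ℝ (ZMod n)) a‖ ^ 2) (B ^ 2) fun a _ =>
        pow_le_pow_left₀ (norm_nonneg _) (hcoord x hx a) 2
      rwa [Finset.card_univ, ZMod.card, nsmul_eq_mul] at this
    have hn1 : (1 : ℝ) ≤ n := by exact_mod_cast hn
    rw [h1]
    nlinarith [mul_nonneg (mul_nonneg (sub_nonneg.2 hn1) (by positivity : (0 : ℝ) ≤ n))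
      (sq_nonneg B), mul_nonneg (by positivity : (0 : ℝ) ≤ n) hB0]
  refine ⟨2 * (n * B + 1), by positivity, fun x hx p hp => ?_⟩
  linarith [norm_sub_le x p, hnorm x hx, hnorm p hp]

/-- For each tubing there is a point of the order polytope that is constant exactly on the proper
tubes contained in a tube of the tubing, and that identifies no further comparable integers. -/
theorem exists_collapsing_point (hc : 0 < c) {A : Set P.ProperTubeClass} (hA : IsTubingFamily A) :
    ∃ x ∈ P.orderPolytope c,
      (∀ i j, P.order.lt i j → (periodicExtension c x i = periodicExtension c x j ↔
        ∃ O ∈ A, ∃ σ ∈ O.1, i ∈ σ ∧ j ∈ σ)) ∧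
      ∀ (O : P.ProperTubeClass) (τ : Set ℤ), τ ∈ O.1 →
        (O.spread (periodicExtension c x) = 0 ↔ ∃ O' ∈ A, ∃ σ ∈ O'.1, τ ⊆ σ) := by
  obtain ⟨f, hf, hmono, h1, h2⟩ := exists_spread_eq_zero_iff c hc hA
  obtain ⟨x, t, hx⟩ := exists_periodicExtension_eq hf
  refine ⟨x, fun i j hij => ?_, fun i j hij => ?_, fun O τ hτ => ?_⟩
  · rw [hx, hx]
    linarith [hmono i j hij]
  · rw [hx, hx, add_left_inj]
    exact h1 i j hij
  · rw [← h2 O τ hτ]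
    simp [ProperTubeClass.spread, hx]

theorem orderInterior_nonempty (P : AffinePoset n) (hc : 0 < c) :
    (P.orderInterior c).Nonempty := by
  obtain ⟨x, hx, h, -⟩ := exists_collapsing_point (c := c) hc (isTubingFamily_empty (P := P))
  refine ⟨x, fun i j hij => lt_of_le_of_ne (hx i j (le_of_lt' hij)) fun e => ?_⟩
  obtain ⟨O, hO, -⟩ := (h i j hij).1 e
  exact hO

/-! ### The generators of the polytopes -/

/-- The vector normal to the inequality `x̃ i ≤ x̃ j` of the order polytope, for `q = (i, j)`, scaled
such that the inequality reads `⟪x - p, pairPoint c p q⟫ ≤ 1`. -/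
noncomputable def pairPoint (c : ℝ) (p : sumZero n) (q : ℤ × ℤ) : sumZero n :=
  (periodicExtension c p q.2 - periodicExtension c p q.1)⁻¹ • root n q.1 q.2

namespace ProperTubeClass

/-- The sum of `e_i - e_j` over the pairs `i ≺ j` in a tube of the class `O`. -/
noncomputable def normal (O : P.ProperTubeClass) : sumZero n := ∑ q ∈ O.edges, root n q.1 q.2

/-- The vector normal to the inequality `δ O ≤ O.spread x̃`, scaled such that the inequality reads
`⟪x - p, O.newVertex c p δ⟫ ≤ 1` if `δ O < O.spread p̃`. It is the vertex that is added when the face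
of the class `O` is subdivided. -/
noncomputable def newVertex (c : ℝ) (p : sumZero n) (δ : P.ProperTubeClass → ℝ)
    (O : P.ProperTubeClass) : sumZero n :=
  (O.spread (periodicExtension c p) - δ O)⁻¹ • O.normal

theorem inner_normal (c : ℝ) (x p : sumZero n) (O : P.ProperTubeClass) :
    inner ℝ (x - p) O.normal =
      O.spread (periodicExtension c p) - O.spread (periodicExtension c x) := by
  rw [normal, inner_sum, spread, spread, ← Finset.sum_sub_distrib]
  exact Finset.sum_congr rfl fun q _ => inner_root c x p q.1 q.2

theorem spread_pos {p : sumZero n} (hp : p ∈ P.orderInterior c) (O : P.ProperTubeClass) :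
    0 < O.spread (periodicExtension c p) :=
  Finset.sum_pos (fun _ hq => sub_pos.2 (hp _ _ (lt_of_mem_edges hq))) O.edges_nonempty

theorem inner_newVertex (c : ℝ) (x p : sumZero n) (δ : P.ProperTubeClass → ℝ)
    (O : P.ProperTubeClass) : inner ℝ (x - p) (O.newVertex c p δ) =
      (O.spread (periodicExtension c p) - δ O)⁻¹ *
      (O.spread (periodicExtension c p) - O.spread (periodicExtension c x)) := by
  rw [← inner_normal c]
  exact real_inner_smul_right (x - p) O.normal _

theorem inner_newVertex_le_one_iff {p : sumZero n} {δ : P.ProperTubeClass → ℝ}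
    {O : P.ProperTubeClass} (hδ : δ O < O.spread (periodicExtension c p)) (x : sumZero n) :
    inner ℝ (x - p) (O.newVertex c p δ) ≤ 1 ↔ δ O ≤ O.spread (periodicExtension c x) := by
  rw [inner_newVertex, inv_mul_le_one₀ (sub_pos.2 hδ)]
  constructor <;> intro h <;> linarith

theorem inner_newVertex_eq_one_iff {p : sumZero n} {δ : P.ProperTubeClass → ℝ}
    {O : P.ProperTubeClass} (hδ : δ O < O.spread (periodicExtension c p)) (x : sumZero n) :
    inner ℝ (x - p) (O.newVertex c p δ) = 1 ↔ O.spread (periodicExtension c x) = δ O := by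
  rw [inner_newVertex, inv_mul_eq_one₀ (sub_pos.2 hδ).ne']
  constructor <;> intro h <;> linarith

end ProperTubeClass

section PairPoint

variable {p : sumZero n}

theorem inner_pairPoint (c : ℝ) (x p : sumZero n) (q : ℤ × ℤ) : inner ℝ (x - p) (pairPoint c p q) =
    (periodicExtension c p q.2 - periodicExtension c p q.1)⁻¹ *
    ((periodicExtension c p q.2 - periodicExtension c p q.1) -
      (periodicExtension c x q.2 - periodicExtension c x q.1)) := by
  rw [← inner_root c]
  exact real_inner_smul_right (x - p) (root n q.1 q.2) _

theorem inner_pairPoint_le_one_iff (hp : p ∈ P.orderInterior c) {q : ℤ × ℤ}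
    (hq : P.order.lt q.1 q.2) (x : sumZero n) : inner ℝ (x - p) (pairPoint c p q) ≤ 1 ↔
      periodicExtension c x q.1 ≤ periodicExtension c x q.2 := by
  rw [inner_pairPoint, inv_mul_le_one₀ (sub_pos.2 (hp _ _ hq))]
  constructor <;> intro h <;> linarith

theorem inner_pairPoint_eq_one_iff (hp : p ∈ P.orderInterior c) {q : ℤ × ℤ}
    (hq : P.order.lt q.1 q.2) (x : sumZero n) : inner ℝ (x - p) (pairPoint c p q) = 1 ↔
      periodicExtension c x q.1 = periodicExtension c x q.2 := by
  rw [inner_pairPoint, inv_mul_eq_one₀ (sub_pos.2 (hp _ _ hq)).ne']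
  constructor <;> intro h <;> linarith

/-- The relation `0 ≺ n` contributes the zero vector. -/
theorem zero_mem_pairPoints (P : AffinePoset n) (c : ℝ) (p : sumZero n) :
    (0 : sumZero n) ∈ pairPoint c p '' P.minimalPairs := by
  refine ⟨(0, n), P.zero_n_mem_minimalPairs, ?_⟩
  have : root n 0 n = 0 := by
    apply Subtype.ext
    simp [root]
  simp [pairPoint, this]

theorem polarDual_eq_convexHull (hc : 0 < c) (hp : p ∈ P.orderInterior c) :
    polarDual (P.orderPolytope c) p = convexHull ℝ (pairPoint c p '' P.minimalPairs) := by
  apply Set.Subset.antisymm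
  · intro y hy
    refine mem_convexHull_of_polar (P.minimalPairs.finite_toSet.image _)
      (P.zero_mem_pairPoints c p) fun u hu => ?_
    have h1 : u + p ∈ P.orderPolytope c := by
      rw [mem_orderPolytope_iff hc.le]
      intro q hq
      rw [← inner_pairPoint_le_one_iff hp (lt_of_mem_minimalPairs hq), add_sub_cancel_right]
      exact hu _ ⟨q, hq, rfl⟩
    simpa using hy _ h1
  · intro y hy x hx
    refine convexHull_le_one (l := innerSL ℝ (x - p)) ?_ y hy
    rintro _ ⟨q, hq, rfl⟩
    exact (inner_pairPoint_le_one_iff hp (lt_of_mem_minimalPairs hq) x).2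
      (hx _ _ (le_of_lt' (lt_of_mem_minimalPairs hq)))

theorem zero_mem_interior_polarDual (hp : p ∈ P.orderInterior c) :
    (0 : sumZero n) ∈ interior (polarDual (P.orderPolytope c) p) := by
  obtain ⟨R, hR, h⟩ := P.exists_norm_sub_le c
  rw [mem_interior_iff_mem_nhds]
  refine Filter.mem_of_superset (Metric.ball_mem_nhds 0 (inv_pos.2 hR)) fun y hy x hx => ?_
  rw [mem_ball_zero_iff] at hy
  calc inner ℝ (x - p) y ≤ ‖x - p‖ * ‖y‖ := real_inner_le_norm _ _
    _ ≤ R * R⁻¹ := mul_le_mul (h x hx p (orderInterior_subset hp)) hy.le (norm_nonneg _) hR.le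
    _ = 1 := mul_inv_cancel₀ hR.ne'

end PairPoint

end AffinePoset

namespace AffinePoset

variable {n : ℕ} [NeZero n] {P : AffinePoset n} {c : ℝ} {p : sumZero n}

/-! ### The stages of the subdivision -/

/-- The generators of the polytope reached when the classes in `M` have been subdivided. -/
def generators (P : AffinePoset n) (c : ℝ) (p : sumZero n) (δ : P.ProperTubeClass → ℝ)
    (M : Set P.ProperTubeClass) : Set (sumZero n) :=
  pairPoint c p '' P.minimalPairs ∪ ProperTubeClass.newVertex c p δ '' M

theorem generators_finite (δ : P.ProperTubeClass → ℝ) (M : Set P.ProperTubeClass) :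
    (P.generators c p δ M).Finite :=
  (P.minimalPairs.finite_toSet.image _).union ((Set.toFinite M).image _)

theorem zero_mem_generators (δ : P.ProperTubeClass → ℝ) (M : Set P.ProperTubeClass) :
    (0 : sumZero n) ∈ P.generators c p δ M := Or.inl (P.zero_mem_pairPoints c p)

theorem zero_mem_interior_generators (hc : 0 < c) (hp : p ∈ P.orderInterior c)
    (δ : P.ProperTubeClass → ℝ) (M : Set P.ProperTubeClass) :
    (0 : sumZero n) ∈ interior (convexHull ℝ (P.generators c p δ M)) := by
  refine interior_mono ?_ (zero_mem_interior_polarDual hp)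
  rw [polarDual_eq_convexHull hc hp]
  exact convexHull_mono Set.subset_union_left

/-- The face of the dual order polytope attached to a tube is spanned by the normal vectors of the
order relations inside the tube. -/
theorem dualFace_orderFace (hc : 0 < c) (hp : p ∈ P.orderInterior c) (O : P.ProperTubeClass)
    {τ : Set ℤ} (hτ : τ ∈ O.1) : dualFace (P.orderPolytope c) p (P.orderFace c τ) =
      convexHull ℝ (pairPoint c p '' O.edges) := by
  apply Set.Subset.antisymm
  · rintro y ⟨hy, hy1⟩
    obtain ⟨x, hx, hpair, hspread⟩ := exists_collapsing_point hc (isTubingFamily_singleton O)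
    have hxτ : x ∈ P.orderFace c τ := ⟨hx,
      (ProperTubeClass.spread_eq_zero_iff (periodicExtension_add_mul c x) hx hτ).1
        ((hspread O τ hτ).2 ⟨O, rfl, τ, hτ, subset_rfl⟩)⟩
    rw [polarDual_eq_convexHull hc hp] at hy
    have hmem : y ∈ {y ∈ convexHull ℝ (pairPoint c p '' P.minimalPairs) |
        innerSL ℝ (x - p) y = 1} := ⟨hy, hy1 x hxτ⟩
    rw [convexHull_face] at hmem
    · refine convexHull_mono ?_ hmem
      rintro _ ⟨⟨q, hq, rfl⟩, hq1⟩
      have hlt := lt_of_mem_minimalPairs hq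
      obtain ⟨O', rfl, σ, hσ, h1, h2⟩ :=
        (hpair _ _ hlt).1 ((inner_pairPoint_eq_one_iff hp hlt x).1 hq1)
      exact ⟨q, ProperTubeClass.mem_edges.2 ⟨hq, σ, hσ, h1, h2⟩, rfl⟩
    · rintro _ ⟨q, hq, rfl⟩
      have hlt := lt_of_mem_minimalPairs hq
      exact (inner_pairPoint_le_one_iff hp hlt x).2 (hx _ _ (le_of_lt' hlt))
  · intro y hy
    refine ⟨?_, fun x hx => ?_⟩
    · rw [polarDual_eq_convexHull hc hp]
      exact convexHull_mono
        (Set.image_mono fun q hq => (ProperTubeClass.mem_edges.1 hq).1) hy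
    · have hone : ∀ z ∈ pairPoint c p '' O.edges, innerSL ℝ (x - p) z = 1 := by
        rintro _ ⟨q, hq, rfl⟩
        refine (inner_pairPoint_eq_one_iff hp (ProperTubeClass.lt_of_mem_edges hq) x).2 ?_
        obtain ⟨d, h1, h2⟩ := ProperTubeClass.exists_shift_of_mem_edges hτ hq
        have := hx.2 _ h1 _ h2
        rw [periodicExtension_add_mul, periodicExtension_add_mul] at this
        linarith
      have hconv : Convex ℝ {z | innerSL ℝ (x - p) z = 1} :=
        convex_hyperplane (innerSL ℝ (x - p)).isLinear 1
      exact convexHull_min (t := {z | innerSL ℝ (x - p) z = 1}) hone hconv hy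

theorem smul_normal_mem_intrinsicInterior (hp : p ∈ P.orderInterior c) (O : P.ProperTubeClass) :
    (O.spread (periodicExtension c p))⁻¹ • O.normal ∈
      intrinsicInterior ℝ (convexHull ℝ (pairPoint c p '' O.edges)) := by
  have hpos := ProperTubeClass.spread_pos hp O
  have hdiff : ∀ q ∈ O.edges, 0 < periodicExtension c p q.2 - periodicExtension c p q.1 :=
    fun q hq => sub_pos.2 (hp _ _ (ProperTubeClass.lt_of_mem_edges hq))
  have h := sum_mem_intrinsicInterior O.edges O.edges_nonempty (pairPoint c p)
    (fun q => (O.spread (periodicExtension c p))⁻¹ *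
      (periodicExtension c p q.2 - periodicExtension c p q.1))
    (fun q hq => mul_pos (inv_pos.2 hpos) (hdiff q hq)) (by
      rw [← Finset.mul_sum]
      exact inv_mul_cancel₀ hpos.ne')
  convert h using 1
  rw [ProperTubeClass.normal, Finset.smul_sum]
  refine Finset.sum_congr rfl fun q hq => ?_
  rw [pairPoint, smul_smul, mul_assoc, mul_inv_cancel₀ (hdiff q hq).ne', mul_one]

/-- Thresholds that are small enough for the classes in `M`, relative to `p` and to given points
`x O` collapsing the tubes of the class `O`. -/
structure IsAdmissible (c : ℝ) (p : sumZero n) (x : P.ProperTubeClass → sumZero n)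
    (M : Set P.ProperTubeClass) (δ : P.ProperTubeClass → ℝ) : Prop
    extends IsHierarchical M c δ where
  lt_spread : ∀ O ∈ M, δ O < O.spread (periodicExtension c p)
  lt_collapse : ∀ O ∈ M, ∀ O', O.spread (periodicExtension c (x O')) ≠ 0 →
    δ O < O.spread (periodicExtension c (x O'))

/-- As long as only faces of tubes not contained in those of the class `O` have been subdivided, the
face of `O` is still a face. -/
theorem isProperFace_stage (hp : p ∈ P.orderInterior c)
    {x : P.ProperTubeClass → sumZero n} {M : Set P.ProperTubeClass} {δ : P.ProperTubeClass → ℝ}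
    (hδ : IsAdmissible c p x M δ) (O : P.ProperTubeClass)
    (hx : x O ∈ P.orderPolytope c)
    (hpair : ∀ i j, P.order.lt i j → (periodicExtension c (x O) i = periodicExtension c (x O) j ↔
        ∃ σ ∈ O.1, i ∈ σ ∧ j ∈ σ))
    (hM : ∀ O' ∈ M, O'.spread (periodicExtension c (x O)) ≠ 0) :
    IsProperFace (convexHull ℝ (P.generators c p δ M))
      (convexHull ℝ (pairPoint c p '' O.edges)) := by
  set l : StrongDual ℝ (sumZero n) := innerSL ℝ (x O - p) with hl
  have hle : ∀ y ∈ P.generators c p δ M, l y ≤ 1 := by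
    rintro _ (⟨q, hq, rfl⟩ | ⟨O', hO', rfl⟩)
    · have hlt := lt_of_mem_minimalPairs hq
      exact (inner_pairPoint_le_one_iff hp hlt (x O)).2 (hx _ _ (le_of_lt' hlt))
    · exact (ProperTubeClass.inner_newVertex_le_one_iff (hδ.lt_spread O' hO') (x O)).2
        (hδ.lt_collapse O' hO' O (hM O' hO')).le
  have hset : {y ∈ P.generators c p δ M | l y = 1} = pairPoint c p '' O.edges := by
    ext y
    constructor
    · rintro ⟨⟨q, hq, rfl⟩ | ⟨O', hO', rfl⟩, hy1⟩
      · have hlt := lt_of_mem_minimalPairs hq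
        obtain ⟨σ, hσ, h1, h2⟩ :=
          (hpair _ _ hlt).1 ((inner_pairPoint_eq_one_iff hp hlt (x O)).1 hy1)
        exact ⟨q, ProperTubeClass.mem_edges.2 ⟨hq, σ, hσ, h1, h2⟩, rfl⟩
      · have h1 := (ProperTubeClass.inner_newVertex_eq_one_iff (hδ.lt_spread O' hO') (x O)).1 hy1
        exact absurd h1 (hδ.lt_collapse O' hO' O (hM O' hO')).ne'
    · rintro ⟨q, hq, rfl⟩
      obtain ⟨hq, hσ⟩ := ProperTubeClass.mem_edges.1 hq
      have hlt := lt_of_mem_minimalPairs hq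
      exact ⟨Or.inl ⟨q, hq, rfl⟩,
        (inner_pairPoint_eq_one_iff hp hlt (x O)).2 ((hpair _ _ hlt).2 hσ)⟩
  have := isProperFace_of_le_one (Q := convexHull ℝ (P.generators c p δ M))
    (subset_convexHull ℝ _ (zero_mem_generators δ M)) (convexHull_le_one hle)
  rwa [convexHull_face hle, hset] at this

/-- One can subdivide once more: the threshold of a class that is maximal among those not used so
far can be chosen small enough. -/
theorem exists_next_stage (hc : 0 < c) (hp : p ∈ P.orderInterior c)
    {x : P.ProperTubeClass → sumZero n} (hx : ∀ O, x O ∈ P.orderPolytope c)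
    (hpair : ∀ O i j, P.order.lt i j →
      (periodicExtension c (x O) i = periodicExtension c (x O) j ↔ ∃ σ ∈ O.1, i ∈ σ ∧ j ∈ σ))
    (hspread : ∀ (O O' : P.ProperTubeClass) (τ : Set ℤ), τ ∈ O'.1 →
      (O'.spread (periodicExtension c (x O)) = 0 ↔ ∃ σ ∈ O.1, τ ⊆ σ))
    {M : Set P.ProperTubeClass} {δ : P.ProperTubeClass → ℝ} (hδ : IsAdmissible c p x M δ)
    (hup : ∀ O ∈ M, ∀ O' : P.ProperTubeClass, ∀ τ ∈ O.1, ∀ σ ∈ O'.1, τ ⊆ σ → O' ∈ M)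
    {O : P.ProperTubeClass} (hO : O ∉ M) {τ : Set ℤ} (hτ : τ ∈ O.1) :
    ∃ d : ℝ, IsAdmissible c p x (insert O M) (Function.update δ O d) ∧
      IsStellarSubdivision (convexHull ℝ (P.generators c p δ M))
        (dualFace (P.orderPolytope c) p (P.orderFace c τ))
        (convexHull ℝ (P.generators c p (Function.update δ O d) (insert O M))) := by
  have hMO : ∀ O' ∈ M, O'.spread (periodicExtension c (x O)) ≠ 0 := by
    intro O' hO' h0
    obtain ⟨τ', hτ'⟩ := O'.nonempty
    obtain ⟨σ, hσ, hsub⟩ := (hspread O O' τ' hτ').1 h0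
    exact hO (hup O' hO' O τ' hτ' σ hσ hsub)
  set s := O.spread (periodicExtension c p) with hs
  have hs0 : 0 < s := ProperTubeClass.spread_pos hp O
  have hn : (0 : ℝ) < n := by exact_mod_cast P.order_pos
  -- conditions of the form `d < b` with `0 < b` hold for all small `d`
  have hsmall : ∀ a b : ℝ, 0 < b → ∀ᶠ d : ℝ in nhdsWithin 0 (Set.Ioi 0), a * d < b := by
    intro a b hb
    apply nhdsWithin_le_nhds
    have hcont : Continuous fun d : ℝ => a * d := by fun_prop
    have ht := hcont.tendsto 0
    simp only [mul_zero] at ht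
    exact ht.eventually_lt_const hb
  have hev1 := hsmall n c hc
  have hev2 := hsmall 1 s hs0
  have hev3 : ∀ᶠ d : ℝ in nhdsWithin 0 (Set.Ioi 0), ∀ O',
      O.spread (periodicExtension c (x O')) ≠ 0 → 1 * d < O.spread (periodicExtension c (x O')) := by
    rw [Filter.eventually_all]
    intro O'
    by_cases h : O.spread (periodicExtension c (x O')) = 0
    · exact Filter.Eventually.of_forall fun d hd => absurd h hd
    · filter_upwards [hsmall 1 _ (lt_of_le_of_ne (ProperTubeClass.spread_nonneg (hx O'))
        (Ne.symm h))] with d hd _ using hd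
  have hev4 : ∀ᶠ d : ℝ in nhdsWithin 0 (Set.Ioi 0), ∀ O' ∈ M,
      (P.minimalPairs.card * n + 1) * d < δ O' := by
    rw [Filter.eventually_all_finite (Set.toFinite M)]
    exact fun O' hO' => hsmall _ _ (hδ.pos O' hO')
  have hlim : Filter.Tendsto (fun d : ℝ => d / (s - d)) (nhdsWithin 0 (Set.Ioi 0))
      (nhdsWithin 0 (Set.Ioi 0)) := by
    rw [tendsto_nhdsWithin_iff]
    constructor
    · apply Filter.Tendsto.mono_left _ nhdsWithin_le_nhds
      have : ContinuousAt (fun d : ℝ => d / (s - d)) 0 :=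
        continuousAt_id.div (by fun_prop) (by simpa using hs0.ne')
      simpa [ContinuousAt] using this
    · filter_upwards [hev2, self_mem_nhdsWithin] with d hd hd0
      exact div_pos (show (0 : ℝ) < d from hd0) (show (0 : ℝ) < s - d by linarith)
  have hface : IsProperFace (convexHull ℝ (P.generators c p δ M))
      (convexHull ℝ (pairPoint c p '' O.edges)) :=
    isProperFace_stage hp hδ O (hx O) (hpair O) hMO
  have hFne : (convexHull ℝ (pairPoint c p '' (O.edges : Set (ℤ × ℤ)))).Nonempty :=
    (Set.Nonempty.image _ O.edges_nonempty).convexHull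
  have hev5 := hlim.eventually (eventually_stellar (generators_finite δ M)
    ⟨0, zero_mem_generators δ M⟩ (zero_mem_interior_generators hc hp δ M) hFne hface
    (smul_normal_mem_intrinsicInterior hp O))
  obtain ⟨d, h1, h2, h3, h4, h5, hd0⟩ :=
    (hev1.and (hev2.and (hev3.and (hev4.and (hev5.and self_mem_nhdsWithin))))).exists
  have hd0 : 0 < d := hd0
  refine ⟨d, ?_, ?_⟩
  · have hold : ∀ O' ∈ M, Function.update δ O d O' = δ O' := fun O' hO' =>
      Function.update_of_ne (fun h => hO (by rwa [← h])) _ _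
    have hnew : Function.update δ O d O = d := Function.update_self _ _ _
    refine ⟨⟨?_, ?_, ?_⟩, ?_, ?_⟩
    · rintro O' (rfl | hO')
      · rwa [hnew]
      · rw [hold O' hO']
        exact hδ.pos O' hO'
    · rintro O' (rfl | hO')
      · rwa [hnew]
      · rw [hold O' hO']
        exact hδ.small O' hO'
    · rintro O₁ (rfl | hO₁) O₂ (rfl | hO₂) τ₁ hτ₁ τ₂ hτ₂ hlt
      · exfalso
        obtain ⟨e, rfl⟩ := ProperTubeClass.exists_shift _ hτ₁ hτ₂
        have hcard := Set.ncard_lt_ncard hlt (ProperTubeClass.isProperTube _ hτ₂).finite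
        rw [shiftSet, Set.ncard_image_of_injective _ (add_left_injective _)] at hcard
        exact lt_irrefl _ hcard
      · rw [hnew, hold O₂ hO₂]
        exact h4 O₂ hO₂
      · exact absurd (hup O₁ hO₁ O₂ τ₁ hτ₁ τ₂ hτ₂ hlt.1) hO
      · rw [hold O₁ hO₁, hold O₂ hO₂]
        exact hδ.lt O₁ hO₁ O₂ hO₂ τ₁ hτ₁ τ₂ hτ₂ hlt
    · rintro O' (rfl | hO')
      · rw [hnew]
        linarith
      · rw [hold O' hO']
        exact hδ.lt_spread O' hO'
    · rintro O' (rfl | hO') O₂ hne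
      · rw [hnew]
        linarith [h3 O₂ hne]
      · rw [hold O' hO']
        exact hδ.lt_collapse O' hO' O₂ hne
  · rw [dualFace_orderFace hc hp O hτ]
    convert h5 using 2
    rw [generators, generators, Set.image_insert_eq, Set.union_insert]
    have e1 : ProperTubeClass.newVertex c p (Function.update δ O d) O =
        (1 + d / (s - d)) • (s⁻¹ • O.normal) := by
      rw [ProperTubeClass.newVertex, Function.update_self, smul_smul]
      congr 1
      have : s - d ≠ 0 := by linarith
      rw [← hs]
      field_simp
      ring
    have e2 : ProperTubeClass.newVertex c p (Function.update δ O d) '' M =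
        ProperTubeClass.newVertex c p δ '' M := by
      refine Set.image_congr fun O' hO' => ?_
      rw [ProperTubeClass.newVertex, ProperTubeClass.newVertex,
        Function.update_of_ne (fun h => hO (by rwa [← h]))]
    rw [e1, e2]

/-- The whole sequence of subdivisions can be carried out. -/
theorem exists_final_stage (hc : 0 < c) (hp : p ∈ P.orderInterior c) :
    ∃ δ : P.ProperTubeClass → ℝ, IsHierarchical Set.univ c δ ∧
      (∀ O, δ O < O.spread (periodicExtension c p)) ∧
      P.SubdivisionStage c p {τ | P.IsProperTube τ}
        (convexHull ℝ (P.generators c p δ Set.univ)) := by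
  choose x hx hpair hspread using fun O : P.ProperTubeClass =>
    exists_collapsing_point hc (isTubingFamily_singleton O)
  simp only [Set.mem_singleton_iff, exists_eq_left] at hpair hspread
  set good : Set (Set P.ProperTubeClass) := {M |
    (∀ O ∈ M, ∀ O' : P.ProperTubeClass, ∀ τ ∈ O.1, ∀ σ ∈ O'.1, τ ⊆ σ → O' ∈ M) ∧
    ∃ δ, IsAdmissible c p x M δ ∧
      P.SubdivisionStage c p (⋃ O ∈ M, O.1) (convexHull ℝ (P.generators c p δ M))} with hgood
  have hempty : ∅ ∈ good := by
    refine ⟨by simp, fun _ => 0, ⟨⟨by simp, by simp, by simp⟩, by simp, by simp⟩, ?_⟩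
    have h := SubdivisionStage.base (P := P) (c := c) (p := p)
    rw [polarDual_eq_convexHull hc hp] at h
    simpa [generators] using h
  obtain ⟨M, hM⟩ := (Set.toFinite good).exists_maximal ⟨∅, hempty⟩
  obtain ⟨hup, δ, hδ, hstage⟩ := hM.1
  have huniv : M = Set.univ := by
    by_contra hne
    obtain ⟨O₀, hO₀⟩ := (Set.ne_univ_iff_exists_notMem M).1 hne
    obtain ⟨τ₀, hτ₀⟩ := O₀.nonempty
    have hτ₀M : τ₀ ∉ ⋃ O ∈ M, O.1 := by
      rw [mem_biUnion_iff_tubeClass (O₀.isProperTube hτ₀), ← O₀.eq_tubeClass hτ₀]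
      exact hO₀
    obtain ⟨τ, hτmax, -⟩ := exists_maximal_properTube (P := P)
      (p := fun σ => P.IsProperTube σ ∧ σ ∉ ⋃ O ∈ M, O.1) (fun ρ h => h.1)
      (σ := τ₀) ⟨O₀.isProperTube hτ₀, hτ₀M⟩
    set O := tubeClass τ hτmax.1.1 with hO
    have hτO : τ ∈ O.1 := mem_shiftClass_self τ
    have hOM : O ∉ M := by
      rw [hO, ← mem_biUnion_iff_tubeClass]
      exact hτmax.1.2
    obtain ⟨d, hadm, hstellar⟩ := exists_next_stage hc hp hx hpair hspread hδ hup hOM hτO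
    have hins : insert O M ∈ good := by
      refine ⟨?_, Function.update δ O d, hadm, ?_⟩
      · rintro O₁ (rfl | hO₁) O₂ τ₁ hτ₁ τ₂ hτ₂ hsub
        · by_cases hO₂ : O₂ ∈ M
          · exact Or.inr hO₂
          left
          obtain ⟨e, he⟩ := O.exists_shift hτ₁ hτO
          have hmem := O₂.shift_mem hτ₂ e
          have hsub' : τ ⊆ shiftSet n τ₂ e := by
            rw [he]
            exact Set.image_mono hsub
          have hprop := O₂.isProperTube hmem
          have heq := hτmax.eq_of_le ⟨hprop, by
            rw [mem_biUnion_iff_tubeClass hprop, ← O₂.eq_tubeClass hmem]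
            exact hO₂⟩ hsub'
          exact ProperTubeClass.eq_of_mem hmem (heq ▸ hτO)
        · exact Or.inr (hup O₁ hO₁ O₂ τ₁ hτ₁ τ₂ hτ₂ hsub)
      · have := SubdivisionStage.step hstage hτmax hstellar
        rwa [Set.biUnion_insert, Set.union_comm]
    exact hOM (hM.2 hins (Set.subset_insert _ _) (Set.mem_insert _ _))
  subst huniv
  refine ⟨δ, hδ.toIsHierarchical, fun O => hδ.lt_spread O trivial, ?_⟩
  have e : (⋃ O ∈ (Set.univ : Set P.ProperTubeClass), O.1) = {τ | P.IsProperTube τ} := by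
    ext τ
    constructor
    · intro h
      obtain ⟨O, -, hτ⟩ := mem_iUnion_classes.1 h
      exact O.isProperTube hτ
    · intro h
      exact (mem_biUnion_iff_tubeClass h).2 trivial
  rwa [e] at hstage

end AffinePoset

/-! ### Isomorphisms of complexes -/

/-- An injection of the vertices of `L` into those of `K` that matches the simplices, and whose
range contains all vertices of `K`, gives an isomorphism. -/
theorem complexesIsomorphic_of_embedding {α β : Type*} {K : PreAbstractSimplicialComplex α}
    {L : PreAbstractSimplicialComplex β} (v : β ↪ α)
    (hK : ∀ S ∈ K.faces, ∀ x ∈ S, x ∈ Set.range v)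
    (hface : ∀ S : Finset β, S.map v ∈ K.faces ↔ S ∈ L.faces) : ComplexesIsomorphic K L := by
  let g : {w : β // {w} ∈ L.faces} → {x : α // {x} ∈ K.faces} := fun w =>
    ⟨v w.1, by simpa using (hface {w.1}).2 w.2⟩
  have hg : Function.Bijective g := by
    constructor
    · intro w w' h
      exact Subtype.ext (v.injective (Subtype.ext_iff.1 h))
    · rintro ⟨x, hx⟩
      obtain ⟨w, rfl⟩ := hK _ hx x (Finset.mem_singleton_self x)
      exact ⟨⟨w, (hface {w}).1 (by simpa using hx)⟩, rfl⟩
  let e := Equiv.ofBijective g hg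
  refine ⟨e.symm, fun S => ?_⟩
  rw [← hface]
  have : S.map (Function.Embedding.subtype _) =
      ((S.map e.symm.toEmbedding).map (Function.Embedding.subtype _)).map v := by
    ext x
    simp only [Finset.mem_map, Function.Embedding.subtype_apply, exists_exists_and_eq_and,
      Equiv.coe_toEmbedding]
    refine exists_congr fun y => and_congr_right fun _ => ?_
    have h : v (e.symm y).1 = y.1 := congrArg Subtype.val (e.apply_symm_apply y)
    rw [h]
  rw [this]

namespace AffinePoset

variable {n : ℕ} [NeZero n] {P : AffinePoset n} {c : ℝ} {p : sumZero n}
  {δ : P.ProperTubeClass → ℝ}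

/-! ### The boundary complex of the final polytope -/

open ProperTubeClass

/-- A nonnegative combination of the new vertices that is supported on a tubing determines its
coefficients. -/
theorem eq_of_sum_newVertex_eq (hc : 0 < c) (hδp : ∀ O, δ O < O.spread (periodicExtension c p))
    {a b : P.ProperTubeClass → ℝ} (ha0 : ∀ O, 0 ≤ a O) (hb0 : ∀ O, 0 ≤ b O)
    (ha : IsTubingFamily {O | a O ≠ 0}) (hb : IsTubingFamily {O | b O ≠ 0})
    (h : ∑ O, a O • newVertex c p δ O = ∑ O, b O • newVertex c p δ O) : a = b := by
  set r : P.ProperTubeClass → ℝ := fun O => (O.spread (periodicExtension c p) - δ O)⁻¹ with hr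
  have hr0 : ∀ O, 0 < r O := fun O => inv_pos.2 (sub_pos.2 (hδp O))
  have hsupp : ∀ u : P.ProperTubeClass → ℝ, {O | u O * r O ≠ 0} = {O | u O ≠ 0} := by
    intro u
    ext O
    simp [(hr0 O).ne']
  have hinner : ∀ (u : P.ProperTubeClass → ℝ) (x : sumZero n),
      inner ℝ (x - p) (∑ O, u O • newVertex c p δ O) =
        ∑ O, u O * r O * O.spread (periodicExtension c p) -
        ∑ O, u O * r O * O.spread (periodicExtension c x) := by
    intro u x
    rw [inner_sum, ← Finset.sum_sub_distrib]
    refine Finset.sum_congr rfl fun O _ => ?_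
    have h1 : inner ℝ (x - p) (u O • newVertex c p δ O) =
        u O * inner ℝ (x - p) (newVertex c p δ O) :=
      real_inner_smul_right (x - p) (newVertex c p δ O) (u O)
    rw [h1, inner_newVertex]
    ring
  have key := IsTubingFamily.eq_of_spread_identity hc _ (a := fun O => a O * r O)
    (b := fun O => b O * r O) (fun O => mul_nonneg (ha0 O) (hr0 O).le)
    (fun O => mul_nonneg (hb0 O) (hr0 O).le) (by rwa [hsupp a]) (by rwa [hsupp b])
    (k := ∑ O, a O * r O * O.spread (periodicExtension c p) -
      ∑ O, b O * r O * O.spread (periodicExtension c p)) (fun f hf => by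
        obtain ⟨x, t, hx⟩ := exists_periodicExtension_eq hf
        have e : ∀ O : P.ProperTubeClass, O.spread (periodicExtension c x) = O.spread f := by
          intro O
          simp [spread, hx]
        have h1 := hinner a x
        have h2 := hinner b x
        rw [h] at h1
        simp only [e] at h1 h2
        linarith) le_rfl
  funext O
  exact mul_right_cancel₀ (hr0 O).ne' (congrFun key O)

theorem newVertex_injective (hc : 0 < c) (hδp : ∀ O, δ O < O.spread (periodicExtension c p)) :
    Function.Injective (newVertex (P := P) c p δ) := by
  intro O O' h
  have hsupp : ∀ O : P.ProperTubeClass,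
      {O' | (Pi.single O 1 : P.ProperTubeClass → ℝ) O' ≠ 0} = {O} := by
    intro O
    ext O'
    simp [Pi.single_apply]
  have hnn : ∀ O O' : P.ProperTubeClass, 0 ≤ (Pi.single O 1 : P.ProperTubeClass → ℝ) O' := by
    intro O O'
    rw [Pi.single_apply]
    split_ifs <;> norm_num
  have hsum : ∀ O : P.ProperTubeClass, ∑ O', (Pi.single O 1 : P.ProperTubeClass → ℝ) O' •
      newVertex c p δ O' = newVertex c p δ O := by
    intro O
    simp [Pi.single_apply]
  have key := eq_of_sum_newVertex_eq hc hδp (hnn O) (hnn O')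
    (by rw [hsupp]; exact isTubingFamily_singleton O)
    (by rw [hsupp]; exact isTubingFamily_singleton O') (by rw [hsum, hsum, h])
  have := congrFun key O
  rw [Pi.single_eq_same, Pi.single_apply] at this
  by_contra hne
  rw [if_neg hne] at this
  exact one_ne_zero this

/-- The new vertices of a tubing are linearly independent: split a linear relation into its positive
and its negative part. -/
theorem linearIndepOn_newVertex (hc : 0 < c) (hδp : ∀ O, δ O < O.spread (periodicExtension c p))
    (A : Finset P.ProperTubeClass) (hA : IsTubingFamily (A : Set P.ProperTubeClass)) :
    LinearIndepOn ℝ (newVertex c p δ) (A : Set P.ProperTubeClass) := by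
  rw [linearIndepOn_finset_iff]
  intro g hg
  set a : P.ProperTubeClass → ℝ := fun O => if O ∈ A then max (g O) 0 else 0 with ha
  set b : P.ProperTubeClass → ℝ := fun O => if O ∈ A then max (-g O) 0 else 0 with hb
  have hab : ∀ O, a O - b O = if O ∈ A then g O else 0 := by
    intro O
    simp only [ha, hb]
    split_ifs
    · exact max_zero_sub_max_neg_zero_eq_self (g O)
    · simp
  have h : ∑ O, a O • newVertex c p δ O = ∑ O, b O • newVertex c p δ O := by
    rw [← sub_eq_zero, ← Finset.sum_sub_distrib]
    simp only [← sub_smul, hab, ite_smul, zero_smul]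
    rw [Finset.sum_ite_mem, Finset.univ_inter]
    exact hg
  have hsuppa : {O | a O ≠ 0} ⊆ (A : Set P.ProperTubeClass) := by
    intro O hO
    by_contra hOA
    exact hO (if_neg hOA)
  have hsuppb : {O | b O ≠ 0} ⊆ (A : Set P.ProperTubeClass) := by
    intro O hO
    by_contra hOA
    exact hO (if_neg hOA)
  have key := eq_of_sum_newVertex_eq hc hδp (a := a) (b := b)
    (fun O => by simp only [ha]; split_ifs; exacts [le_max_right _ _, le_rfl])
    (fun O => by simp only [hb]; split_ifs; exacts [le_max_right _ _, le_rfl])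
    (hA.mono hsuppa) (hA.mono hsuppb) h
  intro O hO
  have := hab O
  rw [key, sub_self, if_pos hO] at this
  exact this.symm

/-- The functionals bounded by `1` on the final polytope correspond to the points of the order
polytope at which all spreads are at least the thresholds. The face cut out by such a functional is
spanned by the new vertices that it contains, and these come from a tubing. -/
theorem face_eq_convexHull_newVertex (hc : 0 < c) (hp : p ∈ P.orderInterior c)
    (hδ : IsHierarchical Set.univ c δ) (hδp : ∀ O, δ O < O.spread (periodicExtension c p))
    {l : StrongDual ℝ (sumZero n)}
    (hl : ∀ y ∈ convexHull ℝ (P.generators c p δ Set.univ), l y ≤ 1) :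
    IsTubingFamily {O | l (newVertex c p δ O) = 1} ∧
      {y ∈ convexHull ℝ (P.generators c p δ Set.univ) | l y = 1} =
        convexHull ℝ (newVertex c p δ '' {O | l (newVertex c p δ O) = 1}) := by
  set x : sumZero n := (InnerProductSpace.toDual ℝ (sumZero n)).symm l + p with hx
  have hlx : ∀ y, l y = inner ℝ (x - p) y := by
    intro y
    rw [hx, add_sub_cancel_right, InnerProductSpace.toDual_symm_apply]
  have hgen : ∀ y ∈ P.generators c p δ Set.univ, l y ≤ 1 := fun y hy =>
    hl y (subset_convexHull ℝ _ hy)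
  have hxO : x ∈ P.orderPolytope c := by
    rw [mem_orderPolytope_iff hc.le]
    intro q hq
    rw [← inner_pairPoint_le_one_iff hp (lt_of_mem_minimalPairs hq), ← hlx]
    exact hgen _ (Or.inl ⟨q, hq, rfl⟩)
  have hfeas : ∀ O : P.ProperTubeClass, δ O ≤ O.spread (periodicExtension c x) := by
    intro O
    rw [← inner_newVertex_le_one_iff (hδp O), ← hlx]
    exact hgen _ (Or.inr ⟨O, trivial, rfl⟩)
  have hset : {O | l (newVertex c p δ O) = 1} =
      {O : P.ProperTubeClass | O.spread (periodicExtension c x) = δ O} := by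
    ext O
    simp only [Set.mem_ofPred_eq]
    rw [hlx, inner_newVertex_eq_one_iff (hδp O)]
  refine ⟨?_, ?_⟩
  · rw [hset]
    exact isTubingFamily_tight hδ (periodicExtension_add_mul c x) hxO hfeas
  · rw [convexHull_face hgen]
    congr 1
    ext y
    constructor
    · rintro ⟨⟨q, hq, rfl⟩ | ⟨O, -, rfl⟩, hy⟩
      · have hlt := lt_of_mem_minimalPairs hq
        rw [hlx, inner_pairPoint_eq_one_iff hp hlt] at hy
        exact absurd hy
          (lt_of_feasible hc hδ (periodicExtension_add_mul c x) hxO hfeas hlt).ne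
      · exact ⟨O, hy, rfl⟩
    · rintro ⟨O, hO, rfl⟩
      exact ⟨Or.inr ⟨O, trivial, rfl⟩, hO⟩

/-- The new vertices of a tubing lie on a common proper face: follow the ray through their sum until
it leaves the polytope. -/
theorem exists_face_of_tubing (hc : 0 < c) (hp : p ∈ P.orderInterior c)
    (hδ : IsHierarchical Set.univ c δ) (hδp : ∀ O, δ O < O.spread (periodicExtension c p))
    (A : Finset P.ProperTubeClass) (hne : A.Nonempty)
    (hA : IsTubingFamily (A : Set P.ProperTubeClass)) :
    ∃ l : StrongDual ℝ (sumZero n),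
      (∀ y ∈ convexHull ℝ (P.generators c p δ Set.univ), l y ≤ 1) ∧
      ∀ O ∈ A, l (newVertex c p δ O) = 1 := by
  have hind : ∀ r : ℝ, r ≠ 0 → {O | (if O ∈ A then r else 0) ≠ 0} =
      (A : Set P.ProperTubeClass) := by
    intro r hr
    ext O
    simp [hr]
  have hnn : ∀ r : ℝ, 0 < r → ∀ O : P.ProperTubeClass, 0 ≤ if O ∈ A then r else 0 := by
    intro r hr O
    split_ifs
    exacts [hr.le, le_rfl]
  have hsum : ∀ r : ℝ, ∑ O, (if O ∈ A then r else 0) • newVertex c p δ O =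
      r • ∑ O ∈ A, newVertex c p δ O := by
    intro r
    simp only [ite_smul, zero_smul]
    rw [Finset.sum_ite_mem, Finset.univ_inter, Finset.smul_sum]
  have hy0 : ∑ O ∈ A, newVertex c p δ O ≠ 0 := by
    intro h0
    have key := eq_of_sum_newVertex_eq hc hδp (hnn 1 one_pos) (b := 0) (fun _ => le_rfl)
      (by rwa [hind 1 one_ne_zero]) (by simpa using isTubingFamily_empty)
      (by rw [hsum, h0]; simp)
    obtain ⟨O, hO⟩ := hne
    simpa [hO] using congrFun key O
  obtain ⟨r, hr, l, hl, hmem, hl1⟩ := exists_smul_mem_face (convex_convexHull ℝ _)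
    ((generators_finite δ Set.univ).isCompact_convexHull ℝ)
    (zero_mem_interior_generators hc hp δ Set.univ) hy0
  refine ⟨l, hl, ?_⟩
  obtain ⟨htub, hface⟩ := face_eq_convexHull_newVertex hc hp hδ hδp hl
  have hyF : r • ∑ O ∈ A, newVertex c p δ O ∈
      {y ∈ convexHull ℝ (P.generators c p δ Set.univ) | l y = 1} := ⟨hmem, hl1⟩
  rw [hface] at hyF
  classical
  obtain ⟨w, hw0, hwt, -, hwsum⟩ := exists_weights
    (Finset.univ.filter fun O => l (newVertex c p δ O) = 1) (newVertex c p δ)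
    (by simpa using hyF)
  have hwsupp : {O | w O ≠ 0} ⊆ {O | l (newVertex c p δ O) = 1} := by
    intro O hO
    by_contra hcon
    exact hO (hwt O (by simpa using hcon))
  have hwsum' : ∑ O, w O • newVertex c p δ O = r • ∑ O ∈ A, newVertex c p δ O := by
    rw [← hwsum]
    symm
    refine Finset.sum_subset (Finset.subset_univ _) fun O _ hO => ?_
    rw [hwt O hO, zero_smul]
  have key := eq_of_sum_newVertex_eq hc hδp hw0 (hnn r hr) (htub.mono hwsupp)
    (by rwa [hind r hr.ne']) (by rw [hwsum', hsum])
  intro O hO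
  refine hwsupp (show w O ≠ 0 from ?_)
  rw [key]
  simpa [hO] using hr.ne'

theorem newVertex_mem_extremePoints (hc : 0 < c) (hp : p ∈ P.orderInterior c)
    (hδ : IsHierarchical Set.univ c δ) (hδp : ∀ O, δ O < O.spread (periodicExtension c p))
    (O : P.ProperTubeClass) : newVertex c p δ O ∈
      (convexHull ℝ (P.generators c p δ Set.univ)).extremePoints ℝ := by
  classical
  obtain ⟨l, hl, hl1⟩ := exists_face_of_tubing hc hp hδ hδp {O} (Finset.singleton_nonempty O)
    (by simpa using isTubingFamily_singleton O)
  have hl1 := hl1 O (Finset.mem_singleton_self O)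
  obtain ⟨htub, hface⟩ := face_eq_convexHull_newVertex hc hp hδ hδp hl
  have hrep : ∀ y ∈ convexHull ℝ (P.generators c p δ Set.univ), l y = 1 →
      ∃ w : P.ProperTubeClass → ℝ, (∀ k, 0 ≤ w k) ∧
        {O | w O ≠ 0} ⊆ {O | l (newVertex c p δ O) = 1} ∧
        ∑ k, w k = 1 ∧ ∑ k, w k • newVertex c p δ k = y := by
    intro y hy hy1
    have hyF : y ∈ {y ∈ convexHull ℝ (P.generators c p δ Set.univ) | l y = 1} := ⟨hy, hy1⟩
    rw [hface] at hyF
    obtain ⟨w, hw0, hwt, hw1, hwsum⟩ := exists_weights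
      (Finset.univ.filter fun O => l (newVertex c p δ O) = 1) (newVertex c p δ)
      (by simpa using hyF)
    refine ⟨w, hw0, fun O hO => ?_, ?_, ?_⟩
    · by_contra hcon
      exact hO (hwt O (by simpa using hcon))
    · rw [← hw1]
      symm
      exact Finset.sum_subset (Finset.subset_univ _) fun O _ hO => hwt O hO
    · rw [← hwsum]
      symm
      refine Finset.sum_subset (Finset.subset_univ _) fun O _ hO => ?_
      rw [hwt O hO, zero_smul]
  rw [mem_extremePoints_iff_left]
  refine ⟨subset_convexHull ℝ _ (Or.inr ⟨O, trivial, rfl⟩), ?_⟩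
  rintro y hy z hz ⟨s, t, hs, ht, hst, hyz⟩
  have hly := hl y hy
  have hlz := hl z hz
  have e : s * l y + t * l z = 1 := by
    rw [← hl1, ← hyz]
    simp
  have hy1 : l y = 1 := by nlinarith
  have hz1 : l z = 1 := by nlinarith
  obtain ⟨u, hu0, husupp, hu1, rfl⟩ := hrep y hy hy1
  obtain ⟨w, hw0, hwsupp, hw1, rfl⟩ := hrep z hz hz1
  have hsupp : {O' | (Pi.single O 1 : P.ProperTubeClass → ℝ) O' ≠ 0} = {O} := by
    ext O'
    simp [Pi.single_apply]
  have key := eq_of_sum_newVertex_eq hc hδp (a := fun k => s * u k + t * w k)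
    (b := Pi.single O 1)
    (fun k => add_nonneg (mul_nonneg hs.le (hu0 k)) (mul_nonneg ht.le (hw0 k)))
    (fun k => by rw [Pi.single_apply]; split_ifs <;> norm_num)
    (htub.mono (fun k hk => by
      by_cases h1 : u k = 0
      · by_cases h2 : w k = 0
        · exact absurd (by simp [h1, h2]) hk
        · exact hwsupp h2
      · exact husupp h1))
    (by rw [hsupp]; exact isTubingFamily_singleton O) (by
      have e1 : ∑ k, (Pi.single O 1 : P.ProperTubeClass → ℝ) k • newVertex c p δ k =
          newVertex c p δ O := by simp [Pi.single_apply]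
      rw [e1, ← hyz]
      simp only [add_smul, mul_smul, Finset.sum_add_distrib, Finset.smul_sum])
  have hzero : ∀ k, k ≠ O → u k = 0 := by
    intro k hk
    have h1 := congrFun key k
    rw [Pi.single_eq_of_ne hk] at h1
    have h2 := mul_nonneg hs.le (hu0 k)
    have h3 := mul_nonneg ht.le (hw0 k)
    have h4 : s * u k = 0 := by linarith
    exact (mul_eq_zero.1 h4).resolve_left hs.ne'
  have huO : u O = 1 := by
    rw [← hu1]
    symm
    exact Finset.sum_eq_single O (fun k _ hk => hzero k hk) (by simp)
  rw [Finset.sum_eq_single O (fun k _ hk => by rw [hzero k hk, zero_smul]) (by simp), huO, one_smul]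

theorem isSimplicialPolytope_final (hc : 0 < c) (hp : p ∈ P.orderInterior c)
    (hδ : IsHierarchical Set.univ c δ) (hδp : ∀ O, δ O < O.spread (periodicExtension c p)) :
    IsSimplicialPolytope (convexHull ℝ (P.generators c p δ Set.univ)) := by
  classical
  refine ⟨⟨(generators_finite (c := c) (p := p) δ Set.univ).toFinset, ?_, by simp⟩, fun F hF => ?_⟩
  · simpa using ⟨0, zero_mem_generators δ Set.univ⟩
  rcases F.eq_empty_or_nonempty with rfl | hne
  · exact ⟨∅, affineIndependent_of_subsingleton ℝ _, by simp⟩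
  obtain ⟨l, hl, rfl⟩ :=
    hF.exists_functional (zero_mem_interior_generators hc hp δ Set.univ) hne
  obtain ⟨htub, hface⟩ := face_eq_convexHull_newVertex hc hp hδ hδp hl
  set A : Finset P.ProperTubeClass := Finset.univ.filter fun O => l (newVertex c p δ O) = 1 with hA
  have hAset : (A : Set P.ProperTubeClass) = {O | l (newVertex c p δ O) = 1} := by simp [hA]
  refine ⟨A.image (newVertex c p δ), ?_, ?_⟩
  · have h1 := (linearIndepOn_newVertex hc hδp A (by rwa [hAset])).affineIndependent.range
    have e : Set.range (fun O : (A : Set P.ProperTubeClass) => newVertex c p δ O) =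
        ((A.image (newVertex c p δ) : Finset (sumZero n)) : Set (sumZero n)) := by
      ext y
      simp
    rw [e] at h1
    exact h1
  · rw [hface, Finset.coe_image, hAset]

theorem complexesIsomorphic_final (hc : 0 < c) (hp : p ∈ P.orderInterior c)
    (hδ : IsHierarchical Set.univ c δ) (hδp : ∀ O, δ O < O.spread (periodicExtension c p)) :
    ComplexesIsomorphic (boundaryComplex (convexHull ℝ (P.generators c p δ Set.univ)))
      P.cyclohedronComplex.toPreAbstractSimplicialComplex := by
  have h0 := zero_mem_interior_generators hc hp δ Set.univ
  refine complexesIsomorphic_of_embedding ⟨newVertex c p δ, newVertex_injective hc hδp⟩ ?_ ?_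
  · rintro S ⟨-, hext, F, hF, hSF⟩ x hx
    obtain ⟨l, hl, rfl⟩ := hF.exists_functional h0 ⟨x, hSF hx⟩
    obtain ⟨-, hface⟩ := face_eq_convexHull_newVertex hc hp hδ hδp hl
    have hxF := hSF hx
    have hx' := inter_extremePoints_subset_extremePoints_of_subset
      (fun y hy => hy.1) (show x ∈ _ ∩ _ from ⟨hxF, hext hx⟩)
    rw [hface] at hx'
    obtain ⟨O, -, hO⟩ := extremePoints_convexHull_subset hx'
    exact ⟨O, hO⟩
  · intro S
    have hcyc : S ∈ P.cyclohedronComplex.faces ↔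
        S.Nonempty ∧ IsTubingFamily (S : Set P.ProperTubeClass) := Iff.rfl
    constructor
    · rintro ⟨hne, -, F, hF, hSF⟩
      have hne' : S.Nonempty := Finset.map_nonempty.1 hne
      have hmem : ∀ O ∈ S, newVertex c p δ O ∈ F := fun O hO =>
        hSF (Finset.mem_coe.2 (Finset.mem_map.2 ⟨O, hO, rfl⟩))
      obtain ⟨O, hO⟩ := hne'
      obtain ⟨l, hl, rfl⟩ := hF.exists_functional h0 ⟨_, hmem O hO⟩
      exact hcyc.2 ⟨⟨O, hO⟩,
        (face_eq_convexHull_newVertex hc hp hδ hδp hl).1.mono fun O hO => (hmem O hO).2⟩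
    · intro h
      obtain ⟨hne, htub⟩ := hcyc.1 h
      obtain ⟨l, hl, hl1⟩ := exists_face_of_tubing hc hp hδ hδp S hne htub
      refine ⟨Finset.map_nonempty.2 hne, ?_, _, isProperFace_of_le_one (interior_subset h0) hl, ?_⟩
      · intro y hy
        obtain ⟨O, -, rfl⟩ := Finset.mem_map.1 (Finset.mem_coe.1 hy)
        exact newVertex_mem_extremePoints hc hp hδ hδp O
      · intro y hy
        obtain ⟨O, hO, rfl⟩ := Finset.mem_map.1 (Finset.mem_coe.1 hy)
        exact ⟨subset_convexHull ℝ _ (Or.inr ⟨O, trivial, rfl⟩), hl1 O hO⟩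

theorem polytopeDim_final (hc : 0 < c) (hp : p ∈ P.orderInterior c) :
    polytopeDim (convexHull ℝ (P.generators c p δ Set.univ)) + 1 = n := by
  have h : affineSpan ℝ (convexHull ℝ (P.generators c p δ Set.univ)) = ⊤ := by
    rw [affineSpan_convexHull]
    exact affineSpan_eq_top_of_nonempty_interior
      ⟨0, zero_mem_interior_generators hc hp δ Set.univ⟩
  rw [polytopeDim, ← direction_affineSpan, h, AffineSubspace.direction_top, finrank_top]
  exact finrank_sumZero

end AffinePoset

theorem mainTheorem3 (n : ℕ) [NeZero n] (P : AffinePoset n) (c : ℝ) (hc : 0 < c) :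
    (P.orderInterior c).Nonempty ∧
    ∀ p ∈ P.orderInterior c, ∃ C : Set (sumZero n),
      IsSimplicialPolytope C ∧ polytopeDim C + 1 = n ∧
      ComplexesIsomorphic (boundaryComplex C)
        P.cyclohedronComplex.toPreAbstractSimplicialComplex ∧
      P.SubdivisionStage c p {τ | P.IsProperTube τ} C := by
  refine ⟨P.orderInterior_nonempty hc, fun p hp => ?_⟩
  obtain ⟨δ, hδ, hδp, hstage⟩ := AffinePoset.exists_final_stage hc hp
  exact ⟨_, AffinePoset.isSimplicialPolytope_final hc hp hδ hδp,
    AffinePoset.polytopeDim_final hc hp, AffinePoset.complexesIsomorphic_final hc hp hδ hδp, hstage⟩
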